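/- **Setting.** Write $\mathbb T=\mathbb R/\mathbb Z$. A long knot diagram $D$ is a one-component plane diagram with one end at left infinity and one at right infinity, oriented from right to left, drawn in general position with respect to the vertical direction, and recorded by its sequence of births, deaths and crossings from left to right. Let $C_D$ be its set of crossings. Its *bridges* (the set $B_D$) are the maximal arcs that only over-pass, and its *segments* are the edges of the underlying four-valent graph. Put $A_D=\mathbb Z[B_D,\epsilon]$ with $2\epsilon=1$. At a crossing $c$ let $\alpha$ and $\gamma$ be the incoming and the outgoing under-passing segment, and let $\beta$ and $\delta$ be the over-passing segments on the left and on the right of the under-passing direction; the same letters denote the elements assigned to these segments. An *admissible assignment* assigns to each segment of a bridge $x$ an element $x+m\epsilon$ with $m\in\mathbb Z$, such that: at every crossing $\beta=\delta+\epsilon$; at every crossing, if $\alpha=x+m\epsilon$ and $\gamma=y+n\epsilon$ for bridges $x,y$, then $m+n$ is odd; and $m=0$ on the two infinite segments. For each crossing $c$ draw a half-line vertically downwards from a point (the *bridge vertex*) on the segment $\alpha$ next to $c$. Number its intersections with $D$ from below by $1,\dots,k_c$; the bridge vertex itself is counted as an intersection exactly when $D$ is directed to the right there. The half-line carries the auxiliary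 element $a_c=(-1)^{k_c}(\alpha+\gamma-\beta-\delta)$. The *action functional* is $$S_D=\sum_{c\in C_D}m_c+\sum_{c\in C_D}\sum_{k=1}^{k_c}(-1)^k(\alpha_{c,k}-\epsilon)\,a_c\in A_D,$$ where $\alpha_{c,k}$ is the element of the segment met at the $k$-th intersection of the half-line of $c$, and where $m_c=(\beta-\gamma)\delta$ if the over-passing strand crosses from the left to the right of the under-passing one, and $m_c=(\delta-\gamma)\delta$ otherwise. Let $\tilde F_D\subset\mathbb R^{B_D}$ be the set of real values of the bridge variables at which all $a_c$ are integers, and let $F_D\subset\mathbb T^{B_D}$ be its image. Let $\tilde X_2$ be the double cyclic cover of the knot complement, so that $H_1(\tilde X_2)$ is the abelianization of the kernel of the homomorphism from the knot group (in its Wirtinger presentation) to $\mathbb Z/2$ which sends every meridian to $1$. **Theorem.** Admissible assignments exist for every long knot diagram $D$, and $F_D$ does not depend on the choice of one. Let $\mu_b$ be the meridian of the bridge $b$ and $\mu_0$ the meridian of the right infinite bridge; then $\varphi\mapsto(\varphi([\mu_b\mu_0]))_{b\in B_D}$ is a bijection from $H^1(\tilde X_2,\mathbb T)=\operatorname{Hom}(H_1(\tilde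 X_2),\mathbb T)$ onto $F_D$. There are functions $f_D:F_D\to\{z\in\mathbb C:|z|=1\}$, one for each long knot diagram $D$, such that: 1. For every admissible assignment on $D$ and every $x\in\tilde F_D$ with image $\xi\in F_D$, one has $e^{2\pi i S_D(x)}=f_D(\xi)$. 2. If $D$ and $D'$ differ by a Reidemeister move (of type 1, 2 or 3, or a planar isotopy move), then the relation "$\xi$ and $\xi'$ have the same values at all points outside of the region of the move" is a bijection from $F_D$ to $F_{D'}$, and $f_D(\xi)=f_{D'}(\xi')$ for corresponding $\xi,\xi'$. 3. $f_D$ does not depend on the image of the free generator of $H_1(\tilde X_2)$: if $\varphi,\psi\in\operatorname{Hom}(H_1(\tilde X_2),\mathbb T)$ agree on the torsion subgroup of $H_1(\tilde X_2)$, then $f_D$ takes the same value at the corresponding elements of $F_D$. -/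

import Mathlib

/-!
Long knot diagrams are drawn in the plane in general position with respect to the vertical
direction. Sweeping the plane by a vertical line from left to right, such a diagram is a finite
sequence of elementary events (births and deaths of pairs of strands, and crossings). Between two
consecutive events the vertical line meets the diagram in finitely many points, which are numbered
from below, starting with 0.
-/

namespace LongKnot

/-- An elementary event of the left-to-right sweep.
* `birth i d`: a left-most turning point; two new strands appear at positions `i` and `i + 1`,
  and the lower one is directed to the right iff `d = true` (the upper one is directed oppositely).
* `death i`: a right-most turning point; the strands at positions `i` and `i + 1` are joined.
* `cross i o`: the strands at positions `i` and `i + 1` cross. The strand going up (from position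
  `i` to position `i + 1`) is the over-passing one iff `o = true`. -/
inductive Event : Type
  | birth (i : ℕ) (d : Bool) : Event
  | death (i : ℕ) : Event
  | cross (i : ℕ) (o : Bool) : Event

/-- The event `e` is possible if the directions of the strands just before it, listed from below
(`true` means directed to the right), are `s`. -/
def Event.Fits : Event → List Bool → Prop
  | .birth i _, s => i ≤ s.length
  | .death i, s => ∃ d : Bool, s[i]? = some d ∧ s[i + 1]? = some (!d)
  | .cross i _, s => i + 1 < s.length

/-- The directions of the strands, listed from below, just after an event. -/
def Event.act : Event → List Bool → List Bool
  | .birth i d, s => s.take i ++ d :: (!d) :: s.drop i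
  | .death i, s => s.take i ++ s.drop (i + 2)
  | .cross i _, s => s.take i ++ ((s.drop i).take 2).reverse ++ s.drop (i + 2)

/-- The directions of the strands, listed from below, met by the sweeping line after the first `t`
events. At the far left there is one strand, directed to the left. -/
def slice (w : List Event) (t : ℕ) : List Bool :=
  (w.take t).foldl (fun s e => e.act s) [false]

/-- A sample point of the diagram: the point at height number `pos` on the vertical line number
`col`, which lies between the events number `col - 1` and `col`. -/
@[ext] structure Pt (w : List Event) : Type where
  col : ℕ
  pos : ℕ
  col_le : col ≤ w.length
  pos_lt : pos < (slice w col).length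

/-- How two neighbouring sample points can be joined by an arc of the diagram: by an arc without
crossings, by an arc which over-passes at one crossing, or by one which under-passes there. -/
inductive Kind : Type
  | plain | over | under

/-- The arcs of the diagram which run between the vertical lines number `t` and `t + 1`, when the
event between these is `e`. Points are written as pairs (number of the line, height number). -/
inductive Joins (t : ℕ) : Event → Kind → ℕ × ℕ → ℕ × ℕ → Prop
  | birth_turn (i : ℕ) (d : Bool) : Joins t (.birth i d) .plain (t + 1, i) (t + 1, i + 1)
  | birth_below (i j : ℕ) (d : Bool) (h : j < i) : Joins t (.birth i d) .plain (t, j) (t + 1, j)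
  | birth_above (i j : ℕ) (d : Bool) (h : i ≤ j) :
      Joins t (.birth i d) .plain (t, j) (t + 1, j + 2)
  | death_turn (i : ℕ) : Joins t (.death i) .plain (t, i) (t, i + 1)
  | death_below (i j : ℕ) (h : j < i) : Joins t (.death i) .plain (t, j) (t + 1, j)
  | death_above (i j : ℕ) (h : i ≤ j) : Joins t (.death i) .plain (t, j + 2) (t + 1, j)
  | cross_below (i j : ℕ) (o : Bool) (h : j < i) : Joins t (.cross i o) .plain (t, j) (t + 1, j)
  | cross_above (i j : ℕ) (o : Bool) (h : i + 2 ≤ j) :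
      Joins t (.cross i o) .plain (t, j) (t + 1, j)
  | cross_up (i : ℕ) (o : Bool) :
      Joins t (.cross i o) (if o then .over else .under) (t, i) (t + 1, i + 1)
  | cross_down (i : ℕ) (o : Bool) :
      Joins t (.cross i o) (if o then .under else .over) (t, i + 1) (t + 1, i)

/-- Two sample points are joined by an elementary arc of the given kind. -/
def Link {w : List Event} (k : Kind) (p q : Pt w) : Prop :=
  ∃ (t : ℕ) (e : Event), w[t]? = some e ∧ Joins t e k (p.col, p.pos) (q.col, q.pos)

/-- A long knot diagram: every event is possible at its place, there is one strand, directed to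
the left, at the far right (and at the far left, by the definition of `slice`), and the diagram
consists of a single curve. -/
structure LongDiagram : Type where
  word : List Event
  fits : ∀ (t : ℕ) (h : t < word.length), (word[t]).Fits (slice word t)
  last : slice word word.length = [false]
  connected : ∀ p q : Pt word, Relation.EqvGen (fun a b => ∃ k, Link k a b) p q

theorem slice_succ (w : List Event) (t : ℕ) (h : t < w.length) :
    slice w (t + 1) = (w[t]).act (slice w t) := by
  unfold slice
  rw [List.take_add_one, List.foldl_append, List.getElem?_eq_getElem h]
  simp

theorem length_act_cross (i : ℕ) (o : Bool) (s : List Bool) :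
    ((Event.cross i o).act s).length = s.length := by
  simp only [Event.act, List.length_append, List.length_take, List.length_reverse,
    List.length_drop]
  omega

/-- The four ends at a crossing: lower left, upper left, lower right, upper right. -/
inductive Corner : Type
  | sw | nw | se | ne
  deriving DecidableEq

/-- The opposite corner. -/
def Corner.opp : Corner → Corner
  | .sw => .ne
  | .nw => .se
  | .se => .nw
  | .ne => .sw

/-- The next corner in counterclockwise direction. -/
def Corner.ccw : Corner → Corner
  | .sw => .se
  | .se => .ne
  | .ne => .nw
  | .nw => .sw

namespace LongDiagram

variable (D : LongDiagram)

/-- The sample points of the diagram. -/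
abbrev Point : Type := Pt D.word

/-- Whether the diagram is directed to the right at the given sample point. -/
def toRight {D : LongDiagram} (p : D.Point) : Bool :=
  (slice D.word p.col)[p.pos]'p.pos_lt

/-- The left infinite end, where the long knot ends. -/
def leftEnd : D.Point := ⟨0, 0, Nat.zero_le _, by simp [slice]⟩

/-- The right infinite end, where the long knot begins. -/
def rightEnd : D.Point := ⟨D.word.length, 0, le_rfl, by simp [D.last]⟩

/-- The bridges: maximal arcs of the diagram which pass only over at crossings. -/
def Bridge : Type := Quot (fun p q : D.Point => Link .plain p q ∨ Link .over p q)

/-- The bridge through a sample point. -/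
def bridge {D : LongDiagram} (p : D.Point) : D.Bridge := Quot.mk _ p

/-- The segments: the edges of the underlying four-valent graph. -/
def Segment : Type := Quot (fun p q : D.Point => Link .plain p q)

/-- The segment through a sample point. -/
def segment {D : LongDiagram} (p : D.Point) : D.Segment := Quot.mk _ p

/-- The crossings of the diagram. -/
@[ext] structure Crossing : Type where
  time : ℕ
  idx : ℕ
  upOver : Bool
  isCross : D.word[time]? = some (.cross idx upOver)

namespace Crossing

variable {D : LongDiagram} (c : D.Crossing)

theorem time_lt : c.time < D.word.length := by
  have h := c.isCross
  rw [List.getElem?_eq_some_iff] at h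
  exact h.1

theorem word_time : D.word[c.time]'c.time_lt = .cross c.idx c.upOver := by
  have h := c.isCross
  rw [List.getElem?_eq_some_iff] at h
  exact h.2

theorem idx_lt : c.idx + 1 < (slice D.word c.time).length := by
  have h := D.fits c.time c.time_lt
  rw [c.word_time] at h
  exact h

theorem idx_lt_succ : c.idx + 1 < (slice D.word (c.time + 1)).length := by
  rw [slice_succ _ _ c.time_lt, c.word_time, length_act_cross]
  exact c.idx_lt

theorem time_injective : Function.Injective
    (fun c : D.Crossing => (⟨c.time, c.time_lt⟩ : Fin D.word.length)) := by
  intro a b h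
  have ht : a.time = b.time := by simpa using h
  have ha := a.isCross
  have hb := b.isCross
  rw [ht, hb] at ha
  simp only [Option.some.injEq, Event.cross.injEq] at ha
  exact Crossing.ext ht ha.1.symm ha.2.symm

noncomputable instance : Fintype D.Crossing := Fintype.ofInjective _ time_injective

/-- The sample points at the four ends of a crossing. -/
def point : Corner → D.Point
  | .sw => ⟨c.time, c.idx, c.time_lt.le, lt_trans (Nat.lt_succ_self _) c.idx_lt⟩
  | .nw => ⟨c.time, c.idx + 1, c.time_lt.le, c.idx_lt⟩
  | .se => ⟨c.time + 1, c.idx, c.time_lt, lt_trans (Nat.lt_succ_self _) c.idx_lt_succ⟩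
  | .ne => ⟨c.time + 1, c.idx + 1, c.time_lt, c.idx_lt_succ⟩

/-- The corner through which the strand with left end `p` (one of `sw`, `nw`) enters. -/
def entry (p : Corner) : Corner := if toRight (c.point p) then p else p.opp

/-- The corner through which the under-passing strand enters the crossing. -/
def underIn : Corner := c.entry (if c.upOver then .nw else .sw)

/-- The corner through which the over-passing strand enters the crossing. -/
def overIn : Corner := c.entry (if c.upOver then .sw else .nw)

/-- The corner through which the under-passing strand leaves the crossing. -/
def underOut : Corner := c.underIn.opp

/-- The corner of the over-passing strand on the left of the under-passing strand. -/
def leftSide : Corner := c.underOut.ccw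

/-- The corner of the over-passing strand on the right of the under-passing strand. -/
def rightSide : Corner := c.leftSide.opp

/-- The bridge vertex: a point near the end of the bridge which ends at this crossing. The
auxiliary vertical half-line of the crossing goes downwards from it. -/
def vertex : D.Point := c.point c.underIn

/-- The number of intersections of the auxiliary half-line with the diagram. These are the points
below the bridge vertex, and the bridge vertex itself if the half-line, which goes downwards,
departs to the right of the direction of the diagram. -/
def count : ℕ := c.vertex.pos + if toRight c.vertex then 1 else 0

/-- The intersections of the auxiliary half-line with the diagram, from below: `j = 0` is the
first one. -/
def hit (j : Fin c.count) : D.Point :=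
  ⟨c.vertex.col, j, c.vertex.col_le, by
    have h1 := j.2
    have h2 := c.vertex.pos_lt
    have h3 : c.count ≤ c.vertex.pos + 1 := by
      unfold count
      split <;> omega
    omega⟩

end Crossing

/-- The intersections of the diagram with all the auxiliary vertical half-lines. -/
abbrev Intersection : Type := Σ c : D.Crossing, Fin c.count

/-- The polynomial algebra generated over `ℤ` by the bridges and the inverse of `2`. -/
abbrev Alg : Type := MvPolynomial D.Bridge (Localization.Away (2 : ℤ))

/-- The inverse of `2`. -/
noncomputable def eps : D.Alg :=
  MvPolynomial.C (IsLocalization.Away.invSelf (S := Localization.Away (2 : ℤ)) (2 : ℤ))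

/-- The indeterminate of a bridge. -/
noncomputable def var {D : LongDiagram} (b : D.Bridge) : D.Alg := MvPolynomial.X b

/-- Admissible assignments of elements of the algebra to the segments. -/
structure Admissible : Type where
  elt : D.Segment → D.Alg
  on_bridge : ∀ p : D.Point, ∃ m : ℤ, elt (segment p) = var (bridge p) + m • D.eps
  at_over : ∀ c : D.Crossing,
    elt (segment (c.point c.leftSide)) = elt (segment (c.point c.rightSide)) + D.eps
  at_under : ∀ (c : D.Crossing) (m n : ℤ),
    elt (segment (c.point c.underIn)) = var (bridge (c.point c.underIn)) + m • D.eps →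
    elt (segment (c.point c.underOut)) = var (bridge (c.point c.underOut)) + n • D.eps →
    Odd (m + n)
  at_rightEnd : elt (segment D.rightEnd) = var (bridge D.rightEnd)
  at_leftEnd : elt (segment D.leftEnd) = var (bridge D.leftEnd)

/-- Evaluation of the elements of the algebra at real values of the bridge variables. -/
noncomputable def evalAt {D : LongDiagram} (x : D.Bridge → ℝ) : D.Alg →+* ℝ :=
  MvPolynomial.eval₂Hom
    (IsLocalization.Away.lift (S := Localization.Away (2 : ℤ)) (2 : ℤ)
      (g := Int.castRingHom ℝ) (by simp)) x

namespace Admissible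

variable {D : LongDiagram} (A : D.Admissible)

/-- The element assigned to the segment through a sample point. -/
def at' (p : D.Point) : D.Alg := A.elt (segment p)

/-- The auxiliary element of the vertical half-line which departs from the bridge vertex of a
crossing. -/
noncomputable def aux (c : D.Crossing) : D.Alg :=
  (A.at' (c.point c.underIn) + A.at' (c.point c.underOut)
    - A.at' (c.point c.leftSide) - A.at' (c.point c.rightSide)) * (-1) ^ c.count

/-- The contribution of a crossing to the action functional. -/
noncomputable def crossingTerm (c : D.Crossing) : D.Alg :=
  if c.overIn = c.leftSide then
    (A.at' (c.point c.leftSide) - A.at' (c.point c.underOut)) * A.at' (c.point c.rightSide)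
  else
    (A.at' (c.point c.rightSide) - A.at' (c.point c.underOut)) * A.at' (c.point c.rightSide)

/-- The contribution of an intersection to the action functional. -/
noncomputable def intersectionTerm (y : D.Intersection) : D.Alg :=
  (-1) ^ ((y.2 : ℕ) + 1) * (A.at' (y.1.hit y.2) - D.eps) * A.aux y.1

/-- The action functional. -/
noncomputable def action : D.Alg :=
  ∑ c : D.Crossing, A.crossingTerm c + ∑ y : D.Intersection, A.intersectionTerm y

/-- The real values of the bridge variables for which all auxiliary elements are integers. -/
def realSolutions : Set (D.Bridge → ℝ) :=
  {x | ∀ c : D.Crossing, ∃ n : ℤ, evalAt x (A.aux c) = n}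

end Admissible

/-- The projection from real values to values in `ℝ / ℤ`. -/
def proj {D : LongDiagram} (x : D.Bridge → ℝ) : D.Bridge → UnitAddCircle :=
  fun b => (x b : UnitAddCircle)

/-- The image in the torus of the set of real solutions. -/
def solutions : Set (D.Bridge → UnitAddCircle) :=
  {ξ | ∃ A : D.Admissible, ξ ∈ proj '' A.realSolutions}

theorem proj_mem {D : LongDiagram} (A : D.Admissible) {x : D.Bridge → ℝ}
    (hx : x ∈ A.realSolutions) : proj x ∈ D.solutions :=
  ⟨A, x, hx, rfl⟩

/-! The knot group through the Wirtinger presentation, and the double cyclic cover. -/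

/-- The Wirtinger relator of a crossing. -/
def relator {D : LongDiagram} (c : D.Crossing) : FreeGroup D.Bridge :=
  let a := FreeGroup.of (bridge (c.point c.underIn))
  let b := FreeGroup.of (bridge (c.point c.underOut))
  let o := FreeGroup.of (bridge (c.point c.overIn))
  if c.overIn = c.leftSide then o⁻¹ * a * o * b⁻¹ else o * a * o⁻¹ * b⁻¹

/-- The knot group, that is the fundamental group of the complement of the knot. -/
abbrev KnotGroup : Type := PresentedGroup (Set.range (relator (D := D)))

/-- The homomorphism to `ℤ / 2` which sends each meridian to the generator. -/
def parity : D.KnotGroup →* Multiplicative (ZMod 2) :=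
  PresentedGroup.toGroup (f := fun _ : D.Bridge => Multiplicative.ofAdd (1 : ZMod 2)) (by
    rintro _ ⟨c, rfl⟩
    unfold relator
    dsimp only
    split <;> simp)

/-- The first homology group of the double cyclic cover of the knot complement: the
abelianization of its fundamental group, which is the kernel of `parity`. -/
abbrev H1 : Type := Additive (Abelianization D.parity.ker)

/-- The class in `H1` of the product of the meridian of a bridge with the meridian of the right
infinite bridge. For the right infinite bridge itself, it is the class of the lift of the square of
the meridian, which generates a free complement of the torsion. -/
def pairClass {D : LongDiagram} (b : D.Bridge) : D.H1 :=
  Additive.ofMul (Abelianization.of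
    ⟨PresentedGroup.of b * PresentedGroup.of (bridge D.rightEnd), by
      rw [MonoidHom.mem_ker, map_mul]
      unfold parity
      rw [PresentedGroup.toGroup.of, PresentedGroup.toGroup.of]
      decide⟩)

/-- The map from the first cohomology group of the double cyclic cover with coefficients in
`ℝ / ℤ` to the values of the bridge variables. -/
def ofCohomology : (D.H1 →+ UnitAddCircle) →+ (D.Bridge → UnitAddCircle) where
  toFun φ := fun b => φ (pairClass b)
  map_zero' := rfl
  map_add' _ _ := rfl

end LongDiagram

/-! Reidemeister moves. -/

namespace Event

/-- The lowest position at which an event takes place. -/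
def idx : Event → ℕ
  | .birth i _ => i
  | .death i => i
  | .cross i _ => i

/-- The number of strands which take part in an event, just before it. -/
def inWidth : Event → ℕ
  | .birth _ _ => 0
  | .death _ => 2
  | .cross _ _ => 2

/-- The number of strands which take part in an event, just after it. -/
def outWidth : Event → ℕ
  | .birth _ _ => 2
  | .death _ => 0
  | .cross _ _ => 2

/-- The same event at another position. -/
def place : Event → ℕ → Event
  | .birth _ d, j => .birth j d
  | .death _, j => .death j
  | .cross _ o, j => .cross j o

end Event

/-- The local moves: the Reidemeister moves of types 1, 2, 3, and the moves which realize planar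
isotopies of diagrams in general position with respect to the vertical direction. -/
inductive LocalMove : List Event → List Event → Prop
  /-- a curl on the upper side of a strand -/
  | curl_above (i : ℕ) (d o : Bool) :
      LocalMove [.birth (i + 1) d, .cross i o, .death (i + 1)] []
  /-- a curl on the lower side of a strand -/
  | curl_below (i : ℕ) (d o : Bool) :
      LocalMove [.birth i d, .cross (i + 1) o, .death i] []
  /-- a curl at a left-most turning point -/
  | curl_birth (i : ℕ) (d o : Bool) :
      LocalMove [.birth i d, .cross i o] [.birth i (!d)]
  /-- a curl at a right-most turning point -/
  | curl_death (i : ℕ) (o : Bool) :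
      LocalMove [.cross i o, .death i] [.death i]
  /-- the second Reidemeister move -/
  | bigon (i : ℕ) (o : Bool) :
      LocalMove [.cross i o, .cross i (!o)] []
  /-- the third Reidemeister move; the hypothesis says that one of the three strands is above
  the two others and one of them below the two others -/
  | triangle (i : ℕ) (o₁ o₂ o₃ : Bool) (h : o₁ = o₃ → o₂ = o₁) :
      LocalMove [.cross i o₁, .cross (i + 1) o₂, .cross i o₃]
        [.cross (i + 1) o₃, .cross i o₂, .cross (i + 1) o₁]
  /-- cancellation of two turning points -/
  | zigzag_below (i : ℕ) (d : Bool) : LocalMove [.birth i d, .death (i + 1)] []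
  | zigzag_above (i : ℕ) (d : Bool) : LocalMove [.birth (i + 1) d, .death i] []
  /-- a strand slides over or under a turning point -/
  | slide_birth (i : ℕ) (d o : Bool) :
      LocalMove [.birth i d, .cross (i + 1) o] [.birth (i + 1) d, .cross i (!o)]
  | slide_death (i : ℕ) (o : Bool) :
      LocalMove [.cross (i + 1) o, .death i] [.cross i (!o), .death (i + 1)]
  /-- two events, one of them above the other, exchange their order from left to right -/
  | exchange (e f : Event) (k : ℕ) :
      LocalMove [e, f.place (e.idx + e.outWidth + k)] [f.place (e.idx + e.inWidth + k), e]

/-- The sample points `p`, `q` of two diagrams are the same point of the plane outside of the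
region of a local move, which comes after `a` events and replaces `l` events by `r` events. -/
def SamePoint (a l r : ℕ) {w z : List Event} (p : Pt w) (q : Pt z) : Prop :=
  p.pos = q.pos ∧
    ((p.col = q.col ∧ p.col ≤ a) ∨ ∃ s : ℕ, p.col = a + l + s ∧ q.col = a + r + s)

/-- A move between two long knot diagrams: a local move inside the diagram. -/
structure Move (D E : LongDiagram) : Type where
  before : List Event
  old : List Event
  new : List Event
  after : List Event
  isLocal : LocalMove old new
  source : D.word = before ++ old ++ after
  target : E.word = before ++ new ++ after

/-- Values of the bridge variables of two diagrams related by a move correspond to each other if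
they agree outside of the region of the move. -/
def Move.Corresponds {D E : LongDiagram} (M : Move D E)
    (ξ : D.Bridge → UnitAddCircle) (η : E.Bridge → UnitAddCircle) : Prop :=
  ∀ (p : D.Point) (q : E.Point),
    SamePoint M.before.length M.old.length M.new.length p q →
      ξ (LongDiagram.bridge p) = η (LongDiagram.bridge q)

end LongKnot

namespace LongKnot

/-! ### Columns of a diagram -/

theorem Event.Fits.idx_add_inWidth_le {e : Event} {s : List Bool} (h : e.Fits s) :
    e.idx + e.inWidth ≤ s.length := by
  cases e with
  | birth i d => simpa [Event.Fits, Event.idx, Event.inWidth] using h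
  | death i =>
    obtain ⟨d, -, h2⟩ := h
    have := (List.getElem?_eq_some_iff.1 h2).1
    simp only [Event.idx, Event.inWidth]; omega
  | cross i o => simp only [Event.Fits, Event.idx, Event.inWidth] at *; omega

theorem Event.Fits.length_act {e : Event} {s : List Bool} (h : e.Fits s) :
    (e.act s).length + e.inWidth = s.length + e.outWidth := by
  have := h.idx_add_inWidth_le
  cases e <;> simp [Event.act, Event.idx, Event.inWidth, Event.outWidth] at * <;> omega

/-- Two families indexed by the strands before and after an event agree off its window. -/
def OffWindow {β : Type*} (e : Event) (f g : ℕ → β) : Prop :=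
  (∀ j < e.idx, g j = f j) ∧ ∀ j, e.idx ≤ j → g (j + e.outWidth) = f (j + e.inWidth)

/-- The effect of an event on the directions of the strands. -/
def Event.DirStep (e : Event) (d d' : ℕ → Bool) : Prop :=
  OffWindow e d d' ∧
    match e with
    | .birth i b => d' i = b ∧ d' (i + 1) = !b
    | .death i => d (i + 1) = !d i
    | .cross i _ => d' i = d (i + 1) ∧ d' (i + 1) = d i

/-- This is where the list surgery of `Event.act` is unfolded; the later arguments treat a column as
a function on `ℕ` and never look at lists of directions again. -/
theorem Event.Fits.dirStep {e : Event} {s : List Bool} (h : e.Fits s) :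
    e.DirStep (fun j => s.getD j false) (fun j => (e.act s).getD j false) := by
  have h0 := h.idx_add_inWidth_le
  cases e with
  | birth i b =>
    simp only [Event.idx, Event.inWidth] at h0
    refine ⟨⟨fun j hj => ?_, fun j hj => ?_⟩, ?_, ?_⟩
    · simp only [Event.idx] at hj
      simp [Event.act, List.getD_eq_getElem?_getD, List.getElem?_append, hj,
        show j < s.length by omega]
    · simp only [Event.idx] at hj
      simp only [Event.act, Event.inWidth, Event.outWidth, List.getD_eq_getElem?_getD,
        List.getElem?_append, List.length_take]
      rw [if_neg (by omega)]
      obtain ⟨k, rfl⟩ : ∃ k, j = i + k := ⟨j - i, by omega⟩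
      rw [show i + k + 2 - min i s.length = k + 2 by omega]
      simp
    · simp only [Event.act, List.getD_eq_getElem?_getD, List.getElem?_append, List.length_take]
      rw [if_neg (by omega), show i - min i s.length = 0 by omega]
      simp
    · simp only [Event.act, List.getD_eq_getElem?_getD, List.getElem?_append, List.length_take]
      rw [if_neg (by omega), show i + 1 - min i s.length = 1 by omega]
      simp
  | death i =>
    simp only [Event.idx, Event.inWidth] at h0
    refine ⟨⟨fun j hj => ?_, fun j hj => ?_⟩, ?_⟩
    · simp only [Event.idx] at hj
      simp [Event.act, List.getD_eq_getElem?_getD, List.getElem?_append, hj,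
        show j < s.length by omega]
    · simp only [Event.idx] at hj
      simp only [Event.act, Event.inWidth, Event.outWidth, List.getD_eq_getElem?_getD,
        List.getElem?_append, List.length_take]
      rw [if_neg (by omega)]
      obtain ⟨k, rfl⟩ : ∃ k, j = i + k := ⟨j - i, by omega⟩
      rw [show i + k + 0 - min i s.length = k by omega, List.getElem?_drop]
      congr 2; omega
    · obtain ⟨d, h1, h2⟩ := h
      simp [List.getD_eq_getElem?_getD, h1, h2]
  | cross i o =>
    simp only [Event.idx, Event.inWidth] at h0
    have key : ∀ j, ((Event.cross i o).act s)[j]? =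
        if j = i then s[i + 1]? else if j = i + 1 then s[i]? else s[j]? := by
      intro j
      have e1 : (s.drop i).take 2 = [s[i], s[i + 1]] := by
        rw [List.drop_eq_getElem_cons (by omega), List.drop_eq_getElem_cons (by omega)]
        rfl
      simp only [Event.act, e1, List.reverse_cons, List.reverse_nil, List.nil_append,
        List.cons_append, List.append_assoc]
      rw [List.getElem?_append, List.length_take]
      split_ifs with a b c b c
      · omega
      · omega
      · rw [List.getElem?_take, if_pos (by omega)]
      · rw [b, show i - min i s.length = 0 by omega]
        simp [List.getElem?_eq_getElem (show i + 1 < s.length by omega)]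
      · rw [c, show i + 1 - min i s.length = 1 by omega]
        simp [List.getElem?_eq_getElem (show i < s.length by omega)]
      · obtain ⟨k, rfl⟩ : ∃ k, j = i + 2 + k := ⟨j - i - 2, by omega⟩
        rw [show i + 2 + k - min i s.length = k + 2 by omega]
        simp [List.getElem?_drop]
    refine ⟨⟨fun j hj => ?_, fun j hj => ?_⟩, ?_, ?_⟩
    · simp only [Event.idx] at hj
      simp only [List.getD_eq_getElem?_getD, key]
      rw [if_neg (by omega), if_neg (by omega)]
    · simp only [Event.idx] at hj
      simp only [List.getD_eq_getElem?_getD, key, Event.inWidth, Event.outWidth]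
      rw [if_neg (by omega), if_neg (by omega)]
    · simp [List.getD_eq_getElem?_getD, key]
    · simp [List.getD_eq_getElem?_getD, key]

/-- The number of strands in a column. -/
def width (w : List Event) (t : ℕ) : ℕ := (slice w t).length

/-- The directions of the strands in a column, extended by `false`. -/
def dir (w : List Event) (t j : ℕ) : Bool := (slice w t).getD j false

theorem dir_zero (w : List Event) : dir w 0 0 = false := by simp [dir, slice]

namespace LongDiagram

variable (D : LongDiagram)

theorem fits_of_getElem? {t : ℕ} {e : Event} (h : D.word[t]? = some e) :
    e.Fits (slice D.word t) := by
  obtain ⟨h1, h2⟩ := List.getElem?_eq_some_iff.1 h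
  exact h2 ▸ D.fits t h1

theorem slice_succ_of_getElem? {t : ℕ} {e : Event} (h : D.word[t]? = some e) :
    slice D.word (t + 1) = e.act (slice D.word t) := by
  obtain ⟨h1, h2⟩ := List.getElem?_eq_some_iff.1 h
  rw [slice_succ _ _ h1, h2]

theorem width_succ {t : ℕ} {e : Event} (h : D.word[t]? = some e) :
    width D.word (t + 1) + e.inWidth = width D.word t + e.outWidth := by
  unfold width
  rw [D.slice_succ_of_getElem? h]
  exact (D.fits_of_getElem? h).length_act

theorem idx_add_inWidth_le {t : ℕ} {e : Event} (h : D.word[t]? = some e) :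
    e.idx + e.inWidth ≤ width D.word t :=
  (D.fits_of_getElem? h).idx_add_inWidth_le

theorem dirStep {t : ℕ} {e : Event} (h : D.word[t]? = some e) :
    e.DirStep (dir D.word t) (dir D.word (t + 1)) := by
  have := (D.fits_of_getElem? h).dirStep
  rw [← D.slice_succ_of_getElem? h] at this
  exact this

theorem toRight_eq {D : LongDiagram} (p : D.Point) : toRight p = dir D.word p.col p.pos := by
  have h := p.pos_lt
  simp [toRight, dir, List.getD_eq_getElem?_getD, h]

theorem width_length : width D.word D.word.length = 1 := by simp [width, D.last]

theorem width_zero (w : List Event) : width w 0 = 1 := by simp [width, slice]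

variable {D}

/-- A function on the sample points as a function of column and height, extended by a default. -/
noncomputable def extend {β : Type*} (z : β) (g : D.Point → β) (t j : ℕ) : β :=
  open Classical in
  if h : t ≤ D.word.length ∧ j < width D.word t then g ⟨t, j, h.1, h.2⟩ else z

theorem extend_apply {β : Type*} (z : β) (g : D.Point → β) (p : D.Point) :
    extend z g p.col p.pos = g p := by
  unfold extend
  rw [dif_pos ⟨p.col_le, p.pos_lt⟩]

theorem extend_of_not {β : Type*} (z : β) (g : D.Point → β) {t j : ℕ}
    (h : ¬ (t ≤ D.word.length ∧ j < width D.word t)) : extend z g t j = z := dif_neg h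

theorem extend_mk {β : Type*} (z : β) (g : D.Point → β) {t j : ℕ}
    (h1 : t ≤ D.word.length) (h2 : j < width D.word t) : extend z g t j = g ⟨t, j, h1, h2⟩ :=
  dif_pos ⟨h1, h2⟩

theorem lt_of_getElem? {t : ℕ} {e : Event} (h : D.word[t]? = some e) : t < D.word.length :=
  (List.getElem?_eq_some_iff.1 h).1

/-- The conditions on a function of column and height to be constant along crossingless arcs. -/
def PlainStep {β : Type*} (e : Event) (f g : ℕ → β) : Prop :=
  OffWindow e f g ∧
    match e with
    | .birth i _ => g i = g (i + 1)
    | .death i => f i = f (i + 1)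
    | .cross _ _ => True

/-- Off the window of an event, a strand is present before it iff its continuation is present after
it. So default meets default, and elsewhere the equations are those given by the plain links. -/
theorem plainStep_extend {β : Type*} (z : β) {g : D.Point → β}
    (hg : ∀ p q, Link .plain p q → g p = g q) {t : ℕ} {e : Event} (h : D.word[t]? = some e) :
    PlainStep e (extend z g t) (extend z g (t + 1)) := by
  have hw := D.width_succ h
  have hi := D.idx_add_inWidth_le h
  have ht : t + 1 ≤ D.word.length := lt_of_getElem? h
  have key : ∀ a b : ℕ, Joins t e .plain (t, a) (t + 1, b) →
      (a < width D.word t ↔ b < width D.word (t + 1)) →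
      extend z g (t + 1) b = extend z g t a := by
    intro a b hj hab
    by_cases ha : a < width D.word t
    · rw [extend_mk z g ht (hab.1 ha), extend_mk z g (Nat.le_of_lt ht) ha]
      exact (hg _ _ ⟨t, e, h, hj⟩).symm
    · rw [extend_of_not z g (by tauto), extend_of_not z g (by tauto)]
  cases e with
  | birth i d =>
    simp only [Event.idx, Event.inWidth, Event.outWidth] at hw hi
    refine ⟨⟨fun j hj => key j j (.birth_below i j d hj) ?_,
      fun j hj => key j (j + 2) (.birth_above i j d hj) ?_⟩, ?_⟩
    · simp only [Event.idx] at hj; omega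
    · simp only [Event.idx] at hj; omega
    · simp only
      rw [extend_mk z g ht (by omega), extend_mk z g ht (by omega)]
      exact hg _ _ ⟨t, _, h, .birth_turn i d⟩
  | death i =>
    simp only [Event.idx, Event.inWidth, Event.outWidth] at hw hi
    refine ⟨⟨fun j hj => key j j (.death_below i j hj) ?_,
      fun j hj => key (j + 2) j (.death_above i j hj) ?_⟩, ?_⟩
    · simp only [Event.idx] at hj; omega
    · simp only [Event.idx] at hj; omega
    · simp only
      rw [extend_mk z g (Nat.le_of_lt ht) (by omega), extend_mk z g (Nat.le_of_lt ht) (by omega)]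
      exact hg _ _ ⟨t, _, h, .death_turn i⟩
  | cross i o =>
    simp only [Event.idx, Event.inWidth, Event.outWidth] at hw hi
    refine ⟨⟨fun j hj => key j j (.cross_below i j o hj) ?_,
      fun j hj => key (j + 2) (j + 2) (.cross_above i (j + 2) o ?_) ?_⟩, trivial⟩
    · simp only [Event.idx] at hj; omega
    · simp only [Event.idx] at hj; omega
    · omega

/-- Converse of `plainStep_extend`: each clause of `PlainStep` is one of the constructors of `Joins`
of plain kind. -/
theorem eq_of_link_plain {β : Type*} {φ : ℕ → ℕ → β}
    (hφ : ∀ t e, D.word[t]? = some e → PlainStep e (φ t) (φ (t + 1))) {p q : D.Point}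
    (h : Link .plain p q) : φ p.col p.pos = φ q.col q.pos := by
  obtain ⟨t, e, he, hj⟩ := h
  have hs := hφ t e he
  generalize hp : (p.col, p.pos) = P at hj
  generalize hq : (q.col, q.pos) = Q at hj
  have hp' : φ p.col p.pos = φ P.1 P.2 := by rw [← hp]
  have hq' : φ q.col q.pos = φ Q.1 Q.2 := by rw [← hq]
  rw [hp', hq']
  generalize hk : Kind.plain = k at hj
  cases hj with
  | birth_turn i d => exact hs.2
  | birth_below i j d h => exact (hs.1.1 j h).symm
  | birth_above i j d h => exact (hs.1.2 j h).symm
  | death_turn i => exact hs.2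
  | death_below i j h => exact (hs.1.1 j h).symm
  | death_above i j h => exact (hs.1.2 j h).symm
  | cross_below i j o h => exact (hs.1.1 j h).symm
  | cross_above i j o h =>
    obtain ⟨k, rfl⟩ : ∃ k, j = k + 2 := ⟨j - 2, by omega⟩
    exact (hs.1.2 k (by simp only [Event.idx]; omega)).symm
  | cross_up i o => cases o <;> simp at hk
  | cross_down i o => cases o <;> simp at hk

/-! ### The ends of a crossing -/

namespace Crossing

variable (c : D.Crossing)

theorem link_sw_ne :
    Link (if c.upOver then .over else .under) (c.point .sw) (c.point .ne) :=
  ⟨c.time, _, c.isCross, .cross_up c.idx c.upOver⟩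

theorem link_nw_se :
    Link (if c.upOver then .under else .over) (c.point .nw) (c.point .se) :=
  ⟨c.time, _, c.isCross, .cross_down c.idx c.upOver⟩

theorem dir_right : dir D.word (c.time + 1) c.idx = dir D.word c.time (c.idx + 1) ∧
    dir D.word (c.time + 1) (c.idx + 1) = dir D.word c.time c.idx :=
  (D.dirStep c.isCross).2

theorem toRight_sw : toRight (c.point .sw) = dir D.word c.time c.idx := toRight_eq _
theorem toRight_nw : toRight (c.point .nw) = dir D.word c.time (c.idx + 1) := toRight_eq _

end Crossing

/-- Two points joined by an arc which over- or under-passes are opposite ends of a crossing. -/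
theorem exists_crossing_of_link {k : Kind} (hk : k ≠ .plain) {p q : D.Point} (h : Link k p q) :
    ∃ c : D.Crossing,
      (p = c.point .sw ∧ q = c.point .ne ∧ k = if c.upOver then .over else .under) ∨
      (p = c.point .nw ∧ q = c.point .se ∧ k = if c.upOver then .under else .over) := by
  obtain ⟨t, e, he, hj⟩ := h
  generalize hp : (p.col, p.pos) = P at hj
  generalize hq : (q.col, q.pos) = Q at hj
  cases hj with
  | cross_up i o =>
    refine ⟨⟨t, i, o, he⟩, Or.inl ⟨?_, ?_, rfl⟩⟩ <;>
      · simp only [Prod.mk.injEq] at hp hq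
        ext <;> simp [Crossing.point, hp, hq]
  | cross_down i o =>
    refine ⟨⟨t, i, o, he⟩, Or.inr ⟨?_, ?_, rfl⟩⟩ <;>
      · simp only [Prod.mk.injEq] at hp hq
        ext <;> simp [Crossing.point, hp, hq]
  | _ => exact absurd rfl hk

end LongDiagram

/-! ### Region values and local weights -/

/-- The element of order two of `ℝ / ℤ`. -/
noncomputable def half : UnitAddCircle := ((1 / 2 : ℝ) : UnitAddCircle)

theorem coe_eq_coe_of_sub_mem {x y : ℝ} (h : x - y ∈ Set.range ((↑) : ℤ → ℝ)) :
    (x : UnitAddCircle) = (y : UnitAddCircle) := by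
  obtain ⟨n, hn⟩ := h
  rw [show x = y + (n : ℝ) by rw [hn]; ring, AddCircle.coe_add]
  have : ((n : ℝ) : UnitAddCircle) = 0 := (AddCircle.coe_eq_zero_iff 1).2 ⟨n, by simp⟩
  rw [this, add_zero]

theorem exists_int_of_coe_eq_coe {x y : ℝ} (h : (x : UnitAddCircle) = (y : UnitAddCircle)) :
    ∃ n : ℤ, x = y + n := by
  rw [← sub_eq_zero, ← AddCircle.coe_sub, AddCircle.coe_eq_zero_iff] at h
  obtain ⟨n, hn⟩ := h
  exact ⟨n, by simp at hn; linarith⟩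

theorem half_add_half : half + half = 0 := by
  unfold half
  rw [← AddCircle.coe_add, AddCircle.coe_eq_zero_iff]
  exact ⟨1, by norm_num⟩

theorem neg_half : -half = half := neg_eq_of_add_eq_zero_left half_add_half

/-- A real representative of an element of `ℝ / ℤ`. -/
noncomputable def lift (x : UnitAddCircle) : ℝ := (QuotientAddGroup.mk_surjective x).choose

@[simp] theorem coe_lift (x : UnitAddCircle) : (lift x : UnitAddCircle) = x :=
  (QuotientAddGroup.mk_surjective x).choose_spec

/-- The weight of a crossing in terms of the values of the four regions around it. With the
under-passing strand directed upwards, the regions are `sw`, `se`, `nw`, `ne`, and `ty` says that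
the over-passing strand crosses from left to right. -/
noncomputable def cornerWeight (ty : Bool) (sw se nw ne : ℝ) : ℝ :=
  (if ty then sw - ne else se - nw) * (se + ne + 1 / 2)

/-- The weight of a crossing of a diagram in terms of the values `l`, `t`, `b`, `r` of the regions
on the left, above, below and on the right of it. -/
noncomputable def crossWeight (o d₁ d₂ : Bool) (l t b r : ℝ) : ℝ :=
  match o, d₁, d₂ with
  | true, d, true => cornerWeight (!d) t l r b
  | true, d, false => cornerWeight d b r l t
  | false, true, d => cornerWeight d l b t r
  | false, false, d => cornerWeight (!d) r t b l

namespace Event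

/-- The relation between the values of the regions inside the window of an event: the regions below
it, in the middle before it and above it, and the region in the middle after it. -/
def RegionRel (e : Event) (b l t r : UnitAddCircle) : Prop :=
  match e with
  | .cross _ o => r = if o then l + b - t + half else l + t - b + half
  | _ => True

/-- The effect of an event on the values of the regions of a column, listed from below. -/
def RegionStep (e : Event) (W W' : ℕ → UnitAddCircle) : Prop :=
  (∀ j ≤ e.idx, W' j = W j) ∧
    (∀ j, e.idx ≤ j → W' (j + e.outWidth) = W (j + e.inWidth)) ∧
    e.RegionRel (W e.idx) (W (e.idx + 1)) (W (e.idx + 2)) (W' (e.idx + 1))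

/-- The contribution of an event in terms of the two strands and the four regions next to it. -/
noncomputable def localWeight (e : Event) (d₁ d₂ : Bool) (b l t r : UnitAddCircle) :
    UnitAddCircle :=
  match e with
  | .cross _ o => (crossWeight o d₁ d₂ (lift l) (lift t) (lift b) (lift r) : ℝ)
  | _ => 0

/-- The contribution of an event to the exponent of the invariant. -/
noncomputable def weight (e : Event) (d : ℕ → Bool) (W W' : ℕ → UnitAddCircle) : UnitAddCircle :=
  e.localWeight (d e.idx) (d (e.idx + 1)) (W e.idx) (W (e.idx + 1)) (W (e.idx + 2))
    (W' (e.idx + 1))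

end Event

/-- A sequence of columns of region values which are related by the given events. -/
def RegionRun (w : List Event) (V : ℕ → ℕ → UnitAddCircle) : Prop :=
  ∀ (k : ℕ) (e : Event), w[k]? = some e → e.RegionStep (V k) (V (k + 1))

/-- A sequence of columns of directions which are related by the given events. -/
def DirRun (w : List Event) (d : ℕ → ℕ → Bool) : Prop :=
  ∀ (k : ℕ) (e : Event), w[k]? = some e → e.DirStep (d k) (d (k + 1))

/-- The total weight of a sequence of columns. -/
noncomputable def runWeight (w : List Event) (d : ℕ → ℕ → Bool) (V : ℕ → ℕ → UnitAddCircle) :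
    UnitAddCircle :=
  ∑ k : Fin w.length, (w[k]).weight (d k) (V k) (V (k + 1))

/-- Two words act in the same way on directions and region values, with the same weights. -/
structure Equivalent (v w : List Event) : Prop where
  exists_run : ∀ V, RegionRun v V →
    ∃ V', RegionRun w V' ∧ V' 0 = V 0 ∧ V' w.length = V v.length
  exists_run' : ∀ V, RegionRun w V →
    ∃ V', RegionRun v V' ∧ V' 0 = V 0 ∧ V' v.length = V w.length
  unique : ∀ V V', RegionRun v V → RegionRun v V' → V 0 = V' 0 → V v.length = V' v.length →
    ∀ k ≤ v.length, V k = V' k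
  unique' : ∀ V V', RegionRun w V → RegionRun w V' → V 0 = V' 0 → V w.length = V' w.length →
    ∀ k ≤ w.length, V k = V' k
  dir_eq : ∀ d d', DirRun v d → DirRun w d' → d 0 = d' 0 → d v.length = d' w.length
  weight_eq : ∀ d d' V V', DirRun v d → DirRun w d' → RegionRun v V → RegionRun w V' →
    d 0 = d' 0 → V 0 = V' 0 → V v.length = V' w.length → runWeight v d V = runWeight w d' V'

/-! ### Crossings as maps of columns -/

section Cross

variable {i : ℕ} {o : Bool} {W W' : ℕ → UnitAddCircle}

theorem Event.RegionStep.cross_of_ne (h : (Event.cross i o).RegionStep W W') {j : ℕ}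
    (hj : j ≠ i + 1) : W' j = W j := by
  by_cases h1 : j ≤ i
  · exact h.1 j h1
  · obtain ⟨k, rfl⟩ : ∃ k, j = k + 2 := ⟨j - 2, by omega⟩
    exact h.2.1 k (show i ≤ k by omega)

/-- A crossing acts on columns by a map, which replaces one entry. In words of crossings the first
column therefore determines all the others. -/
theorem regionStep_cross_iff : (Event.cross i o).RegionStep W W' ↔
    W' = Function.update W (i + 1)
      (if o then W (i + 1) + W i - W (i + 2) + half
        else W (i + 1) + W (i + 2) - W i + half) := by
  constructor
  · intro h
    funext j
    by_cases hj : j = i + 1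
    · subst hj; simpa [Event.RegionRel, Event.idx] using h.2.2
    · rw [Function.update_of_ne hj, h.cross_of_ne hj]
  · rintro rfl
    refine ⟨fun j hj => ?_, fun j hj => ?_, ?_⟩
    · simp only [Event.idx] at hj
      rw [Function.update_of_ne (by omega)]
    · simp only [Event.idx] at hj
      exact Function.update_of_ne (by simp only [Event.outWidth]; omega) _ _
    · simp [Event.RegionRel, Event.idx]

/-- The relation at a crossing holds for the chosen real representatives only up to an integer;
these integers enter the weight identities of the moves. -/
theorem exists_lift_cross (h : (Event.cross i o).RegionStep W W') :
    ∃ n : ℤ, lift (W' (i + 1)) =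
      (if o then lift (W (i + 1)) + lift (W i) - lift (W (i + 2)) + 1 / 2
        else lift (W (i + 1)) + lift (W (i + 2)) - lift (W i) + 1 / 2) + n := by
  refine exists_int_of_coe_eq_coe ?_
  have := h.2.2
  simp only [Event.RegionRel, Event.idx] at this
  cases o <;> simpa [AddCircle.coe_add, AddCircle.coe_sub, half] using this

end Cross

theorem dirStep_cross_iff {i : ℕ} {o : Bool} {d d' : ℕ → Bool} :
    (Event.cross i o).DirStep d d' ↔ d' = d ∘ Equiv.swap i (i + 1) := by
  constructor
  · rintro ⟨h1, h2, h3⟩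
    funext j
    simp only [Function.comp]
    rcases lt_trichotomy j i with h | rfl | h
    · rw [Equiv.swap_apply_of_ne_of_ne (by omega) (by omega)]
      exact h1.1 j h
    · simpa using h2
    · by_cases hj : j = i + 1
      · subst hj; simpa using h3
      · rw [Equiv.swap_apply_of_ne_of_ne (by omega) (by omega)]
        obtain ⟨k, rfl⟩ : ∃ k, j = k + 2 := ⟨j - 2, by omega⟩
        exact h1.2 k (show i ≤ k by omega)
  · rintro rfl
    refine ⟨⟨fun j hj => ?_, fun j hj => ?_⟩, ?_, ?_⟩
    · simp only [Event.idx] at hj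
      simp only [Function.comp]
      rw [Equiv.swap_apply_of_ne_of_ne (by omega) (by omega)]
    · simp only [Event.idx] at hj
      simp only [Function.comp, Event.inWidth, Event.outWidth]
      rw [Equiv.swap_apply_of_ne_of_ne (by omega) (by omega)]
    · simp
    · simp

/-- The regions `p₁` and `z` are the small triangles on the two sides of the move. After elimination
of the dependent variables the real variables cancel, and an integral polynomial in the four
integers remains. This is checked for every order of the three strands and all their directions. -/
theorem triangle_weight {o₁ o₂ o₃ : Bool} (h : o₁ = o₃ → o₂ = o₁) (d₀ d₁ d₂ : Bool)
    {b p q t p₁ q₁ p₂ z : ℝ} {n₁ n₂ n₃ n₄ : ℤ}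
    (h₁ : p₁ = (if o₁ then p + b - q + 1 / 2 else p + q - b + 1 / 2) + n₁)
    (h₂ : q₁ = (if o₂ then q + p₁ - t + 1 / 2 else q + t - p₁ + 1 / 2) + n₂)
    (h₃ : p₂ = (if o₃ then p₁ + b - q₁ + 1 / 2 else p₁ + q₁ - b + 1 / 2) + n₃)
    (h₄ : z = (if o₃ then q + p - t + 1 / 2 else q + t - p + 1 / 2) + n₄) :
    (crossWeight o₁ d₀ d₁ p q b p₁ + crossWeight o₂ d₀ d₂ q t p₁ q₁ +
        crossWeight o₃ d₁ d₂ p₁ q₁ b p₂) -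
      (crossWeight o₃ d₁ d₂ q t p z + crossWeight o₂ d₀ d₂ p z b p₂ +
        crossWeight o₁ d₀ d₁ z t p₂ q₁) ∈ Set.range ((↑) : ℤ → ℝ) := by
  subst h₁ h₂ h₃ h₄
  cases o₁ <;> cases o₂ <;> cases o₃ <;> simp at h <;> cases d₀ <;> cases d₁ <;> cases d₂ <;>
    simp only [crossWeight, cornerWeight, Bool.not_true, Bool.not_false, if_true, if_false,
      Bool.false_eq_true] <;>
    ring_nf <;> norm_cast <;> exact ⟨_, rfl⟩

/-! ### Local moves preserve the invariant -/

theorem regionRun_nil (V : ℕ → ℕ → UnitAddCircle) : RegionRun [] V := by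
  intro k e h; simp at h

theorem regionRun_cons {e : Event} {w : List Event} {V : ℕ → ℕ → UnitAddCircle} :
    RegionRun (e :: w) V ↔ e.RegionStep (V 0) (V 1) ∧ RegionRun w (fun k => V (k + 1)) := by
  constructor
  · exact fun h => ⟨h 0 e rfl, fun k f hf => h (k + 1) f hf⟩
  · rintro ⟨h1, h2⟩ (_ | k) f hf
    · obtain rfl : e = f := by simpa using hf
      exact h1
    · exact h2 k f hf

theorem dirRun_cons {e : Event} {w : List Event} {d : ℕ → ℕ → Bool} :
    DirRun (e :: w) d ↔ e.DirStep (d 0) (d 1) ∧ DirRun w (fun k => d (k + 1)) := by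
  constructor
  · exact fun h => ⟨h 0 e rfl, fun k f hf => h (k + 1) f hf⟩
  · rintro ⟨h1, h2⟩ (_ | k) f hf
    · obtain rfl : e = f := by simpa using hf
      exact h1
    · exact h2 k f hf

theorem dirRun_nil (d : ℕ → ℕ → Bool) : DirRun [] d := by
  intro k e h; simp at h

theorem runWeight_nil (d : ℕ → ℕ → Bool) (V : ℕ → ℕ → UnitAddCircle) : runWeight [] d V = 0 := by
  simp [runWeight]

theorem runWeight_cons (e : Event) (w : List Event) (d : ℕ → ℕ → Bool)
    (V : ℕ → ℕ → UnitAddCircle) : runWeight (e :: w) d V =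
      e.weight (d 0) (V 0) (V 1) + runWeight w (fun k => d (k + 1)) (fun k => V (k + 1)) := by
  simp only [runWeight]
  exact Fin.sum_univ_succ (n := w.length) _

theorem exists_run_one {e : Event} {A B : ℕ → UnitAddCircle} (h : e.RegionStep A B) :
    ∃ V, RegionRun [e] V ∧ V 0 = A ∧ V [e].length = B :=
  ⟨fun k => match k with | 0 => A | _ => B,
    regionRun_cons.2 ⟨h, regionRun_nil _⟩, rfl, rfl⟩

theorem exists_run_two {e f : Event} {A B C : ℕ → UnitAddCircle} (h : e.RegionStep A B)
    (h' : f.RegionStep B C) : ∃ V, RegionRun [e, f] V ∧ V 0 = A ∧ V [e, f].length = C :=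
  ⟨fun k => match k with | 0 => A | 1 => B | _ => C,
    regionRun_cons.2 ⟨h, regionRun_cons.2 ⟨h', regionRun_nil _⟩⟩, rfl, rfl⟩

theorem exists_run_three {e f g : Event} {A B C E : ℕ → UnitAddCircle} (h : e.RegionStep A B)
    (h' : f.RegionStep B C) (h'' : g.RegionStep C E) :
    ∃ V, RegionRun [e, f, g] V ∧ V 0 = A ∧ V [e, f, g].length = E :=
  ⟨fun k => match k with | 0 => A | 1 => B | 2 => C | _ => E,
    regionRun_cons.2 ⟨h, regionRun_cons.2 ⟨h', regionRun_cons.2 ⟨h'', regionRun_nil _⟩⟩⟩, rfl, rfl⟩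

theorem forall_le_one {P : ℕ → Prop} (h0 : P 0) (h1 : P 1) : ∀ k ≤ 1, P k := by
  intro k hk; interval_cases k <;> assumption

theorem forall_le_two {P : ℕ → Prop} (h0 : P 0) (h1 : P 1) (h2 : P 2) : ∀ k ≤ 2, P k := by
  intro k hk; interval_cases k <;> assumption

theorem forall_le_three {P : ℕ → Prop} (h0 : P 0) (h1 : P 1) (h2 : P 2) (h3 : P 3) :
    ∀ k ≤ 3, P k := by
  intro k hk; interval_cases k <;> assumption

namespace Event

@[simp] theorem idx_place (f : Event) (a : ℕ) : (f.place a).idx = a := by cases f <;> rfl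
@[simp] theorem inWidth_place (f : Event) (a : ℕ) : (f.place a).inWidth = f.inWidth := by
  cases f <;> rfl
@[simp] theorem outWidth_place (f : Event) (a : ℕ) : (f.place a).outWidth = f.outWidth := by
  cases f <;> rfl
@[simp] theorem regionRel_place (f : Event) (a : ℕ) :
    (f.place a).RegionRel = f.RegionRel := by cases f <;> rfl
@[simp] theorem localWeight_place (f : Event) (a : ℕ) :
    (f.place a).localWeight = f.localWeight := by cases f <;> rfl

theorem regionRel_congr {e : Event} {b l t r b' l' t' r' : UnitAddCircle}
    (h : e.inWidth = 2 → e.outWidth = 2 → b = b' ∧ l = l' ∧ t = t' ∧ r = r')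
    (hr : e.RegionRel b l t r) : e.RegionRel b' l' t' r' := by
  cases e with
  | cross i o => obtain ⟨rfl, rfl, rfl, rfl⟩ := h rfl rfl; exact hr
  | _ => trivial

theorem localWeight_congr {e : Event} {d₁ d₂ d₁' d₂' : Bool}
    {b l t r b' l' t' r' : UnitAddCircle}
    (h : e.inWidth = 2 → e.outWidth = 2 →
      d₁ = d₁' ∧ d₂ = d₂' ∧ b = b' ∧ l = l' ∧ t = t' ∧ r = r') :
    e.localWeight d₁ d₂ b l t r = e.localWeight d₁' d₂' b' l' t' r' := by
  cases e with
  | cross i o => obtain ⟨rfl, rfl, rfl, rfl, rfl, rfl⟩ := h rfl rfl; rfl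
  | _ => rfl

/-- The directions of the strands in the window after an event are determined by those before. -/
theorem DirStep.congr {e f : Event} {a : ℕ} (hf : f = e.place a) {d d' u u' : ℕ → Bool}
    (h : e.DirStep d d') (h' : f.DirStep u u')
    (hd : ∀ j < e.inWidth, d (e.idx + j) = u (a + j)) :
    ∀ j < e.outWidth, d' (e.idx + j) = u' (a + j) := by
  subst hf
  intro j hj
  cases e with
  | birth i b =>
    simp only [outWidth] at hj
    interval_cases j
    · exact h.2.1.trans h'.2.1.symm
    · exact h.2.2.trans h'.2.2.symm
  | death i => simp [outWidth] at hj
  | cross i o =>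
    simp only [outWidth] at hj
    interval_cases j
    · exact h.2.1.trans ((hd 1 (by simp [inWidth])).trans h'.2.1.symm)
    · exact h.2.2.trans ((hd 0 (by simp [inWidth])).trans h'.2.2.symm)

end Event

/-! ### Exchange of two distant events -/

section Exchange

variable (e f : Event) (k : ℕ)

theorem exchange_exists {A B C : ℕ → UnitAddCircle} (h₁ : e.RegionStep A B)
    (h₂ : (f.place (e.idx + e.outWidth + k)).RegionStep B C) :
    ∃ U, (f.place (e.idx + e.inWidth + k)).RegionStep A U ∧ e.RegionStep U C := by
  obtain ⟨a1, a2, a3⟩ := h₁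
  obtain ⟨b1, b2, b3⟩ := h₂
  simp only [Event.idx_place, Event.inWidth_place, Event.outWidth_place,
    Event.regionRel_place] at b1 b2 b3
  set i := e.idx
  set p := e.inWidth
  set q := e.outWidth
  have hAB : ∀ j, i + p ≤ j → B (j - p + q) = A j := fun j hj => by
    rw [a2 (j - p) (by omega)]; congr 1; omega
  -- The content is at the junction `j = i + p + k`: the bottom region of the window of `f` is
  -- changed by neither event, so both prescriptions agree there.
  have hU : ∀ j, i + p + k ≤ j → (if j ≤ i + p + k then A j else C (j - p + q)) = C (j - p + q) := by
    intro j hj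
    split_ifs with h
    · rw [b1 _ (by omega), hAB j (by omega)]
    · rfl
  -- If `f` acts first, the middle column is still the first column up to the window of `f`, and
  -- from there on it is already the last column, with the renumbering by `e` undone.
  refine ⟨fun j => if j ≤ i + p + k then A j else C (j - p + q), ⟨?_, ?_, ?_⟩, ?_, ?_, ?_⟩
  · intro j hj
    simp only [Event.idx_place] at hj
    exact if_pos hj
  · intro j hj
    simp only [Event.idx_place, Event.inWidth_place, Event.outWidth_place] at hj ⊢
    rw [hU _ (by omega), ← hAB _ (by omega),
      show j + f.outWidth - p + q = j - p + q + f.outWidth by omega, b2 _ (by omega)]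
    congr 1; omega
  · simp only [Event.idx_place, Event.regionRel_place]
    rw [hU _ (by omega), ← hAB (i + p + k) (by omega),
      ← hAB (i + p + k + 1) (by omega), ← hAB (i + p + k + 2) (by omega)]
    convert b3 using 2 <;> omega
  · intro j hj
    simp only
    rw [if_pos (by omega), b1 j (by omega), a1 j hj]
  · intro j hj
    simp only
    split_ifs with h
    · rw [b1 _ (by omega), a2 j hj]
    · congr 1; omega
  · refine Event.regionRel_congr (fun hp hq => ?_) a3
    have hp' : p = 2 := hp
    have hq' : q = 2 := hq
    simp only
    rw [if_pos (by omega), if_pos (by omega), if_pos (by omega), b1 _ (by omega)]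
    exact ⟨rfl, rfl, rfl, rfl⟩

theorem exchange_exists' {A U C : ℕ → UnitAddCircle}
    (h₁ : (f.place (e.idx + e.inWidth + k)).RegionStep A U) (h₂ : e.RegionStep U C) :
    ∃ B, e.RegionStep A B ∧ (f.place (e.idx + e.outWidth + k)).RegionStep B C := by
  obtain ⟨b1, b2, b3⟩ := h₁
  obtain ⟨a1, a2, a3⟩ := h₂
  simp only [Event.idx_place, Event.inWidth_place, Event.outWidth_place,
    Event.regionRel_place] at b1 b2 b3
  set i := e.idx
  set p := e.inWidth
  set q := e.outWidth
  have hB : ∀ j, i + q + k ≤ j → (if j ≤ i + q + k then C j else A (j - q + p)) = A (j - q + p) := by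
    intro j hj
    split_ifs with h
    · rw [← b1 _ (by omega), ← a2 _ (by omega)]; congr 1; omega
    · rfl
  -- Now `e` acts first: the lower part is already that of the last column, the upper part is that
  -- of the first one, renumbered by `e`.
  refine ⟨fun j => if j ≤ i + q + k then C j else A (j - q + p), ⟨?_, ?_, ?_⟩, ?_, ?_, ?_⟩
  · intro j hj
    simp only
    rw [if_pos (by omega), a1 j hj, b1 j (by omega)]
  · intro j hj
    simp only
    split_ifs with h
    · rw [a2 j hj, b1 _ (by omega)]
    · congr 1; omega
  · refine Event.regionRel_congr (fun hp hq => ?_) a3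
    have hp' : p = 2 := hp
    have hq' : q = 2 := hq
    simp only
    rw [if_pos (by omega), b1 _ (by omega), b1 _ (by omega), b1 _ (by omega)]
    exact ⟨rfl, rfl, rfl, rfl⟩
  · intro j hj
    simp only [Event.idx_place] at hj
    exact (if_pos hj).symm
  · intro j hj
    simp only [Event.idx_place, Event.inWidth_place, Event.outWidth_place] at hj ⊢
    rw [hB _ (by omega), show j + f.outWidth = (j - q + f.outWidth) + q by omega,
      a2 _ (by omega), show j - q + f.outWidth + p = (j - q + p) + f.outWidth by omega,
      b2 _ (by omega)]
    congr 1; omega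
  · simp only [Event.idx_place, Event.regionRel_place]
    rw [hB _ (by omega), hB _ (by omega), hB _ (by omega),
      show i + q + k + 1 = (i + k + 1) + q by omega, a2 _ (by omega)]
    convert b3 using 2 <;> omega

/-- The second event does not touch the lower part of the middle column, and the first event only
renumbers the upper part. So the outer columns determine both parts, even if `e` or `f` is a birth
or a death. -/
theorem exchange_unique {A B B' C : ℕ → UnitAddCircle}
    (h₁ : e.RegionStep A B) (h₂ : (f.place (e.idx + e.outWidth + k)).RegionStep B C)
    (h₁' : e.RegionStep A B') (h₂' : (f.place (e.idx + e.outWidth + k)).RegionStep B' C) :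
    B = B' := by
  funext j
  by_cases hj : j ≤ e.idx + e.outWidth + k
  · rw [← h₂.1 j (by simpa using hj), ← h₂'.1 j (by simpa using hj)]
  · obtain ⟨m, rfl⟩ : ∃ m, j = m + e.outWidth := ⟨j - e.outWidth, by omega⟩
    rw [h₁.2.1 m (by omega), h₁'.2.1 m (by omega)]

theorem exchange_unique' {A U U' C : ℕ → UnitAddCircle}
    (h₁ : (f.place (e.idx + e.inWidth + k)).RegionStep A U) (h₂ : e.RegionStep U C)
    (h₁' : (f.place (e.idx + e.inWidth + k)).RegionStep A U') (h₂' : e.RegionStep U' C) :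
    U = U' := by
  funext j
  by_cases hj : j ≤ e.idx + e.inWidth + k
  · rw [h₁.1 j (by simpa using hj), h₁'.1 j (by simpa using hj)]
  · obtain ⟨m, rfl⟩ : ∃ m, j = m + e.inWidth := ⟨j - e.inWidth, by omega⟩
    rw [← h₂.2.1 m (by omega), ← h₂'.2.1 m (by omega)]

/-- Five ranges of heights are compared: below both windows, in the window of `e`, between the
windows, in the window of `f`, and above both. -/
theorem exchange_dir {A B U C C' : ℕ → Bool}
    (h₁ : e.DirStep A B) (h₂ : (f.place (e.idx + e.outWidth + k)).DirStep B C)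
    (h₁' : (f.place (e.idx + e.inWidth + k)).DirStep A U) (h₂' : e.DirStep U C') : C = C' := by
  have b1 := h₂.1.1
  have b2 := h₂.1.2
  have c1 := h₁'.1.1
  have c2 := h₁'.1.2
  simp only [Event.idx_place, Event.inWidth_place, Event.outWidth_place] at b1 b2 c1 c2
  funext j
  by_cases hj : j < e.idx + e.outWidth + k
  · rw [b1 j hj]
    by_cases h : j < e.idx
    · rw [h₁.1.1 j h, h₂'.1.1 j h, c1 j (by omega)]
    · by_cases h' : j < e.idx + e.outWidth
      · obtain ⟨m, rfl⟩ : ∃ m, j = e.idx + m := ⟨j - e.idx, by omega⟩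
        exact Event.DirStep.congr (e := e) (f := e) (a := e.idx) (by cases e <;> rfl) h₁ h₂'
          (fun l hl => (c1 _ (by omega)).symm) m (by omega)
      · obtain ⟨m, rfl⟩ : ∃ m, j = m + e.outWidth := ⟨j - e.outWidth, by omega⟩
        rw [h₁.1.2 m (by omega), h₂'.1.2 m (by omega), c1 _ (by omega)]
  · by_cases h : j < e.idx + e.outWidth + k + f.outWidth
    · obtain ⟨m, rfl⟩ : ∃ m, j = e.idx + e.outWidth + k + m :=
        ⟨j - (e.idx + e.outWidth + k), by omega⟩
      have := Event.DirStep.congr (e := f.place (e.idx + e.outWidth + k))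
        (f := f.place (e.idx + e.inWidth + k)) (a := e.idx + e.inWidth + k)
        (by cases f <;> rfl) h₂ h₁' (fun l hl => ?_) m (by simp; omega)
      · simp only [Event.idx_place] at this
        rw [this, show e.idx + e.outWidth + k + m = (e.idx + k + m) + e.outWidth by omega,
          h₂'.1.2 _ (by omega)]
        congr 1; omega
      · simp only [Event.idx_place]
        rw [show e.idx + e.outWidth + k + l = (e.idx + k + l) + e.outWidth by omega,
          h₁.1.2 _ (by omega)]
        congr 1; omega
    · obtain ⟨m, rfl⟩ : ∃ m, j = e.idx + k + m + e.outWidth + f.outWidth :=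
        ⟨j - (e.idx + e.outWidth + k + f.outWidth), by omega⟩
      rw [b2 _ (by omega),
        show e.idx + k + m + e.outWidth + f.inWidth = (e.idx + k + m + f.inWidth) + e.outWidth by
          omega, h₁.1.2 _ (by omega),
        show e.idx + k + m + e.outWidth + f.outWidth = (e.idx + k + m + f.outWidth) + e.outWidth by
          omega, h₂'.1.2 _ (by omega),
        show e.idx + k + m + f.outWidth + e.inWidth = (e.idx + k + m + e.inWidth) + f.outWidth by
          omega, c2 _ (by omega)]
      congr 1; omega

/-- A weight depends only on the window of its event, and the other event at most renumbers that
window. -/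
theorem exchange_weight {d₀ d₁ u : ℕ → Bool} {A B U C : ℕ → UnitAddCircle}
    (g₁ : e.DirStep d₀ d₁) (g₁' : (f.place (e.idx + e.inWidth + k)).DirStep d₀ u)
    (h₁ : e.RegionStep A B) (h₂ : (f.place (e.idx + e.outWidth + k)).RegionStep B C)
    (h₁' : (f.place (e.idx + e.inWidth + k)).RegionStep A U) (h₂' : e.RegionStep U C) :
    e.weight d₀ A B + (f.place (e.idx + e.outWidth + k)).weight d₁ B C =
      (f.place (e.idx + e.inWidth + k)).weight d₀ A U + e.weight u U C := by
  rw [add_comm]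
  have b1 := h₂.1
  have c1 := h₁'.1
  have c1' := g₁'.1.1
  simp only [Event.idx_place] at b1 c1 c1'
  congr 1
  · simp only [Event.weight, Event.localWeight_place, Event.idx_place]
    refine Event.localWeight_congr fun _ _ => ?_
    have hd : ∀ m, d₁ (e.idx + e.outWidth + k + m) = d₀ (e.idx + e.inWidth + k + m) := fun m => by
      rw [show e.idx + e.outWidth + k + m = (e.idx + k + m) + e.outWidth by omega,
        g₁.1.2 _ (by omega)]
      congr 1; omega
    have hB : ∀ m, B (e.idx + e.outWidth + k + m) = A (e.idx + e.inWidth + k + m) := fun m => by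
      rw [show e.idx + e.outWidth + k + m = (e.idx + k + m) + e.outWidth by omega,
        h₁.2.1 _ (by omega)]
      congr 1; omega
    refine ⟨hd 0, hd 1, hB 0, hB 1, hB 2, ?_⟩
    rw [show e.idx + e.outWidth + k + 1 = (e.idx + k + 1) + e.outWidth by omega,
      h₂'.2.1 _ (by omega)]
    congr 1; omega
  · refine Event.localWeight_congr fun h2 h2' => ?_
    refine ⟨(c1' _ (by omega)).symm, (c1' _ (by omega)).symm, (c1 _ (by omega)).symm,
      (c1 _ (by omega)).symm, (c1 _ (by omega)).symm, (b1 _ (by omega)).symm⟩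

theorem equivalent_exchange :
    Equivalent [e, f.place (e.idx + e.outWidth + k)] [f.place (e.idx + e.inWidth + k), e] where
  exists_run V h := by
    simp only [regionRun_cons] at h
    obtain ⟨U, h1, h2⟩ := exchange_exists e f k h.1 h.2.1
    exact exists_run_two h1 h2
  exists_run' V h := by
    simp only [regionRun_cons] at h
    obtain ⟨U, h1, h2⟩ := exchange_exists' e f k h.1 h.2.1
    exact exists_run_two h1 h2
  unique V V' h h' h0 h2 := by
    simp only [regionRun_cons] at h h'
    simp only [List.length_cons, List.length_nil, Nat.reduceAdd, zero_add] at h2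
    refine forall_le_two h0 ?_ h2
    rw [← h0] at h'
    exact exchange_unique e f k h.1 h.2.1 h'.1 (by simpa [h2] using h'.2.1)
  unique' V V' h h' h0 h2 := by
    simp only [regionRun_cons] at h h'
    simp only [List.length_cons, List.length_nil, Nat.reduceAdd, zero_add] at h2
    refine forall_le_two h0 ?_ h2
    rw [← h0] at h'
    exact exchange_unique' e f k h.1 h.2.1 h'.1 (by simpa [h2] using h'.2.1)
  dir_eq d d' h h' h0 := by
    simp only [dirRun_cons] at h h'
    rw [← h0] at h'
    exact exchange_dir e f k h.1 h.2.1 h'.1 h'.2.1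
  weight_eq d d' V V' g g' h h' g0 h0 h2 := by
    simp only [dirRun_cons, regionRun_cons] at g g' h h'
    simp only [List.length_cons, List.length_nil, Nat.reduceAdd, zero_add] at h2
    simp only [runWeight_cons, runWeight_nil, add_zero, zero_add, Nat.reduceAdd]
    rw [← h0, ← g0] at *
    simp only [zero_add, Nat.reduceAdd] at *
    have := h'.2.1
    rw [← h2] at this
    rw [exchange_weight e f k g.1 g'.1 h.1 h.2.1 h'.1 this, h2]

end Exchange

/-! ### Births, deaths, and curls at turning points -/

/-- Insertion of a region with value `y` and of a copy of region `i` above region `i`. -/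
def insertTwo {β : Type*} (W : ℕ → β) (i : ℕ) (y : β) : ℕ → β :=
  fun j => if j ≤ i then W j else if j = i + 1 then y else W (j - 2)

/-- Removal of the two regions above region `i`. -/
def removeTwo {β : Type*} (W : ℕ → β) (i : ℕ) : ℕ → β :=
  fun j => if j ≤ i then W j else W (j + 2)

section

variable {i : ℕ} {W : ℕ → UnitAddCircle} {y : UnitAddCircle}

theorem insertTwo_of_le {j : ℕ} (h : j ≤ i) : insertTwo W i y j = W j := if_pos h

theorem insertTwo_succ : insertTwo W i y (i + 1) = y := by simp [insertTwo]

theorem insertTwo_add_two {j : ℕ} (h : i ≤ j) : insertTwo W i y (j + 2) = W j := by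
  unfold insertTwo
  rw [if_neg (by omega), if_neg (by omega)]
  rfl

theorem removeTwo_of_le {j : ℕ} (h : j ≤ i) : removeTwo W i j = W j := if_pos h

theorem removeTwo_of_lt {j : ℕ} (h : i < j) : removeTwo W i j = W (j + 2) :=
  if_neg (by omega)

end

/-- The only freedom at a birth is the value of the region inside the turning point. -/
theorem regionStep_birth_iff {i : ℕ} {b : Bool} {W W' : ℕ → UnitAddCircle} :
    (Event.birth i b).RegionStep W W' ↔ W' = insertTwo W i (W' (i + 1)) := by
  constructor
  · rintro ⟨h1, h2, -⟩
    funext j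
    unfold insertTwo
    split_ifs with h h'
    · exact h1 j h
    · rw [h']
    · obtain ⟨k, rfl⟩ : ∃ k, j = k + 2 := ⟨j - 2, by omega⟩
      exact h2 k (show i ≤ k by omega)
  · intro h
    refine ⟨fun j hj => ?_, fun j hj => ?_, trivial⟩
    · rw [h]; exact if_pos hj
    · simp only [Event.idx] at hj
      rw [h]
      exact insertTwo_add_two hj

theorem regionStep_birth (i : ℕ) (b : Bool) (W : ℕ → UnitAddCircle) (y : UnitAddCircle) :
    (Event.birth i b).RegionStep W (insertTwo W i y) :=
  regionStep_birth_iff.2 (by congr 1; simp [insertTwo])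

/-- The equation is the compatibility of the two clauses about outer regions, which both apply to
region `i`: a death joins the regions below and above the pair of strands. -/
theorem regionStep_death_iff {i : ℕ} {W W' : ℕ → UnitAddCircle} :
    (Event.death i).RegionStep W W' ↔ W (i + 2) = W i ∧ W' = removeTwo W i := by
  constructor
  · rintro ⟨h1, h2, -⟩
    refine ⟨(h2 i le_rfl).symm.trans (h1 i le_rfl), ?_⟩
    funext j
    unfold removeTwo
    split_ifs with h
    · exact h1 j h
    · exact h2 j (show i ≤ j by omega)
  · rintro ⟨h, rfl⟩
    refine ⟨fun j hj => if_pos hj, fun j hj => ?_, trivial⟩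
    simp only [Event.idx] at hj
    change removeTwo W i j = W (j + 2)
    unfold removeTwo
    split_ifs with h'
    · obtain rfl : j = i := by omega
      exact h.symm
    · rfl

theorem regionStep_cross (i : ℕ) (o : Bool) (W : ℕ → UnitAddCircle) :
    (Event.cross i o).RegionStep W (Function.update W (i + 1)
      (if o then W (i + 1) + W i - W (i + 2) + half
        else W (i + 1) + W (i + 2) - W i + half)) :=
  regionStep_cross_iff.2 rfl

/-- The free value of the inner region is shifted by one half, which is a bijection of the possible
values, so both words allow the same last columns. -/
theorem equivalent_curl_birth (i : ℕ) (d o : Bool) :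
    Equivalent [.birth i d, .cross i o] [.birth i (!d)] := by
  -- Below and above the crossing lies the same region, so it cancels from the crossing relation and
  -- only the half is left.
  have key : ∀ W : ℕ → UnitAddCircle, ∀ y, (Event.cross i o).RegionStep (insertTwo W i y)
      (insertTwo W i (y + half)) := by
    intro W y
    rw [regionStep_cross_iff]
    funext j
    by_cases hj : j = i + 1
    · subst hj
      rw [Function.update_self, insertTwo_succ, insertTwo_succ, insertTwo_of_le le_rfl,
        insertTwo_add_two le_rfl]
      simp
    · rw [Function.update_of_ne hj]
      simp [insertTwo, hj]
  refine ⟨fun V h => ?_, fun V h => ?_, fun V V' h h' h0 h2 => ?_, fun V V' h h' h0 h2 => ?_,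
    fun g g' h h' h0 => ?_, fun g g' V V' k k' h h' g0 h0 h2 => ?_⟩
  · simp only [regionRun_cons, regionStep_birth_iff] at h
    refine exists_run_one (regionStep_birth_iff.2 ?_)
    have h1 := h.1
    have h2 := h.2.1
    simp only [zero_add, Nat.reduceAdd, List.length_cons, List.length_nil] at h2 ⊢
    rw [h1] at h2
    have := (regionStep_cross_iff.1 h2).trans (regionStep_cross_iff.1 (key _ _)).symm
    rw [this, insertTwo_succ]
  · simp only [regionRun_cons, regionStep_birth_iff] at h
    have h1 := h.1
    refine exists_run_two (regionStep_birth i d (V 0) (V 1 (i + 1) + half)) ?_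
    have := key (V 0) (V 1 (i + 1) + half)
    rw [add_assoc, half_add_half, add_zero, ← h1] at this
    exact this
  · simp only [regionRun_cons, regionStep_birth_iff] at h h'
    simp only [zero_add, Nat.reduceAdd, List.length_cons, List.length_nil] at h2 h h'
    refine forall_le_two h0 ?_ h2
    have e1 := h.2.1
    have e2 := h'.2.1
    rw [h.1] at e1 ⊢
    rw [h'.1] at e2 ⊢
    have e3 := (regionStep_cross_iff.1 e1).trans (regionStep_cross_iff.1 (key _ _)).symm
    have e4 := (regionStep_cross_iff.1 e2).trans (regionStep_cross_iff.1 (key _ _)).symm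
    have e5 := congrFun (e3.symm.trans (h2.trans e4)) (i + 1)
    rw [insertTwo_succ, insertTwo_succ, add_left_inj] at e5
    rw [e5, h0]
  · exact forall_le_one h0 h2
  · simp only [dirRun_cons] at h h'
    simp only [zero_add, Nat.reduceAdd, List.length_cons, List.length_nil] at h h' ⊢
    have e1 := h.1
    have e2 := dirStep_cross_iff.1 h.2.1
    have e3 := h'.1
    rw [← h0] at e3
    funext j
    rw [e2]
    simp only [Function.comp]
    by_cases h1 : j = i
    · subst h1
      rw [Equiv.swap_apply_left, e1.2.2, e3.2.1]
    · by_cases h2 : j = i + 1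
      · subst h2
        rw [Equiv.swap_apply_right, e1.2.1, e3.2.2, Bool.not_not]
      · rw [Equiv.swap_apply_of_ne_of_ne h1 h2]
        by_cases h3 : j < i
        · rw [e1.1.1 j h3, e3.1.1 j h3]
        · obtain ⟨m, rfl⟩ : ∃ m, j = m + 2 := ⟨j - 2, by omega⟩
          exact (e1.1.2 m (show i ≤ m by omega)).trans (e3.1.2 m (show i ≤ m by omega)).symm
  · simp only [regionRun_cons, dirRun_cons, regionStep_birth_iff] at h k
    simp only [zero_add, Nat.reduceAdd] at h k
    simp only [runWeight_cons, runWeight_nil, zero_add, add_zero]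
    have e1 : g 1 (i + 1) = !(g 1 i) := by rw [k.1.2.1, k.1.2.2]
    have e2 : V 1 (i + 2) = V 1 i := by
      rw [h.1, insertTwo_add_two le_rfl, insertTwo_of_le le_rfl]
    simp only [Event.weight, Event.localWeight, Event.idx, e1, e2]
    -- The first factor of the weight is the difference of the two regions which the oriented
    -- smoothing of the crossing joins. At a curl these are the same region, so the weight is zero.
    cases o <;> cases g 1 i <;> simp [crossWeight, cornerWeight]

/-- The crossing changes only the inner region, which the death forgets; the weight is zero as for
the curl at a birth. -/
theorem equivalent_curl_death (i : ℕ) (o : Bool) :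
    Equivalent [.cross i o, .death i] [.death i] := by
  have key : ∀ (W : ℕ → UnitAddCircle) y,
      removeTwo (Function.update W (i + 1) y) i = removeTwo W i := by
    intro W y
    funext j
    unfold removeTwo
    split_ifs with hj
    · rw [Function.update_of_ne (by omega)]
    · rw [Function.update_of_ne (by omega)]
  have key' : ∀ {A B C : ℕ → UnitAddCircle}, (Event.cross i o).RegionStep A B →
      (Event.death i).RegionStep B C → A (i + 2) = A i ∧ C = removeTwo A i := by
    intro A B C h h'
    rw [regionStep_cross_iff] at h
    rw [regionStep_death_iff] at h'
    subst h
    rw [Function.update_of_ne (by omega), Function.update_of_ne (by omega), key] at h'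
    exact h'
  refine ⟨fun V h => ?_, fun V h => ?_, fun V V' h h' h0 h2 => ?_, fun V V' h h' h0 h2 => ?_,
    fun g g' h h' h0 => ?_, fun g g' V V' k k' h h' g0 h0 h2 => ?_⟩
  · simp only [regionRun_cons] at h
    exact exists_run_one (regionStep_death_iff.2 (key' h.1 h.2.1))
  · simp only [regionRun_cons, regionStep_death_iff] at h
    refine exists_run_two (regionStep_cross i o (V 0)) (regionStep_death_iff.2 ?_)
    rw [Function.update_of_ne (by omega), Function.update_of_ne (by omega), key]
    exact h.1
  · simp only [regionRun_cons, regionStep_cross_iff] at h h'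
    refine forall_le_two h0 ?_ h2
    have e1 := h.1
    have e2 := h'.1
    rw [← h0] at e2
    exact e1.trans e2.symm
  · exact forall_le_one h0 h2
  · simp only [dirRun_cons] at h h'
    simp only [zero_add, Nat.reduceAdd, List.length_cons, List.length_nil] at h h' ⊢
    have e1 := dirStep_cross_iff.1 h.1
    have e2 := h.2.1
    have e3 := h'.1
    rw [← h0] at e3
    funext j
    by_cases h3 : j < i
    · rw [e2.1.1 j h3, e3.1.1 j h3, e1]
      simp only [Function.comp]
      rw [Equiv.swap_apply_of_ne_of_ne (by omega) (by omega)]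
    · rw [show g 2 j = g 1 (j + 2) from e2.1.2 j (show i ≤ j by omega),
        show g' 1 j = g 0 (j + 2) from e3.1.2 j (show i ≤ j by omega), e1]
      simp only [Function.comp]
      rw [Equiv.swap_apply_of_ne_of_ne (by omega) (by omega)]
  · simp only [regionRun_cons, dirRun_cons] at h k
    simp only [zero_add, Nat.reduceAdd] at h k
    simp only [runWeight_cons, runWeight_nil, zero_add, add_zero]
    have e1 : g 0 (i + 1) = !(g 0 i) := by
      have e3 := k.2.1.2
      simp only [k.1.2.1, k.1.2.2] at e3
      rw [e3, Bool.not_not]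
    have e2 : V 0 (i + 2) = V 0 i := (key' h.1 h.2.1).1
    simp only [Event.weight, Event.localWeight, Event.idx, e1, e2]
    cases o <;> cases g 0 i <;> simp [crossWeight, cornerWeight]

/-! ### Zigzags, the second and third Reidemeister moves, and curls on a strand -/

/-- Two functions on `ℕ` agree if they agree below `i`, on a window, and above it. -/
theorem funext_window {β : Type*} {f g : ℕ → β} (i n : ℕ) (h1 : ∀ j < i, f j = g j)
    (h2 : ∀ j < n, f (i + j) = g (i + j)) (h3 : ∀ j, i ≤ j → f (j + n) = g (j + n)) : f = g := by
  funext j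
  by_cases h : j < i
  · exact h1 j h
  · by_cases h' : j < i + n
    · obtain ⟨m, rfl⟩ : ∃ m, j = i + m := ⟨j - i, by omega⟩
      exact h2 m (by omega)
    · obtain ⟨m, rfl⟩ : ∃ m, j = m + n := ⟨j - n, by omega⟩
      exact h3 m (by omega)

/-- The death forces the free value of the birth to be that of the region which the zigzag enters;
then the last column is the first one, and no weights occur. -/
theorem equivalent_zigzag_below (i : ℕ) (d : Bool) :
    Equivalent [.birth i d, .death (i + 1)] [] := by
  have key : ∀ W : ℕ → UnitAddCircle, removeTwo (insertTwo W i (W (i + 1))) (i + 1) = W := by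
    intro W
    refine funext_window i 2 (fun j hj => ?_) (fun j hj => ?_) (fun j hj => ?_)
    · rw [removeTwo_of_le (by omega), insertTwo_of_le (by omega)]
    · interval_cases j
      · rw [removeTwo_of_le (by omega), insertTwo_of_le (by omega)]
      · rw [removeTwo_of_le (by omega), insertTwo_succ]
    · rw [removeTwo_of_lt (by omega), insertTwo_add_two (by omega)]
  have key' : ∀ {A B C : ℕ → UnitAddCircle}, (Event.birth i d).RegionStep A B →
      (Event.death (i + 1)).RegionStep B C → B = insertTwo A i (A (i + 1)) ∧ C = A := by
    intro A B C h h'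
    rw [regionStep_birth_iff] at h
    rw [regionStep_death_iff] at h'
    have e1 := h'.1
    rw [h, insertTwo_succ, show i + 1 + 2 = (i + 1) + 2 from rfl,
      insertTwo_add_two (by omega)] at e1
    rw [← e1] at h
    exact ⟨h, by rw [h'.2, h, key]⟩
  refine ⟨fun V h => ?_, fun V h => ?_, fun V V' h h' h0 h2 => ?_, fun V V' h h' h0 h2 => ?_,
    fun g g' h h' h0 => ?_, fun g g' V V' k k' h h' g0 h0 h2 => ?_⟩
  · simp only [regionRun_cons] at h
    exact ⟨fun _ => V 0, regionRun_nil _, rfl, (key' h.1 h.2.1).2.symm⟩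
  · refine exists_run_two (regionStep_birth i d (V 0) (V 0 (i + 1))) (regionStep_death_iff.2 ⟨?_, ?_⟩)
    · rw [insertTwo_succ, insertTwo_add_two (by omega)]
    · exact (key _).symm
  · simp only [regionRun_cons] at h h'
    refine forall_le_two h0 ?_ h2
    have e1 := (key' h.1 h.2.1).1
    have e2 := (key' h'.1 h'.2.1).1
    rw [← h0] at e2
    exact e1.trans e2.symm
  · intro k hk
    obtain rfl : k = 0 := by simpa using hk
    exact h0
  · simp only [dirRun_cons] at h
    simp only [zero_add, Nat.reduceAdd, List.length_cons, List.length_nil] at h ⊢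
    rw [← h0]
    obtain ⟨⟨⟨a1, a2⟩, a3, a4⟩, ⟨⟨b1, b2⟩, b3⟩, -⟩ := h
    simp only [Event.idx, Event.inWidth, Event.outWidth, add_zero] at *
    refine funext_window i 1 (fun j hj => ?_) (fun j hj => ?_) (fun j hj => ?_)
    · rw [b1 j (by omega), a1 j hj]
    · interval_cases j
      rw [add_zero, b1 i (by omega), a3, ← a2 i le_rfl, b3, a4, Bool.not_not]
    · rw [b2 (j + 1) (by omega), a2 (j + 1) (by omega)]
  · simp [runWeight_cons, runWeight_nil, Event.weight, Event.localWeight]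

theorem equivalent_zigzag_above (i : ℕ) (d : Bool) :
    Equivalent [.birth (i + 1) d, .death i] [] := by
  have key : ∀ W : ℕ → UnitAddCircle, removeTwo (insertTwo W (i + 1) (W i)) i = W := by
    intro W
    refine funext_window (i + 1) 0 (fun j hj => ?_) (fun j hj => ?_) (fun j hj => ?_)
    · rw [removeTwo_of_le (by omega), insertTwo_of_le (by omega)]
    · omega
    · rw [add_zero, removeTwo_of_lt (by omega), insertTwo_add_two (by omega)]
  have key' : ∀ {A B C : ℕ → UnitAddCircle}, (Event.birth (i + 1) d).RegionStep A B →
      (Event.death i).RegionStep B C → B = insertTwo A (i + 1) (A i) ∧ C = A := by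
    intro A B C h h'
    rw [regionStep_birth_iff] at h
    rw [regionStep_death_iff] at h'
    have e1 := h'.1
    rw [h, show i + 2 = i + 1 + 1 from rfl, insertTwo_succ, insertTwo_of_le (by omega)] at e1
    rw [show B (i + 1 + 1) = A i from e1] at h
    exact ⟨h, by rw [h'.2, h, key]⟩
  refine ⟨fun V h => ?_, fun V h => ?_, fun V V' h h' h0 h2 => ?_, fun V V' h h' h0 h2 => ?_,
    fun g g' h h' h0 => ?_, fun g g' V V' k k' h h' g0 h0 h2 => ?_⟩
  · simp only [regionRun_cons] at h
    exact ⟨fun _ => V 0, regionRun_nil _, rfl, (key' h.1 h.2.1).2.symm⟩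
  · refine exists_run_two (regionStep_birth (i + 1) d (V 0) (V 0 i))
      (regionStep_death_iff.2 ⟨?_, ?_⟩)
    · rw [show i + 2 = i + 1 + 1 from rfl, insertTwo_succ, insertTwo_of_le (by omega)]
    · exact (key _).symm
  · simp only [regionRun_cons] at h h'
    refine forall_le_two h0 ?_ h2
    have e1 := (key' h.1 h.2.1).1
    have e2 := (key' h'.1 h'.2.1).1
    rw [← h0] at e2
    exact e1.trans e2.symm
  · intro k hk
    obtain rfl : k = 0 := by simpa using hk
    exact h0
  · simp only [dirRun_cons] at h
    simp only [zero_add, Nat.reduceAdd, List.length_cons, List.length_nil] at h ⊢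
    rw [← h0]
    obtain ⟨⟨⟨a1, a2⟩, a3, a4⟩, ⟨⟨b1, b2⟩, b3⟩, -⟩ := h
    simp only [Event.idx, Event.inWidth, Event.outWidth, add_zero] at *
    refine funext_window i 1 (fun j hj => ?_) (fun j hj => ?_) (fun j hj => ?_)
    · rw [b1 j (by omega), a1 j (by omega)]
    · interval_cases j
      rw [add_zero, b2 i (by omega), show i + 2 = i + 1 + 1 from rfl, a4, ← a3, b3, Bool.not_not,
        a1 i (by omega)]
    · rw [b2 (j + 1) (by omega), a2 (j + 1) (by omega)]
  · simp [runWeight_cons, runWeight_nil, Event.weight, Event.localWeight]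

/-- Opposite crossings act by inverse maps, because twice one half is zero in `ℝ / ℤ`. -/
theorem equivalent_bigon (i : ℕ) (o : Bool) :
    Equivalent [.cross i o, .cross i (!o)] [] := by
  have h2 := half_add_half
  have key : ∀ {A B C : ℕ → UnitAddCircle}, (Event.cross i o).RegionStep A B →
      ((Event.cross i (!o)).RegionStep B C ↔ C = A) := by
    intro A B C h
    rw [regionStep_cross_iff] at h
    rw [regionStep_cross_iff]
    have : Function.update B (i + 1) (if (!o) = true then B (i + 1) + B i - B (i + 2) + half
        else B (i + 1) + B (i + 2) - B i + half) = A := by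
      subst h
      rw [Function.update_idem, Function.update_self, Function.update_of_ne (by omega),
        Function.update_of_ne (by omega), Function.update_eq_self_iff]
      cases o <;> simp only [Bool.not_true, Bool.not_false, if_true, if_false,
        Bool.false_eq_true] <;> grind
    rw [this]
  refine ⟨fun V h => ?_, fun V h => ?_, fun V V' h h' h0 h2 => ?_, fun V V' h h' h0 h2 => ?_,
    fun g g' h h' h0 => ?_, fun g g' V V' k k' h h' g0 h0 h2 => ?_⟩
  · simp only [regionRun_cons] at h
    exact ⟨fun _ => V 0, regionRun_nil _, rfl, ((key h.1).1 h.2.1).symm⟩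
  · exact exists_run_two (regionStep_cross i o (V 0)) ((key (regionStep_cross i o (V 0))).2 rfl)
  · simp only [regionRun_cons, regionStep_cross_iff] at h h'
    refine forall_le_two h0 ?_ h2
    have e2 := h'.1
    rw [← h0] at e2
    exact h.1.trans e2.symm
  · intro k hk
    obtain rfl : k = 0 := by simpa using hk
    exact h0
  · simp only [dirRun_cons] at h
    simp only [zero_add, Nat.reduceAdd, List.length_cons, List.length_nil] at h ⊢
    rw [← h0, dirStep_cross_iff.1 h.2.1, dirStep_cross_iff.1 h.1]
    funext j
    simp
  · simp only [regionRun_cons, dirRun_cons] at h k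
    simp only [zero_add, Nat.reduceAdd] at h k
    simp only [runWeight_cons, runWeight_nil, zero_add, add_zero, Nat.reduceAdd]
    have e1 : V 1 (i + 2) = V 0 (i + 2) := h.1.cross_of_ne (by omega)
    have e2 : V 1 i = V 0 i := h.1.cross_of_ne (by omega)
    have e3 : V 2 = V 0 := (key h.1).1 h.2.1
    have e4 : g 1 i = g 0 (i + 1) := k.1.2.1
    have e5 : g 1 (i + 1) = g 0 i := k.1.2.2
    simp only [Event.weight, Event.localWeight, Event.idx, e1, e2, e3, e4, e5]
    rw [← AddCircle.coe_add]
    -- Both crossings see the same representatives, with left and right exchanged. Their weights are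
    -- opposite as real numbers, so no integrality is needed.
    cases o <;> cases g 0 i <;> cases g 0 (i + 1) <;>
      simp only [crossWeight, cornerWeight, Bool.not_true, Bool.not_false, if_true, if_false,
        Bool.false_eq_true] <;> ring_nf <;> rfl

/-- Only regions `i + 1` and `i + 2` can change. For each admissible order of the strands the two
ways of computing them agree, up to multiples of `half + half`. -/
theorem triangle_end {i : ℕ} {o₁ o₂ o₃ : Bool} (ho : o₁ = o₃ → o₂ = o₁)
    {A B C E B' C' E' : ℕ → UnitAddCircle} (h1 : (Event.cross i o₁).RegionStep A B)
    (h2 : (Event.cross (i + 1) o₂).RegionStep B C) (h3 : (Event.cross i o₃).RegionStep C E)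
    (h1' : (Event.cross (i + 1) o₃).RegionStep A B') (h2' : (Event.cross i o₂).RegionStep B' C')
    (h3' : (Event.cross (i + 1) o₁).RegionStep C' E') : E = E' := by
  have a1 := h1.2.2
  have a2 := h2.2.2
  have a3 := h3.2.2
  have b1 := h1'.2.2
  have b2 := h2'.2.2
  have b3 := h3'.2.2
  simp only [Event.RegionRel, Event.idx] at a1 a2 a3 b1 b2 b3
  simp only [show i + 1 + 1 = i + 2 from rfl, show i + 1 + 2 = i + 3 from rfl] at *
  have hh := half_add_half
  rw [h1.cross_of_ne (j := i + 2) (by omega), h1.cross_of_ne (j := i + 3) (by omega)] at a2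
  rw [h2.cross_of_ne (j := i + 1) (by omega), h2.cross_of_ne (j := i) (by omega),
    h1.cross_of_ne (j := i) (by omega)] at a3
  rw [h1'.cross_of_ne (j := i + 1) (by omega), h1'.cross_of_ne (j := i) (by omega)] at b2
  rw [h2'.cross_of_ne (j := i + 2) (by omega), h2'.cross_of_ne (j := i + 3) (by omega),
    h1'.cross_of_ne (j := i + 3) (by omega)] at b3
  funext j
  by_cases hj1 : j = i + 1
  · subst hj1
    rw [h3'.cross_of_ne (j := i + 1) (by omega), a3, b2, a2, a1, b1]
    clear a1 a2 a3 b1 b2 b3 h1 h2 h3 h1' h2' h3'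
    cases o₁ <;> cases o₂ <;> cases o₃ <;> simp at ho <;>
      simp only [if_true, if_false, Bool.false_eq_true] <;>
      first
        | abel1
        | linear_combination (norm := module) hh
        | linear_combination (norm := module) -hh
        | linear_combination (norm := module) (2 : ℤ) • hh
  · by_cases hj2 : j = i + 2
    · subst hj2
      rw [h3.cross_of_ne (j := i + 2) (by omega), a2, b3, a1, b2, b1]
      clear a1 a2 a3 b1 b2 b3 h1 h2 h3 h1' h2' h3'
      cases o₁ <;> cases o₂ <;> cases o₃ <;> simp at ho <;>
        simp only [if_true, if_false, Bool.false_eq_true] <;>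
        first
          | abel1
          | linear_combination (norm := module) hh
          | linear_combination (norm := module) -hh
          | linear_combination (norm := module) (2 : ℤ) • hh
          | linear_combination (norm := module) (-2 : ℤ) • hh
    · rw [h3.cross_of_ne hj1, h2.cross_of_ne (by omega), h1.cross_of_ne hj1,
        h3'.cross_of_ne (by omega), h2'.cross_of_ne hj1, h1'.cross_of_ne (by omega)]

theorem exists_regionStep_cross (i : ℕ) (o : Bool) (A : ℕ → UnitAddCircle) :
    ∃ B, (Event.cross i o).RegionStep A B := ⟨_, regionStep_cross i o A⟩

theorem Event.RegionStep.cross_unique {j : ℕ} {o : Bool} {A A' B B' : ℕ → UnitAddCircle}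
    (h : (Event.cross j o).RegionStep A B) (h' : (Event.cross j o).RegionStep A' B')
    (hA : A = A') : B = B' := by
  subst hA
  rw [regionStep_cross_iff] at h h'
  exact h.trans h'.symm

/-- Translation to `triangle_weight`: the directions follow the permuted strands, and every region
value is traced back to the column in which it appears first. -/
theorem triangle_runWeight {i : ℕ} {o₁ o₂ o₃ : Bool} (ho : o₁ = o₃ → o₂ = o₁)
    {d₀ d₁ d₂ d₁' d₂' : ℕ → Bool} {A B C E B' C' : ℕ → UnitAddCircle}
    (k1 : (Event.cross i o₁).DirStep d₀ d₁) (k2 : (Event.cross (i + 1) o₂).DirStep d₁ d₂)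
    (k1' : (Event.cross (i + 1) o₃).DirStep d₀ d₁') (k2' : (Event.cross i o₂).DirStep d₁' d₂')
    (s1 : (Event.cross i o₁).RegionStep A B)
    (s2 : (Event.cross (i + 1) o₂).RegionStep B C) (s3 : (Event.cross i o₃).RegionStep C E)
    (s1' : (Event.cross (i + 1) o₃).RegionStep A B') (s2' : (Event.cross i o₂).RegionStep B' C')
    (s3' : (Event.cross (i + 1) o₁).RegionStep C' E) :
    (Event.cross i o₁).weight d₀ A B + ((Event.cross (i + 1) o₂).weight d₁ B C +
        (Event.cross i o₃).weight d₂ C E) =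
      (Event.cross (i + 1) o₃).weight d₀ A B' + ((Event.cross i o₂).weight d₁' B' C' +
        (Event.cross (i + 1) o₁).weight d₂' C' E) := by
  rw [dirStep_cross_iff] at k1 k2 k1' k2'
  obtain ⟨n₁, l₁⟩ := exists_lift_cross s1
  obtain ⟨n₂, l₂⟩ := exists_lift_cross s2
  obtain ⟨n₃, l₃⟩ := exists_lift_cross s3
  obtain ⟨n₄, l₄⟩ := exists_lift_cross s1'
  have e1 : d₁ (i + 1) = d₀ i := by simp [k1]
  have e2 : d₁ (i + 2) = d₀ (i + 2) := by
    rw [k1]; exact congrArg d₀ (Equiv.swap_apply_of_ne_of_ne (by omega) (by omega))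
  have e3 : d₂ i = d₀ (i + 1) := by
    rw [k2, Function.comp, Equiv.swap_apply_of_ne_of_ne (by omega) (by omega), k1, Function.comp,
      Equiv.swap_apply_left]
  have e4 : d₂ (i + 1) = d₀ (i + 2) := by rw [k2, ← e2]; simp
  have e1' : d₁' (i + 1) = d₀ (i + 2) := by simp [k1']
  have e2' : d₁' i = d₀ i := by
    rw [k1']; exact congrArg d₀ (Equiv.swap_apply_of_ne_of_ne (by omega) (by omega))
  have e3' : d₂' (i + 1) = d₀ i := by rw [k2', ← e2']; simp
  have e4' : d₂' (i + 2) = d₀ (i + 1) := by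
    rw [k2', Function.comp, Equiv.swap_apply_of_ne_of_ne (by omega) (by omega), k1', Function.comp,
      Equiv.swap_apply_right]
  have f1 : B (i + 2) = A (i + 2) := s1.cross_of_ne (by omega)
  have f2 : B (i + 3) = A (i + 3) := s1.cross_of_ne (by omega)
  have f3 : C (i + 1) = B (i + 1) := s2.cross_of_ne (by omega)
  have f4 : C i = A i := (s2.cross_of_ne (by omega)).trans (s1.cross_of_ne (by omega))
  have f5 : B' (i + 1) = A (i + 1) := s1'.cross_of_ne (by omega)
  have f6 : B' i = A i := s1'.cross_of_ne (by omega)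
  have f7 : C' (i + 2) = B' (i + 2) := s2'.cross_of_ne (by omega)
  have f8 : C' (i + 3) = A (i + 3) :=
    (s2'.cross_of_ne (by omega)).trans (s1'.cross_of_ne (by omega))
  have f9 : C' (i + 1) = E (i + 1) := (s3'.cross_of_ne (by omega)).symm
  have f10 : E (i + 2) = C (i + 2) := s3.cross_of_ne (by omega)
  simp only [show i + 1 + 1 = i + 2 from rfl, show i + 1 + 2 = i + 3 from rfl,
    f1, f2, f3, f4] at l₁ l₂ l₃ l₄
  simp only [Event.weight, Event.localWeight, Event.idx, show i + 1 + 1 = i + 2 from rfl,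
    show i + 1 + 2 = i + 3 from rfl, f1, f2, f3, f4, f5, f6, f7, f8, f9, f10, e1, e2, e3, e4,
    e1', e2', e3', e4']
  rw [← add_assoc, ← add_assoc]
  simp only [← AddCircle.coe_add]
  exact coe_eq_coe_of_sub_mem (triangle_weight ho _ _ _ l₁ l₂ l₃ l₄)

theorem equivalent_triangle (i : ℕ) (o₁ o₂ o₃ : Bool) (ho : o₁ = o₃ → o₂ = o₁) :
    Equivalent [.cross i o₁, .cross (i + 1) o₂, .cross i o₃]
      [.cross (i + 1) o₃, .cross i o₂, .cross (i + 1) o₁] := by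
  refine ⟨fun V h => ?_, fun V h => ?_, fun V V' h h' h0 h3 => ?_, fun V V' h h' h0 h3 => ?_,
    fun g g' h h' h0 => ?_, fun g g' V V' k k' h h' g0 h0 h3 => ?_⟩
  · simp only [regionRun_cons] at h
    obtain ⟨A, r1⟩ := exists_regionStep_cross (i + 1) o₃ (V 0)
    obtain ⟨B, r2⟩ := exists_regionStep_cross i o₂ A
    obtain ⟨C, r3⟩ := exists_regionStep_cross (i + 1) o₁ B
    rw [← triangle_end ho h.1 h.2.1 h.2.2.1 r1 r2 r3] at r3
    exact exists_run_three r1 r2 r3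
  · simp only [regionRun_cons] at h
    obtain ⟨A, r1⟩ := exists_regionStep_cross i o₁ (V 0)
    obtain ⟨B, r2⟩ := exists_regionStep_cross (i + 1) o₂ A
    obtain ⟨C, r3⟩ := exists_regionStep_cross i o₃ B
    rw [triangle_end ho r1 r2 r3 h.1 h.2.1 h.2.2.1] at r3
    exact exists_run_three r1 r2 r3
  · simp only [regionRun_cons] at h h'
    have e1 := h.1.cross_unique h'.1 h0
    exact forall_le_three h0 e1 (h.2.1.cross_unique h'.2.1 e1) h3
  · simp only [regionRun_cons] at h h'
    have e1 := h.1.cross_unique h'.1 h0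
    exact forall_le_three h0 e1 (h.2.1.cross_unique h'.2.1 e1) h3
  · simp only [dirRun_cons] at h h'
    simp only [zero_add, Nat.reduceAdd, List.length_cons, List.length_nil] at h h' ⊢
    rw [dirStep_cross_iff.1 h.2.2.1, dirStep_cross_iff.1 h.2.1, dirStep_cross_iff.1 h.1,
      dirStep_cross_iff.1 h'.2.2.1, dirStep_cross_iff.1 h'.2.1, dirStep_cross_iff.1 h'.1, ← h0]
    simp only [Function.comp_assoc]
    congr 1
    funext j
    simp only [Function.comp]
    simp only [Equiv.swap_apply_def]
    split_ifs <;> omega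
  · simp only [regionRun_cons, dirRun_cons] at h h' k k'
    simp only [zero_add, Nat.reduceAdd, List.length_cons, List.length_nil] at h h' k k' h3
    simp only [runWeight_cons, runWeight_nil, zero_add, add_zero, Nat.reduceAdd]
    rw [← h0, ← h3] at h'
    rw [← g0] at k'
    rw [← h0, ← g0, ← h3]
    exact triangle_runWeight ho k.1 k.2.1 k'.1 k'.2.1 h.1 h.2.1 h.2.2.1 h'.1 h'.2.1 h'.2.2.1

/-- The death forces the region inside the turning point to be the region across the strand plus one
half. With this value the crossing leaves its column unchanged, so the regions on its left and right
agree and its weight is zero. -/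
theorem equivalent_curl_above (i : ℕ) (d o : Bool) :
    Equivalent [.birth (i + 1) d, .cross i o, .death (i + 1)] [] := by
  have hh := half_add_half
  have key : ∀ W : ℕ → UnitAddCircle, (Event.cross i o).RegionStep
      (insertTwo W (i + 1) (W i + half)) (insertTwo W (i + 1) (W i + half)) := by
    intro W
    rw [regionStep_cross_iff, eq_comm, Function.update_eq_self_iff, insertTwo_of_le le_rfl,
      insertTwo_of_le (Nat.le_succ i), show i + 2 = i + 1 + 1 from rfl, insertTwo_succ]
    cases o <;> simp only [if_true, if_false, Bool.false_eq_true] <;> grind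
  have key₂ : ∀ (W : ℕ → UnitAddCircle) y, removeTwo (insertTwo W (i + 1) y) (i + 1) = W := by
    intro W y
    funext j
    by_cases hj : j ≤ i + 1
    · rw [removeTwo_of_le hj, insertTwo_of_le hj]
    · rw [removeTwo_of_lt (by omega), insertTwo_add_two (by omega)]
  have key' : ∀ {A B C E : ℕ → UnitAddCircle}, (Event.birth (i + 1) d).RegionStep A B →
      (Event.cross i o).RegionStep B C → (Event.death (i + 1)).RegionStep C E →
      B = insertTwo A (i + 1) (A i + half) ∧ C = B ∧ E = A := by
    intro A B C E h h' h''
    rw [regionStep_birth_iff] at h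
    rw [regionStep_death_iff] at h''
    have e1 := h''.1
    have e2 : C (i + 1) = _ := h'.2.2
    simp only [Event.idx] at e2
    rw [h'.cross_of_ne (by omega), e2, h, insertTwo_add_two (j := i + 1) le_rfl,
      insertTwo_of_le le_rfl, insertTwo_of_le (Nat.le_succ i), show i + 2 = i + 1 + 1 from rfl,
      insertTwo_succ] at e1
    -- Solves the closing condition `e1` for the free value of the birth.
    have e3 : B (i + 1 + 1) = A i + half := by
      cases o <;> simp only [if_true, if_false, Bool.false_eq_true] at e1
      · linear_combination (norm := module) -e1 - hh
      · linear_combination (norm := module) e1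
    rw [e3] at h
    have e4 : C = B := by
      rw [h] at h' ⊢
      exact (regionStep_cross_iff.1 h').trans (regionStep_cross_iff.1 (key A)).symm
    refine ⟨h, e4, ?_⟩
    rw [h''.2, e4, h, key₂]
  refine ⟨fun V h => ?_, fun V h => ?_, fun V V' h h' h0 h2 => ?_, fun V V' h h' h0 h2 => ?_,
    fun g g' h h' h0 => ?_, fun g g' V V' k k' h h' g0 h0 h2 => ?_⟩
  · simp only [regionRun_cons] at h
    exact ⟨fun _ => V 0, regionRun_nil _, rfl, (key' h.1 h.2.1 h.2.2.1).2.2.symm⟩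
  · refine exists_run_three (regionStep_birth (i + 1) d (V 0) (V 0 i + half)) (key _)
      (regionStep_death_iff.2 ⟨?_, (key₂ _ _).symm⟩)
    rw [insertTwo_add_two le_rfl, insertTwo_of_le le_rfl]
  · simp only [regionRun_cons] at h h'
    obtain ⟨a1, a2, -⟩ := key' h.1 h.2.1 h.2.2.1
    obtain ⟨b1, b2, -⟩ := key' h'.1 h'.2.1 h'.2.2.1
    rw [← h0] at b1
    exact forall_le_three h0 (a1.trans b1.symm) ((a2.trans a1).trans (b2.trans b1).symm) h2
  · intro k hk
    obtain rfl : k = 0 := by simpa using hk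
    exact h0
  · simp only [dirRun_cons] at h
    simp only [zero_add, Nat.reduceAdd, List.length_cons, List.length_nil] at h ⊢
    rw [← h0]
    obtain ⟨⟨⟨a1, a2⟩, a3, a4⟩, hc, ⟨⟨b1, b2⟩, b3⟩, -⟩ := h
    rw [dirStep_cross_iff] at hc
    rw [hc] at b1 b2 b3
    simp only [Event.idx, Event.inWidth, Event.outWidth, add_zero, Function.comp] at *
    rw [Equiv.swap_apply_right, Equiv.swap_apply_of_ne_of_ne (by omega) (by omega), a4,
      a1 i (by omega)] at b3
    refine funext_window i 1 (fun j hj => ?_) (fun j hj => ?_) (fun j hj => ?_)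
    · rw [b1 j (by omega), Equiv.swap_apply_of_ne_of_ne (by omega) (by omega), a1 j (by omega)]
    · interval_cases j
      rw [add_zero, b1 i (by omega), Equiv.swap_apply_left, a3]
      simpa using b3
    · rw [b2 (j + 1) (by omega), Equiv.swap_apply_of_ne_of_ne (by omega) (by omega),
        a2 (j + 1) (by omega)]
  · simp only [regionRun_cons, dirRun_cons] at h k
    simp only [zero_add, Nat.reduceAdd] at h k
    simp only [runWeight_cons, runWeight_nil, zero_add, add_zero, Nat.reduceAdd]
    obtain ⟨a1, a2, -⟩ := key' h.1 h.2.1 h.2.2.1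
    have e1 : g 1 (i + 1) = g 1 i := by
      have e2 := k.2.2.1.2
      have e3 := dirStep_cross_iff.1 k.2.1
      simp only at e2
      rw [e3] at e2
      simp only [Function.comp] at e2
      rw [Equiv.swap_apply_right, Equiv.swap_apply_of_ne_of_ne (by omega) (by omega), k.1.2.2] at e2
      rw [k.1.2.1]
      simpa using e2
    simp only [Event.weight, Event.localWeight, Event.idx, e1, a2]
    cases o <;> cases g 1 i <;> simp [crossWeight, cornerWeight]

/-- Mirror image of the curl above the strand: the inner region is forced to be the region above the
strand plus one half. -/
theorem equivalent_curl_below (i : ℕ) (d o : Bool) :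
    Equivalent [.birth i d, .cross (i + 1) o, .death i] [] := by
  have hh := half_add_half
  have key : ∀ W : ℕ → UnitAddCircle, (Event.cross (i + 1) o).RegionStep
      (insertTwo W i (W (i + 1) + half)) (insertTwo W i (W (i + 1) + half)) := by
    intro W
    rw [regionStep_cross_iff, eq_comm, Function.update_eq_self_iff, insertTwo_succ,
      insertTwo_add_two (Nat.le_succ i), show i + 1 + 1 = i + 2 from rfl, insertTwo_add_two le_rfl]
    cases o <;> simp only [if_true, if_false, Bool.false_eq_true] <;> grind
  have key₂ : ∀ (W : ℕ → UnitAddCircle) y, removeTwo (insertTwo W i y) i = W := by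
    intro W y
    funext j
    by_cases hj : j ≤ i
    · rw [removeTwo_of_le hj, insertTwo_of_le hj]
    · rw [removeTwo_of_lt (by omega), insertTwo_add_two (by omega)]
  have key' : ∀ {A B C E : ℕ → UnitAddCircle}, (Event.birth i d).RegionStep A B →
      (Event.cross (i + 1) o).RegionStep B C → (Event.death i).RegionStep C E →
      B = insertTwo A i (A (i + 1) + half) ∧ C = B ∧ E = A := by
    intro A B C E h h' h''
    rw [regionStep_birth_iff] at h
    rw [regionStep_death_iff] at h''
    have e1 := h''.1
    have e2 : C (i + 2) = _ := h'.2.2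
    simp only [Event.idx] at e2
    rw [h'.cross_of_ne (j := i) (by omega), e2, h, insertTwo_succ,
      insertTwo_add_two (j := i + 1) (Nat.le_succ i), show i + 1 + 1 = i + 2 from rfl,
      insertTwo_add_two le_rfl, insertTwo_of_le le_rfl] at e1
    have e3 : B (i + 1) = A (i + 1) + half := by
      cases o <;> simp only [if_true, if_false, Bool.false_eq_true] at e1
      · linear_combination (norm := module) -e1
      · linear_combination (norm := module) e1 - hh
    rw [e3] at h
    have e4 : C = B := by
      rw [h] at h' ⊢
      exact (regionStep_cross_iff.1 h').trans (regionStep_cross_iff.1 (key A)).symm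
    refine ⟨h, e4, ?_⟩
    rw [h''.2, e4, h, key₂]
  refine ⟨fun V h => ?_, fun V h => ?_, fun V V' h h' h0 h2 => ?_, fun V V' h h' h0 h2 => ?_,
    fun g g' h h' h0 => ?_, fun g g' V V' k k' h h' g0 h0 h2 => ?_⟩
  · simp only [regionRun_cons] at h
    exact ⟨fun _ => V 0, regionRun_nil _, rfl, (key' h.1 h.2.1 h.2.2.1).2.2.symm⟩
  · refine exists_run_three (regionStep_birth i d (V 0) (V 0 (i + 1) + half)) (key _)
      (regionStep_death_iff.2 ⟨?_, (key₂ _ _).symm⟩)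
    rw [insertTwo_add_two le_rfl, insertTwo_of_le le_rfl]
  · simp only [regionRun_cons] at h h'
    obtain ⟨a1, a2, -⟩ := key' h.1 h.2.1 h.2.2.1
    obtain ⟨b1, b2, -⟩ := key' h'.1 h'.2.1 h'.2.2.1
    rw [← h0] at b1
    exact forall_le_three h0 (a1.trans b1.symm) ((a2.trans a1).trans (b2.trans b1).symm) h2
  · intro k hk
    obtain rfl : k = 0 := by simpa using hk
    exact h0
  · simp only [dirRun_cons] at h
    simp only [zero_add, Nat.reduceAdd, List.length_cons, List.length_nil] at h ⊢
    rw [← h0]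
    obtain ⟨⟨⟨a1, a2⟩, a3, a4⟩, hc, ⟨⟨b1, b2⟩, b3⟩, -⟩ := h
    rw [dirStep_cross_iff] at hc
    rw [hc] at b1 b2 b3
    simp only [Event.idx, Event.inWidth, Event.outWidth, add_zero, Function.comp] at *
    rw [Equiv.swap_apply_left, Equiv.swap_apply_of_ne_of_ne (by omega) (by omega), a3,
      show i + 1 + 1 = i + 2 from rfl, a2 i le_rfl] at b3
    refine funext_window i 1 (fun j hj => ?_) (fun j hj => ?_) (fun j hj => ?_)
    · rw [b1 j (by omega), Equiv.swap_apply_of_ne_of_ne (by omega) (by omega), a1 j (by omega)]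
    · interval_cases j
      rw [add_zero, b2 i le_rfl, show i + 2 = i + 1 + 1 from rfl, Equiv.swap_apply_right, a4, b3]
    · rw [b2 (j + 1) (by omega), Equiv.swap_apply_of_ne_of_ne (by omega) (by omega),
        a2 (j + 1) (by omega)]
  · simp only [regionRun_cons, dirRun_cons] at h k
    simp only [zero_add, Nat.reduceAdd] at h k
    simp only [runWeight_cons, runWeight_nil, zero_add, add_zero, Nat.reduceAdd]
    obtain ⟨a1, a2, -⟩ := key' h.1 h.2.1 h.2.2.1
    have e1 : g 1 (i + 2) = g 1 (i + 1) := by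
      have e2 := k.2.2.1.2
      have e3 := dirStep_cross_iff.1 k.2.1
      simp only at e2
      rw [e3] at e2
      simp only [Function.comp] at e2
      rw [Equiv.swap_apply_left, Equiv.swap_apply_of_ne_of_ne (by omega) (by omega), k.1.2.1] at e2
      rw [k.1.2.2]
      exact e2
    have e2 : V 1 (i + 2) = V 1 i := by
      rw [a1, insertTwo_add_two le_rfl, insertTwo_of_le le_rfl]
    simp only [Event.weight, Event.localWeight, Event.idx, a2, show i + 1 + 1 = i + 2 from rfl, e1,
      e2]
    cases o <;> cases g 1 (i + 1) <;> simp [crossWeight, cornerWeight]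

/-! ### Sliding a strand along a turning point -/

/-- The weight is read relative to the direction of the under-passing strand. The slide rotates the
crossing, reverses one strand direction as seen from left to right, and permutes the four regions,
so both sides become the same `cornerWeight`. -/
theorem slide_birth_weight (o d e : Bool) {b x y z : ℝ} {n : ℤ}
    (h : z = (if o then b + y - x + 1 / 2 else b + x - y + 1 / 2) + n) :
    crossWeight o d e b x y z = crossWeight (!o) e (!d) x z b y := by
  subst h
  cases o <;> cases d <;> cases e <;>
    simp only [crossWeight, cornerWeight, Bool.not_true, Bool.not_false, if_true, if_false,
      Bool.false_eq_true]

theorem slide_death_weight (o d e : Bool) {a b c x : ℝ} {n : ℤ}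
    (h : b = (if o then c + a - x + 1 / 2 else c + x - a + 1 / 2) + n) :
    crossWeight o e (!d) c x a b = crossWeight (!o) d e a c b x := by
  subst h
  cases o <;> cases d <;> cases e <;>
    simp only [crossWeight, cornerWeight, Bool.not_true, Bool.not_false, if_true, if_false,
      Bool.false_eq_true]

section SlideBirth

variable {i : ℕ} {d o : Bool} {A B C : ℕ → UnitAddCircle}

/-- The pair `(y, z)` consists of the inner regions of the turning point before and after the slide.
Both words are parametrized by the same pairs, with the same last column; compare
`slide_birth_new_iff`. -/
theorem slide_birth_old_iff :
    ((Event.birth i d).RegionStep A B ∧ (Event.cross (i + 1) o).RegionStep B C) ↔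
      ∃ y z, (z = if o then A i + y - A (i + 1) + half else A i + A (i + 1) - y + half) ∧
        B = insertTwo A i y ∧ C = Function.update (insertTwo A i y) (i + 2) z := by
  rw [regionStep_cross_iff]
  constructor
  · rintro ⟨h, rfl⟩
    rw [regionStep_birth_iff] at h
    refine ⟨B (i + 1), _, rfl, h, ?_⟩
    rw [h, insertTwo_succ, show i + 1 + 2 = (i + 1) + 2 from rfl, insertTwo_add_two (Nat.le_succ i),
      show i + 1 + 1 = i + 2 from rfl, insertTwo_add_two le_rfl]
  · rintro ⟨y, z, rfl, rfl, rfl⟩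
    refine ⟨regionStep_birth _ _ _ _, ?_⟩
    rw [insertTwo_succ, show i + 1 + 2 = (i + 1) + 2 from rfl, insertTwo_add_two (Nat.le_succ i),
      show i + 1 + 1 = i + 2 from rfl, insertTwo_add_two le_rfl]

theorem slide_birth_new_iff :
    ((Event.birth (i + 1) d).RegionStep A B ∧ (Event.cross i (!o)).RegionStep B C) ↔
      ∃ y z, (z = if o then A i + y - A (i + 1) + half else A i + A (i + 1) - y + half) ∧
        B = insertTwo A (i + 1) z ∧ C = Function.update (insertTwo A i y) (i + 2) z := by
  have hh := half_add_half
  have e1 : ∀ y z, Function.update (insertTwo A i y) (i + 2) z =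
      Function.update (insertTwo A (i + 1) z) (i + 1) y := by
    intro y z
    funext j
    simp only [Function.update_apply, insertTwo]
    split_ifs <;> first | omega | rfl
  rw [regionStep_cross_iff]
  constructor
  · rintro ⟨h, rfl⟩
    rw [regionStep_birth_iff] at h
    rw [h, show i + 2 = i + 1 + 1 from rfl, insertTwo_succ, insertTwo_of_le le_rfl,
      insertTwo_of_le (Nat.le_succ i)]
    refine ⟨_, B (i + 1 + 1), ?_, rfl, (e1 _ _).symm⟩
    cases o <;> simp only [if_true, if_false, Bool.false_eq_true, Bool.not_true, Bool.not_false]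
    · abel
    · linear_combination (norm := module) -hh
  · rintro ⟨y, z, h, rfl, rfl⟩
    refine ⟨regionStep_birth _ _ _ _, ?_⟩
    rw [e1, show i + 2 = i + 1 + 1 from rfl, insertTwo_succ, insertTwo_of_le le_rfl,
      insertTwo_of_le (Nat.le_succ i)]
    congr 1
    cases o <;> simp only [if_true, if_false, Bool.false_eq_true, Bool.not_true, Bool.not_false]
      at h ⊢
    · rw [h]; abel
    · rw [h]; linear_combination (norm := module) -hh

/-- Both parameters can be read off the last column, at heights `i + 1` and `i + 2`; this gives
uniqueness of the middle column. -/
theorem update_insertTwo_injective {y z y' z' : UnitAddCircle}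
    (h : Function.update (insertTwo A i y) (i + 2) z =
      Function.update (insertTwo A i y') (i + 2) z') : y = y' ∧ z = z' := by
  constructor
  · have := congrFun h (i + 1)
    rwa [Function.update_of_ne (by omega), Function.update_of_ne (by omega), insertTwo_succ,
      insertTwo_succ] at this
  · have := congrFun h (i + 2)
    rwa [Function.update_self, Function.update_self] at this

end SlideBirth

theorem equivalent_slide_birth (i : ℕ) (d o : Bool) :
    Equivalent [.birth i d, .cross (i + 1) o] [.birth (i + 1) d, .cross i (!o)] := by
  refine ⟨fun V h => ?_, fun V h => ?_, fun V V' h h' h0 h2 => ?_, fun V V' h h' h0 h2 => ?_,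
    fun g g' h h' h0 => ?_, fun g g' V V' k k' h h' g0 h0 h2 => ?_⟩
  · simp only [regionRun_cons] at h
    obtain ⟨y, z, hz, -, hC⟩ := slide_birth_old_iff.1 ⟨h.1, h.2.1⟩
    obtain ⟨s1, s2⟩ := slide_birth_new_iff.2 ⟨y, z, hz, rfl, hC⟩
    exact exists_run_two s1 s2
  · simp only [regionRun_cons] at h
    obtain ⟨y, z, hz, -, hC⟩ := slide_birth_new_iff.1 ⟨h.1, h.2.1⟩
    obtain ⟨s1, s2⟩ := slide_birth_old_iff.2 ⟨y, z, hz, rfl, hC⟩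
    exact exists_run_two s1 s2
  · simp only [regionRun_cons] at h h'
    rw [← h0] at h'
    obtain ⟨y, z, hz, hB, hC⟩ := slide_birth_old_iff.1 ⟨h.1, h.2.1⟩
    obtain ⟨y', z', hz', hB', hC'⟩ := slide_birth_old_iff.1 ⟨h'.1, h'.2.1⟩
    obtain ⟨rfl, rfl⟩ := update_insertTwo_injective (hC.symm.trans (h2.trans hC'))
    exact forall_le_two h0 (hB.trans hB'.symm) h2
  · simp only [regionRun_cons] at h h'
    rw [← h0] at h'
    obtain ⟨y, z, hz, hB, hC⟩ := slide_birth_new_iff.1 ⟨h.1, h.2.1⟩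
    obtain ⟨y', z', hz', hB', hC'⟩ := slide_birth_new_iff.1 ⟨h'.1, h'.2.1⟩
    obtain ⟨rfl, rfl⟩ := update_insertTwo_injective (hC.symm.trans (h2.trans hC'))
    exact forall_le_two h0 (hB.trans hB'.symm) h2
  · simp only [dirRun_cons, dirStep_cross_iff] at h h'
    simp only [zero_add, Nat.reduceAdd, List.length_cons, List.length_nil] at h h' ⊢
    rw [← h0] at h'
    obtain ⟨⟨⟨a1, a2⟩, a3, a4⟩, a5, -⟩ := h
    obtain ⟨⟨⟨b1, b2⟩, b3, b4⟩, b5, -⟩ := h'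
    simp only [Event.idx, Event.inWidth, Event.outWidth, add_zero] at *
    rw [a5, b5]
    refine funext_window i 3 (fun j hj => ?_) (fun j hj => ?_) (fun j hj => ?_)
    · simp only [Function.comp]
      rw [Equiv.swap_apply_of_ne_of_ne (by omega) (by omega),
        Equiv.swap_apply_of_ne_of_ne (by omega) (by omega), a1 j hj, b1 j (by omega)]
    · simp only [Function.comp]
      interval_cases j
      · rw [add_zero, Equiv.swap_apply_of_ne_of_ne (by omega) (by omega), Equiv.swap_apply_left, a3,
          b3]
      · rw [Equiv.swap_apply_left, Equiv.swap_apply_right, show i + 1 + 1 = i + 2 from rfl,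
          a2 i le_rfl, b1 i (by omega)]
      · rw [show i + 1 + 1 = i + 2 from rfl, Equiv.swap_apply_right,
          Equiv.swap_apply_of_ne_of_ne (by omega) (by omega), a4, ← b4]
    · simp only [Function.comp]
      rw [Equiv.swap_apply_of_ne_of_ne (by omega) (by omega),
        Equiv.swap_apply_of_ne_of_ne (by omega) (by omega), show j + 3 = (j + 1) + 2 from rfl,
        a2 _ (by omega), b2 _ (by omega)]
  · simp only [regionRun_cons, dirRun_cons] at h h' k k'
    simp only [zero_add, Nat.reduceAdd, List.length_cons, List.length_nil] at h h' k k' h2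
    rw [← h0, ← h2] at h'
    rw [← g0] at k'
    simp only [runWeight_cons, runWeight_nil, zero_add, add_zero, Nat.reduceAdd]
    obtain ⟨⟨⟨a1, a2⟩, a3, a4⟩, -⟩ := k
    obtain ⟨⟨⟨b1, b2⟩, b3, b4⟩, -⟩ := k'
    simp only [Event.idx, Event.inWidth, Event.outWidth, add_zero] at a1 a2 a3 a4 b1 b2 b3 b4
    obtain ⟨y, z, hz, hB, hC⟩ := slide_birth_old_iff.1 ⟨h.1, h.2.1⟩
    obtain ⟨y', z', hz', hB', hC'⟩ := slide_birth_new_iff.1 ⟨h'.1, h'.2.1⟩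
    obtain ⟨rfl, rfl⟩ := update_insertTwo_injective (hC.symm.trans hC')
    obtain ⟨n, hn⟩ := exists_lift_cross h.2.1
    have e1 : V 1 (i + 1) = y := by rw [hB, insertTwo_succ]
    have e2 : V 1 (i + 2) = V 0 i := by rw [hB, insertTwo_add_two le_rfl]
    have e3 : V 1 (i + 3) = V 0 (i + 1) := by
      rw [hB, show i + 3 = (i + 1) + 2 from rfl, insertTwo_add_two (Nat.le_succ i)]
    have e4 : V 2 (i + 2) = z := by rw [hC, Function.update_self]
    have e5 : V 2 (i + 1) = y := by
      rw [hC, Function.update_of_ne (by omega), insertTwo_succ]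
    have e6 : V' 1 (i + 1) = V 0 (i + 1) := by rw [hB', insertTwo_of_le le_rfl]
    have e7 : V' 1 (i + 2) = z := by rw [hB', show i + 2 = i + 1 + 1 from rfl, insertTwo_succ]
    have e8 : V' 1 i = V 0 i := by rw [hB', insertTwo_of_le (Nat.le_succ i)]
    have e9 : g 1 (i + 2) = g' 1 i := by rw [a2 i le_rfl, b1 i (by omega)]
    have e10 : g' 1 (i + 1) = !g 1 (i + 1) := by rw [b3, a4, Bool.not_not]
    simp only [show i + 1 + 1 = i + 2 from rfl, show i + 1 + 2 = i + 3 from rfl, e1, e2, e3,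
      e4] at hn
    simp only [Event.weight, Event.localWeight, Event.idx, show i + 1 + 1 = i + 2 from rfl,
      show i + 1 + 2 = i + 3 from rfl, e1, e2, e3, e4, e5, e6, e7, e8, e9, e10, ← h2, zero_add]
    rw [slide_birth_weight o _ _ hn]

section SlideDeath

variable {i : ℕ} {o : Bool} {A B C : ℕ → UnitAddCircle}

/-- Here the word imposes an equation on the first column instead of having a parameter.
`slide_death_new_iff` gives the same equation and the same last column. -/
theorem slide_death_old_iff :
    ((Event.cross (i + 1) o).RegionStep A B ∧ (Event.death i).RegionStep B C) ↔
      (A i = if o then A (i + 2) + A (i + 1) - A (i + 3) + half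
        else A (i + 2) + A (i + 3) - A (i + 1) + half) ∧
        B = Function.update A (i + 2) (A i) ∧ C = removeTwo A i := by
  have e1 : ∀ y, removeTwo (Function.update A (i + 2) y) i = removeTwo A i := by
    intro y
    funext j
    simp only [Function.update_apply, removeTwo]
    split_ifs <;> first | omega | rfl
  rw [regionStep_cross_iff, regionStep_death_iff]
  constructor
  · rintro ⟨rfl, h, rfl⟩
    rw [show i + 1 + 1 = i + 2 from rfl, Function.update_self,
      Function.update_of_ne (by omega)] at h
    rw [show i + 1 + 1 = i + 2 from rfl, e1]
    exact ⟨h.symm, by rw [h], rfl⟩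
  · rintro ⟨h, rfl, rfl⟩
    refine ⟨by rw [h], ?_, (e1 _).symm⟩
    rw [Function.update_self, Function.update_of_ne (by omega)]

theorem slide_death_new_iff :
    ((Event.cross i (!o)).RegionStep A B ∧ (Event.death (i + 1)).RegionStep B C) ↔
      (A i = if o then A (i + 2) + A (i + 1) - A (i + 3) + half
        else A (i + 2) + A (i + 3) - A (i + 1) + half) ∧
        B = Function.update A (i + 1) (A (i + 3)) ∧ C = removeTwo A i := by
  have hh := half_add_half
  have e1 : removeTwo (Function.update A (i + 1) (A (i + 3))) (i + 1) = removeTwo A i := by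
    funext j
    simp only [Function.update_apply, removeTwo]
    split_ifs <;> first | omega | rfl | (congr 1; omega)
  have e2 : (A (i + 3) = if (!o) = true then A (i + 1) + A i - A (i + 2) + half
      else A (i + 1) + A (i + 2) - A i + half) ↔ (A i = if o then A (i + 2) + A (i + 1) - A (i + 3) + half
        else A (i + 2) + A (i + 3) - A (i + 1) + half) := by
    cases o <;> simp only [if_true, if_false, Bool.false_eq_true, Bool.not_true, Bool.not_false]
    · constructor <;> intro h
      · linear_combination (norm := module) -h - hh
      · linear_combination (norm := module) -h - hh
    · constructor <;> intro h
      · linear_combination (norm := module) h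
      · linear_combination (norm := module) h
  rw [regionStep_cross_iff, regionStep_death_iff, ← e2]
  constructor
  · rintro ⟨rfl, h, rfl⟩
    rw [Function.update_self, Function.update_of_ne (by omega)] at h
    exact ⟨h, by rw [← h], by rw [← h, e1]⟩
  · rintro ⟨h, rfl, rfl⟩
    refine ⟨by rw [← h], ?_, e1.symm⟩
    rw [Function.update_self, Function.update_of_ne (by omega)]

end SlideDeath

theorem equivalent_slide_death (i : ℕ) (o : Bool) :
    Equivalent [.cross (i + 1) o, .death i] [.cross i (!o), .death (i + 1)] := by
  refine ⟨fun V h => ?_, fun V h => ?_, fun V V' h h' h0 h2 => ?_, fun V V' h h' h0 h2 => ?_,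
    fun g g' h h' h0 => ?_, fun g g' V V' k k' h h' g0 h0 h2 => ?_⟩
  · simp only [regionRun_cons] at h
    obtain ⟨hz, -, hC⟩ := slide_death_old_iff.1 ⟨h.1, h.2.1⟩
    obtain ⟨s1, s2⟩ := slide_death_new_iff.2 ⟨hz, rfl, hC⟩
    exact exists_run_two s1 s2
  · simp only [regionRun_cons] at h
    obtain ⟨hz, -, hC⟩ := slide_death_new_iff.1 ⟨h.1, h.2.1⟩
    obtain ⟨s1, s2⟩ := slide_death_old_iff.2 ⟨hz, rfl, hC⟩
    exact exists_run_two s1 s2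
  · simp only [regionRun_cons] at h h'
    exact forall_le_two h0 (h.1.cross_unique h'.1 h0) h2
  · simp only [regionRun_cons] at h h'
    exact forall_le_two h0 (h.1.cross_unique h'.1 h0) h2
  · simp only [dirRun_cons, dirStep_cross_iff] at h h'
    simp only [zero_add, Nat.reduceAdd, List.length_cons, List.length_nil] at h h' ⊢
    rw [← h0] at h'
    obtain ⟨a1, ⟨⟨a2, a3⟩, a4⟩, -⟩ := h
    obtain ⟨b1, ⟨⟨b2, b3⟩, b4⟩, -⟩ := h'
    rw [a1] at a2 a3
    rw [b1] at b2 b3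
    simp only [Event.idx, Event.inWidth, Event.outWidth, add_zero, Function.comp] at a2 a3 b2 b3
    refine funext_window i 1 (fun j hj => ?_) (fun j hj => ?_) (fun j hj => ?_)
    · rw [a2 j hj, b2 j (by omega), Equiv.swap_apply_of_ne_of_ne (by omega) (by omega),
        Equiv.swap_apply_of_ne_of_ne (by omega) (by omega)]
    · interval_cases j
      rw [add_zero, a3 i le_rfl, b2 i (by omega), show i + 1 + 1 = i + 2 from rfl,
        Equiv.swap_apply_right, Equiv.swap_apply_left]
    · rw [a3 (j + 1) (by omega), b3 (j + 1) (by omega),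
        Equiv.swap_apply_of_ne_of_ne (by omega) (by omega),
        Equiv.swap_apply_of_ne_of_ne (by omega) (by omega)]
  · simp only [regionRun_cons, dirRun_cons] at h h' k k'
    simp only [zero_add, Nat.reduceAdd, List.length_cons, List.length_nil] at h h' k k' h2
    rw [← h0, ← h2] at h'
    rw [← g0] at k'
    simp only [runWeight_cons, runWeight_nil, zero_add, add_zero, Nat.reduceAdd]
    rw [← h0, ← g0]
    obtain ⟨hz, hB, -⟩ := slide_death_old_iff.1 ⟨h.1, h.2.1⟩
    obtain ⟨-, hB', -⟩ := slide_death_new_iff.1 ⟨h'.1, h'.2.1⟩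
    obtain ⟨n, hn⟩ := exists_lift_cross h.1
    have e1 : V 1 (i + 2) = V 0 i := by rw [hB, Function.update_self]
    have e2 : V' 1 (i + 1) = V 0 (i + 3) := by rw [hB', Function.update_self]
    have e3 : g 0 (i + 2) = !g 0 i := by
      have e4 := k.2.1.2
      simp only at e4
      rw [dirStep_cross_iff.1 k.1] at e4
      simp only [Function.comp] at e4
      rwa [Equiv.swap_apply_left, Equiv.swap_apply_of_ne_of_ne (by omega) (by omega)] at e4
    simp only [show i + 1 + 1 = i + 2 from rfl, show i + 1 + 2 = i + 3 from rfl, e1] at hn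
    simp only [Event.weight, Event.localWeight, Event.idx, show i + 1 + 1 = i + 2 from rfl,
      show i + 1 + 2 = i + 3 from rfl, e1, e2, e3, add_zero]
    rw [slide_death_weight o _ _ hn]

theorem LocalMove.equivalent {v w : List Event} (h : LocalMove v w) : Equivalent v w := by
  cases h with
  | curl_above i d o => exact equivalent_curl_above i d o
  | curl_below i d o => exact equivalent_curl_below i d o
  | curl_birth i d o => exact equivalent_curl_birth i d o
  | curl_death i o => exact equivalent_curl_death i o
  | bigon i o => exact equivalent_bigon i o
  | triangle i o₁ o₂ o₃ h => exact equivalent_triangle i o₁ o₂ o₃ h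
  | zigzag_below i d => exact equivalent_zigzag_below i d
  | zigzag_above i d => exact equivalent_zigzag_above i d
  | slide_birth i d o => exact equivalent_slide_birth i d o
  | slide_death i o => exact equivalent_slide_death i o
  | exchange e f k => exact equivalent_exchange e f k

/-! ### Regions next to a strand, and the winding index -/

/-- The part of `Event.RegionStep` which concerns the regions outside of the event. -/
def RegionOff {β : Type*} (e : Event) (W W' : ℕ → β) : Prop :=
  (∀ j ≤ e.idx, W' j = W j) ∧ ∀ j, e.idx ≤ j → W' (j + e.outWidth) = W (j + e.inWidth)

theorem Event.RegionStep.regionOff {e : Event} {W W' : ℕ → UnitAddCircle}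
    (h : e.RegionStep W W') : RegionOff e W W' := ⟨h.1, h.2.1⟩

/-- The winding index of the regions of a column, from below. -/
def index (d : ℕ → Bool) : ℕ → ℤ
  | 0 => 0
  | j + 1 => index d j + if d j then 1 else -1

/-- The index above an event is unchanged: the two strands of a birth or a death have opposite
directions, and a crossing only permutes the two contributions. -/
theorem regionOff_index {e : Event} {d d' : ℕ → Bool} (h : e.DirStep d d') :
    RegionOff e (index d) (index d') := by
  have h1 : ∀ j ≤ e.idx, index d' j = index d j := by
    intro j hj
    induction j with
    | zero => rfl
    | succ j ih => rw [index, index, ih (by omega), h.1.1 j (by omega)]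
  refine ⟨h1, fun j hj => ?_⟩
  induction j, hj using Nat.le_induction with
  | base =>
    cases e with
    | birth i b =>
      have := h1 i le_rfl
      change index d' (i + 1 + 1) = index d i
      rw [index, index, this, h.2.1, h.2.2]
      cases b <;> simp
    | death i =>
      have := h1 i le_rfl
      change index d' i = index d (i + 1 + 1)
      rw [index, index, this, show d (i + 1) = !d i from h.2]
      cases d i <;> simp
    | cross i o =>
      have := h1 i le_rfl
      change index d' (i + 1 + 1) = index d (i + 1 + 1)
      rw [index, index, index, index, this, show d' i = d (i + 1) from h.2.1,
        show d' (i + 1) = d i from h.2.2]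
      ring
  | succ j hj ih =>
    rw [show j + 1 + e.outWidth = (j + e.outWidth) + 1 by omega,
      show j + 1 + e.inWidth = (j + e.inWidth) + 1 by omega, index, index, ih, h.1.2 j hj]

/-- The number of the region on the left, or on the right, of a strand. -/
def side (left : Bool) (d : ℕ → Bool) (j : ℕ) : ℕ := j + if d j = left then 1 else 0

/-- A crossingless arc keeps the same region on a given side: at a turning point both the direction
and the roles of above and below are reversed. -/
theorem plainStep_side {β : Type*} {e : Event} {d d' : ℕ → Bool} {W W' : ℕ → β}
    (hd : e.DirStep d d') (h : RegionOff e W W') (left : Bool) :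
    LongDiagram.PlainStep e (fun j => W (side left d j)) (fun j => W' (side left d' j)) := by
  refine ⟨⟨fun j hj => ?_, fun j hj => ?_⟩, ?_⟩
  · simp only [side, hd.1.1 j hj]
    exact h.1 _ (by split_ifs <;> omega)
  · simp only [side, hd.1.2 j hj]
    rw [show ∀ k, j + e.outWidth + k = (j + k) + e.outWidth by intro k; omega,
      show ∀ k, j + e.inWidth + k = (j + k) + e.inWidth by intro k; omega]
    exact h.2 _ (by omega)
  · cases e with
    | birth i b =>
      have e1 : W' (i + 2) = W' i := (h.2 i le_rfl).trans (h.1 i le_rfl).symm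
      have e2 := hd.2.1
      have e3 := hd.2.2
      simp only [side, e2, e3]
      cases b <;> cases left <;> simp [e1]
    | death i =>
      have e1 : W (i + 2) = W i := (h.2 i le_rfl).symm.trans (h.1 i le_rfl)
      have e2 : d (i + 1) = !d i := hd.2
      simp only [side, e2]
      cases d i <;> cases left <;> simp [e1]
    | cross i o => trivial

namespace LongDiagram

variable {D : LongDiagram}

/-- The value of a function of regions on the left, or on the right, of a sample point. -/
def sideValue {β : Type*} (left : Bool) (W : ℕ → ℕ → β) (p : D.Point) : β :=
  W p.col (side left (dir D.word p.col) p.pos)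

theorem sideValue_eq_of_link {β : Type*} (left : Bool) {W : ℕ → ℕ → β}
    (hW : ∀ t e, D.word[t]? = some e → RegionOff e (W t) (W (t + 1))) {p q : D.Point}
    (h : Link .plain p q) : sideValue left W p = sideValue left W q :=
  eq_of_link_plain (φ := fun t j => W t (side left (dir D.word t) j))
    (fun t e he => plainStep_side (D.dirStep he) (hW t e he) left) h

theorem sideValue_leftEnd {β : Type*} (W : ℕ → ℕ → β) :
    sideValue true W D.leftEnd = W 0 0 := by
  simp [sideValue, leftEnd, side, dir_zero]

theorem dir_length (D : LongDiagram) : dir D.word D.word.length 0 = false := by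
  simp [dir, D.last]

theorem sideValue_rightEnd {β : Type*} (W : ℕ → ℕ → β) :
    sideValue true W D.rightEnd = W D.word.length 0 := by
  simp [sideValue, rightEnd, side, dir_length]

/-- The winding index of the region on the left of a sample point. -/
def leftIndex (p : D.Point) : ℤ := sideValue true (fun t => index (dir D.word t)) p

theorem leftIndex_eq_of_link {p q : D.Point} (h : Link .plain p q) : leftIndex p = leftIndex q :=
  sideValue_eq_of_link (W := fun t => index (dir D.word t)) true
    (fun _ _ he => regionOff_index (D.dirStep he)) h

theorem bridge_eq_of_link {p q : D.Point} (h : Link .plain p q) : bridge p = bridge q :=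
  Quot.sound (Or.inl h)

theorem bridge_eq_of_link_over {p q : D.Point} (h : Link .over p q) : bridge p = bridge q :=
  Quot.sound (Or.inr h)

namespace Crossing

variable (c : D.Crossing)

theorem underIn_eq : c.underIn = if c.upOver then
    (if dir D.word c.time (c.idx + 1) then .nw else .se)
    else (if dir D.word c.time c.idx then .sw else .ne) := by
  unfold underIn entry
  split_ifs with h <;> simp_all [toRight_sw, toRight_nw, Corner.opp]

theorem overIn_eq : c.overIn = if c.upOver then
    (if dir D.word c.time c.idx then .sw else .ne)
    else (if dir D.word c.time (c.idx + 1) then .nw else .se) := by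
  unfold overIn entry
  split_ifs with h <;> simp_all [toRight_sw, toRight_nw, Corner.opp]

theorem underOut_eq : c.underOut = if c.upOver then
    (if dir D.word c.time (c.idx + 1) then .se else .nw)
    else (if dir D.word c.time c.idx then .ne else .sw) := by
  unfold underOut
  rw [underIn_eq]
  split_ifs <;> rfl

theorem leftSide_eq : c.leftSide = if c.upOver then
    (if dir D.word c.time (c.idx + 1) then .ne else .sw)
    else (if dir D.word c.time c.idx then .nw else .se) := by
  unfold leftSide
  rw [underOut_eq]
  split_ifs <;> rfl

theorem rightSide_eq : c.rightSide = if c.upOver then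
    (if dir D.word c.time (c.idx + 1) then .sw else .ne)
    else (if dir D.word c.time c.idx then .se else .nw) := by
  unfold rightSide
  rw [leftSide_eq]
  split_ifs <;> rfl

theorem sideValue_sw {β : Type*} (l : Bool) (W : ℕ → ℕ → β) : sideValue l W (c.point .sw) =
    W c.time (c.idx + if dir D.word c.time c.idx = l then 1 else 0) := rfl

theorem sideValue_nw {β : Type*} (l : Bool) (W : ℕ → ℕ → β) : sideValue l W (c.point .nw) =
    W c.time (c.idx + 1 + if dir D.word c.time (c.idx + 1) = l then 1 else 0) := rfl

theorem sideValue_se {β : Type*} (l : Bool) (W : ℕ → ℕ → β) : sideValue l W (c.point .se) =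
    W (c.time + 1) (c.idx + if dir D.word c.time (c.idx + 1) = l then 1 else 0) := by
  simp only [sideValue, side, point, c.dir_right.1]

theorem sideValue_ne {β : Type*} (l : Bool) (W : ℕ → ℕ → β) : sideValue l W (c.point .ne) =
    W (c.time + 1) (c.idx + 1 + if dir D.word c.time c.idx = l then 1 else 0) := by
  simp only [sideValue, side, point, c.dir_right.2]

/-- The index rises by one when a strand is crossed to its left. The over-passing strand crosses the
under-passing one; the sign for the under-passing strand depends on the direction of the other one.
These are the conditions on admissible assignments. -/
theorem leftIndex_point : leftIndex (c.point c.leftSide) = leftIndex (c.point c.rightSide) + 1 ∧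
    (leftIndex (c.point c.underOut) = leftIndex (c.point c.underIn) + 1 ∨
      leftIndex (c.point c.underOut) = leftIndex (c.point c.underIn) - 1) := by
  have h1 := c.dir_right
  have h0 := (regionOff_index (D.dirStep c.isCross)).1 c.idx le_rfl
  simp only [leftIndex, leftSide_eq, rightSide_eq, underIn_eq, underOut_eq]
  cases c.upOver <;> cases e1 : dir D.word c.time c.idx <;>
    cases e2 : dir D.word c.time (c.idx + 1) <;>
    simp [sideValue_sw, sideValue_nw, sideValue_se, sideValue_ne, e1, e2, index, h0, h1] <;>
    omega

theorem bridge_leftSide : bridge (c.point c.leftSide) = bridge (c.point c.rightSide) := by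
  have h1 := c.link_sw_ne
  have h2 := c.link_nw_se
  rw [leftSide_eq, rightSide_eq]
  cases h : c.upOver <;> simp only [h, if_true, if_false, Bool.false_eq_true] at h1 h2 ⊢ <;>
    split_ifs <;> first | exact bridge_eq_of_link_over h1 |
      exact bridge_eq_of_link_over h2 | exact (bridge_eq_of_link_over h1).symm |
      exact (bridge_eq_of_link_over h2).symm

theorem bridge_overIn : bridge (c.point c.overIn) = bridge (c.point c.rightSide) := by
  have h1 := c.link_sw_ne
  have h2 := c.link_nw_se
  rw [overIn_eq, rightSide_eq]
  cases h : c.upOver <;> simp only [h, if_true, if_false, Bool.false_eq_true] at h1 h2 ⊢ <;>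
    split_ifs <;> first | rfl | exact bridge_eq_of_link_over h1 |
      exact bridge_eq_of_link_over h2 | exact (bridge_eq_of_link_over h1).symm |
      exact (bridge_eq_of_link_over h2).symm

end Crossing

/-- A link which is not plain joins the two over-passing or the two under-passing ends of a
crossing. -/
theorem exists_ends_of_link {k : Kind} (hk : k ≠ .plain) {p q : D.Point} (h : Link k p q) :
    ∃ c : D.Crossing, (k = .over ∧ ((p = c.point c.leftSide ∧ q = c.point c.rightSide) ∨
        (q = c.point c.leftSide ∧ p = c.point c.rightSide))) ∨
      (k = .under ∧ ((p = c.point c.underIn ∧ q = c.point c.underOut) ∨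
        (q = c.point c.underIn ∧ p = c.point c.underOut))) := by
  obtain ⟨c, h | h⟩ := exists_crossing_of_link hk h <;> obtain ⟨rfl, rfl, rfl⟩ := h <;>
    refine ⟨c, ?_⟩ <;>
    rw [c.leftSide_eq, c.rightSide_eq, c.underIn_eq, c.underOut_eq] <;>
    cases c.upOver <;> simp <;> split_ifs <;> simp

/-! ### Admissible assignments -/

theorem two_mul_eps : (2 : D.Alg) * D.eps = 1 := by
  have := IsLocalization.Away.mul_invSelf (S := Localization.Away (2 : ℤ)) (2 : ℤ)
  have h3 := congrArg (MvPolynomial.C (σ := D.Bridge)) this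
  have h2 : (MvPolynomial.C (2 : Localization.Away (2 : ℤ)) : D.Alg) = 2 := map_ofNat _ 2
  rw [map_mul, map_one, map_ofNat (algebraMap ℤ (Localization.Away (2 : ℤ))) 2, h2] at h3
  exact h3

theorem evalAt_eps (x : D.Bridge → ℝ) : evalAt x D.eps = 1 / 2 := by
  have := congrArg (evalAt x) (two_mul_eps (D := D))
  rw [map_mul, map_one, map_ofNat] at this
  linarith

theorem evalAt_var (x : D.Bridge → ℝ) (b : D.Bridge) : evalAt x (var b) = x b := by
  simp [evalAt, var]

variable (D) in
/-- The admissible assignment given by the winding indices of the regions. -/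
noncomputable def indexAdmissible : D.Admissible where
  elt := Quot.lift (fun p => var (bridge p) + leftIndex p • D.eps) (fun p q h => by
    rw [bridge_eq_of_link h, leftIndex_eq_of_link h])
  on_bridge p := ⟨leftIndex p, rfl⟩
  at_over c := by
    change var _ + _ • _ = var _ + _ • _ + _
    rw [c.bridge_leftSide, c.leftIndex_point.1, add_zsmul, one_zsmul, add_assoc]
  at_under c m n hm hn := by
    have hinj : ∀ a b : ℤ, a • D.eps = b • D.eps → a = b := by
      intro a b hab
      have := congrArg (evalAt (fun _ => 0)) hab
      simpa [map_zsmul, evalAt_eps] using this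
    have hm' : leftIndex (c.point c.underIn) = m := hinj _ _ (add_left_cancel hm)
    have hn' : leftIndex (c.point c.underOut) = n := hinj _ _ (add_left_cancel hn)
    -- A change by plus or minus one makes the sum of the two coefficients odd.
    rw [← hm', ← hn']
    rcases c.leftIndex_point.2 with h | h <;> rw [h]
    · exact ⟨leftIndex (c.point c.underIn), by ring⟩
    · exact ⟨leftIndex (c.point c.underIn) - 1, by ring⟩
  at_rightEnd := by
    change var _ + _ • _ = var _
    rw [show leftIndex D.rightEnd = 0 from sideValue_rightEnd _, zero_zsmul, add_zero]
  at_leftEnd := by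
    change var _ + _ • _ = var _
    rw [show leftIndex D.leftEnd = 0 from sideValue_leftEnd _, zero_zsmul, add_zero]

/-! ### Arbitrary admissible assignments -/

theorem zsmul_eps_injective {a b : ℤ} (h : a • D.eps = b • D.eps) : a = b := by
  have := congrArg (evalAt (fun _ => 0)) h
  simpa [map_zsmul, evalAt_eps] using this

/-- A property which is transported along all arcs and holds at the right end holds everywhere. -/
theorem forall_of_link {P : D.Point → Prop} (h : ∀ k p q, Link k p q → (P p ↔ P q))
    (h0 : P D.rightEnd) (p : D.Point) : P p := by
  have key : ∀ a b : D.Point, Relation.EqvGen (fun a b => ∃ k, Link k a b) a b → (P a ↔ P b) := by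
    intro a b hab
    induction hab with
    | rel a b hab => obtain ⟨k, hk⟩ := hab; exact h k a b hk
    | refl a => exact Iff.rfl
    | symm a b _ ih => exact ih.symm
    | trans a b c _ _ ih1 ih2 => exact ih1.trans ih2
  exact (key p D.rightEnd (D.connected p D.rightEnd)).2 h0

theorem leftIndex_rightEnd : leftIndex D.rightEnd = 0 := sideValue_rightEnd _

/-- The coefficients and the winding indices are constant on segments and change parity together at
each passage through a crossing. They agree at the right end, and the diagram is a single curve. -/
theorem Admissible.exists_coeff (A : D.Admissible) : ∃ m : D.Point → ℤ,
    ∀ p, A.at' p = var (bridge p) + m p • D.eps ∧ Even (m p - leftIndex p) := by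
  choose m hm using A.on_bridge
  have hplain : ∀ p q : D.Point, Link .plain p q → m p = m q := by
    intro p q h
    have h1 : (segment p : D.Segment) = segment q := Quot.sound h
    have h2 := hm p
    rw [h1, hm q, bridge_eq_of_link h] at h2
    exact (zsmul_eps_injective (add_left_cancel h2)).symm
  have hover : ∀ c : D.Crossing, m (c.point c.leftSide) = m (c.point c.rightSide) + 1 := by
    intro c
    have h2 := A.at_over c
    rw [hm, hm, c.bridge_leftSide, add_assoc] at h2
    refine zsmul_eps_injective (D := D) ?_
    rw [add_zsmul, one_zsmul]
    exact add_left_cancel h2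
  have hunder : ∀ c : D.Crossing, Odd (m (c.point c.underIn) + m (c.point c.underOut)) :=
    fun c => A.at_under c _ _ (hm _) (hm _)
  refine ⟨m, fun p => ⟨hm p, ?_⟩⟩
  refine forall_of_link (P := fun p => Even (m p - leftIndex p)) ?_ ?_ p
  · intro k p q h
    by_cases hk : k = .plain
    · subst hk
      rw [hplain p q h, leftIndex_eq_of_link h]
    · obtain ⟨c, ⟨-, ⟨rfl, rfl⟩ | ⟨rfl, rfl⟩⟩ | ⟨-, ⟨rfl, rfl⟩ | ⟨rfl, rfl⟩⟩⟩ :=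
        exists_ends_of_link hk h
      all_goals
        have h1 := hover c
        have h2 := hunder c
        have h3 := c.leftIndex_point
        rw [Int.odd_iff] at h2
        rw [Int.even_iff, Int.even_iff]
        omega
  · have h2 := hm D.rightEnd
    rw [A.at_rightEnd] at h2
    have : (0 : ℤ) = m D.rightEnd := zsmul_eps_injective (by
      rw [zero_zsmul]
      exact add_left_cancel (a := var (bridge D.rightEnd)) (by rw [add_zero]; exact h2))
    rw [← this, leftIndex_rightEnd]
    simp

/-- The real value of the segment through a sample point. -/
noncomputable def Admissible.value (A : D.Admissible) (x : D.Bridge → ℝ) (p : D.Point) : ℝ :=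
  evalAt x (A.at' p)

theorem zsmul_half_of_even {n : ℤ} (h : Even n) : n • half = 0 := by
  obtain ⟨k, rfl⟩ := h
  rw [add_zsmul, ← zsmul_add, half_add_half, zsmul_zero]

theorem coe_int_div_two (m : ℤ) : (((m : ℝ) / 2 : ℝ) : UnitAddCircle) = m • half := by
  rw [half, ← AddCircle.coe_zsmul]
  congr 1
  simp; ring

theorem Admissible.value_eq_of_link (A : D.Admissible) (x : D.Bridge → ℝ) {p q : D.Point}
    (h : Link .plain p q) : A.value x p = A.value x q := by
  have h1 : (segment p : D.Segment) = segment q := Quot.sound h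
  unfold Admissible.value Admissible.at'
  rw [h1]

/-- An even coefficient of `eps` is an integer, so the parity of the coefficient is all that
survives modulo one. -/
theorem Admissible.coe_value (A : D.Admissible) (x : D.Bridge → ℝ) (p : D.Point) :
    (A.value x p : UnitAddCircle) = proj x (bridge p) + leftIndex p • half := by
  obtain ⟨m, hm⟩ := A.exists_coeff
  obtain ⟨h1, h2⟩ := hm p
  unfold Admissible.value
  rw [h1, map_add, map_zsmul, evalAt_eps, evalAt_var, AddCircle.coe_add, proj]
  congr 1
  rw [show m p • (1 / 2 : ℝ) = (m p : ℝ) / 2 by simp; ring, coe_int_div_two, ← sub_eq_zero,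
    sub_eq_add_neg, ← sub_zsmul, zsmul_half_of_even h2]

theorem Admissible.value_leftSide (A : D.Admissible) (x : D.Bridge → ℝ) (c : D.Crossing) :
    A.value x (c.point c.leftSide) = A.value x (c.point c.rightSide) + 1 / 2 := by
  have := congrArg (evalAt x) (A.at_over c)
  rwa [map_add, evalAt_eps] at this

/-! ### Solutions as dihedral colourings -/

/-- The dihedral (Fox) colourings of the bridges by elements of `ℝ / ℤ`. -/
def IsColouring (ξ : D.Bridge → UnitAddCircle) : Prop :=
  ∀ c : D.Crossing, ξ (bridge (c.point c.underIn)) + ξ (bridge (c.point c.underOut)) =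
    ξ (bridge (c.point c.overIn)) + ξ (bridge (c.point c.overIn))

theorem Crossing.leftIndex_over_smul (c : D.Crossing) :
    leftIndex (c.point c.leftSide) • half = leftIndex (c.point c.rightSide) • half + half := by
  rw [c.leftIndex_point.1, add_zsmul, one_zsmul]

theorem Crossing.leftIndex_under_smul (c : D.Crossing) :
    leftIndex (c.point c.underOut) • half = leftIndex (c.point c.underIn) • half + half := by
  rcases c.leftIndex_point.2 with h | h <;> rw [h]
  · rw [add_zsmul, one_zsmul]
  · rw [sub_zsmul, one_zsmul, neg_half]

/-- The sum of the values at a crossing which is an integer for solutions. -/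
noncomputable def Admissible.defect (A : D.Admissible) (x : D.Bridge → ℝ) (c : D.Crossing) : ℝ :=
  A.value x (c.point c.underIn) + A.value x (c.point c.underOut)
    - A.value x (c.point c.leftSide) - A.value x (c.point c.rightSide)

theorem Admissible.evalAt_aux (A : D.Admissible) (x : D.Bridge → ℝ) (c : D.Crossing) :
    evalAt x (A.aux c) = A.defect x c * (-1) ^ c.count := by
  simp [Admissible.aux, Admissible.defect, Admissible.value]

/-- The two under-passing indices together contribute one half, and so do the two over-passing ones;
these cancel. -/
theorem Admissible.coe_defect (A : D.Admissible) (x : D.Bridge → ℝ) (c : D.Crossing) :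
    (A.defect x c : UnitAddCircle) =
      proj x (bridge (c.point c.underIn)) + proj x (bridge (c.point c.underOut)) -
      (proj x (bridge (c.point c.overIn)) + proj x (bridge (c.point c.overIn))) := by
  unfold Admissible.defect
  rw [AddCircle.coe_sub, AddCircle.coe_sub, AddCircle.coe_add, A.coe_value, A.coe_value,
    A.coe_value, A.coe_value, c.leftIndex_over_smul, c.leftIndex_under_smul, c.bridge_leftSide,
    ← c.bridge_overIn]
  have h1 := half_add_half
  have h2 := zsmul_half_of_even (n := leftIndex (c.point c.underIn) +
    leftIndex (c.point c.underIn)) ⟨_, rfl⟩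
  have h3 := zsmul_half_of_even (n := leftIndex (c.point c.rightSide) +
    leftIndex (c.point c.rightSide)) ⟨_, rfl⟩
  rw [add_zsmul] at h2 h3
  generalize leftIndex (c.point c.underIn) • half = a at *
  generalize leftIndex (c.point c.rightSide) • half = b at *
  linear_combination (norm := module) h2 - h3

/-- The sign of an auxiliary element does not affect its integrality. The criterion no longer
mentions the assignment, which makes the set of solutions independent of it. -/
theorem Admissible.mem_realSolutions_iff (A : D.Admissible) {x : D.Bridge → ℝ} :
    x ∈ A.realSolutions ↔ IsColouring (proj x) := by
  refine forall_congr' fun c => ?_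
  rw [A.evalAt_aux, ← sub_eq_zero, ← A.coe_defect, AddCircle.coe_eq_zero_iff]
  constructor
  · rintro ⟨n, hn⟩
    rcases neg_one_pow_eq_or ℝ c.count with h | h <;> rw [h] at hn
    · exact ⟨n, by simp; linarith⟩
    · exact ⟨-n, by simp; linarith⟩
  · rintro ⟨n, hn⟩
    simp only [zsmul_eq_mul, mul_one] at hn
    rw [← hn]
    rcases neg_one_pow_eq_or ℝ c.count with h | h <;> rw [h]
    · exact ⟨n, by simp⟩
    · exact ⟨-n, by simp⟩

theorem proj_surjective : Function.Surjective (proj : (D.Bridge → ℝ) → _) := fun ξ =>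
  ⟨fun b => lift (ξ b), funext fun b => coe_lift (ξ b)⟩

theorem Admissible.image_realSolutions (A : D.Admissible) :
    proj '' A.realSolutions = {ξ | IsColouring ξ} := by
  ext ξ
  constructor
  · rintro ⟨x, hx, rfl⟩
    exact A.mem_realSolutions_iff.1 hx
  · intro h
    obtain ⟨x, rfl⟩ := proj_surjective ξ
    exact ⟨x, A.mem_realSolutions_iff.2 h, rfl⟩

theorem solutions_eq (D : LongDiagram) : D.solutions = {ξ | IsColouring ξ} := by
  ext ξ
  constructor
  · rintro ⟨A, h⟩
    rwa [A.image_realSolutions] at h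
  · intro h
    exact ⟨D.indexAdmissible, by rwa [Admissible.image_realSolutions]⟩

theorem mem_solutions_iff {ξ : D.Bridge → UnitAddCircle} : ξ ∈ D.solutions ↔ IsColouring ξ := by
  rw [D.solutions_eq]; rfl

/-! ### Strand values and region values of a colouring -/

/-- A dihedral colouring in terms of the corners of the crossings. -/
theorem isColouring_iff_corner {ξ : D.Bridge → UnitAddCircle} : IsColouring ξ ↔
    ∀ c : D.Crossing, if c.upOver then
      ξ (bridge (c.point .nw)) + ξ (bridge (c.point .se)) =
        ξ (bridge (c.point .sw)) + ξ (bridge (c.point .sw))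
      else ξ (bridge (c.point .sw)) + ξ (bridge (c.point .ne)) =
        ξ (bridge (c.point .nw)) + ξ (bridge (c.point .nw)) := by
  refine forall_congr' fun c => ?_
  have h1 := c.link_sw_ne
  have h2 := c.link_nw_se
  rw [c.underIn_eq, c.underOut_eq, c.overIn_eq]
  cases h : c.upOver <;> simp only [h, if_true, if_false, Bool.false_eq_true] at h1 h2 ⊢
  · have := bridge_eq_of_link_over h2
    split_ifs <;> simp only [add_comm, this]
  · have := bridge_eq_of_link_over h1
    split_ifs <;> simp only [add_comm, this]

/-- Since `half` has order two, the directions of the strands are irrelevant here. -/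
theorem Crossing.leftIndex_corner_smul (c : D.Crossing) :
    leftIndex (c.point .ne) • half = leftIndex (c.point .sw) • half + half ∧
    leftIndex (c.point .se) • half = leftIndex (c.point .nw) • half + half := by
  have h1 := c.leftIndex_over_smul
  have h2 := c.leftIndex_under_smul
  have h3 := half_add_half
  have key : ∀ x y : UnitAddCircle, x = y + half → y = x + half := by
    intro x y h; rw [h, add_assoc, h3, add_zero]
  rw [c.leftSide_eq, c.rightSide_eq] at h1
  rw [c.underIn_eq, c.underOut_eq] at h2
  split_ifs at h1 h2 <;> constructor <;> first | exact h1 | exact h2 | exact key _ _ h1 |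
    exact key _ _ h2

/-- The value of the strand through a sample point. -/
noncomputable def strandAt (ξ : D.Bridge → UnitAddCircle) (p : D.Point) : UnitAddCircle :=
  ξ (bridge p) + leftIndex p • half + half

/-- The values of the strands of a column. -/
noncomputable def strand (ξ : D.Bridge → UnitAddCircle) : ℕ → ℕ → UnitAddCircle :=
  extend 0 (strandAt ξ)

theorem strandAt_eq_of_link (ξ : D.Bridge → UnitAddCircle) {p q : D.Point}
    (h : Link .plain p q) : strandAt ξ p = strandAt ξ q := by
  rw [strandAt, strandAt, bridge_eq_of_link h, leftIndex_eq_of_link h]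

end LongDiagram

/-! ### Passing between columns of strands and columns of regions -/

/-- The effect of an event on the values of the strands. -/
def Event.StrandStep (e : Event) (χ χ' : ℕ → UnitAddCircle) : Prop :=
  LongDiagram.PlainStep e χ χ' ∧
    match e with
    | .cross i true => χ' i = χ i + χ i - χ (i + 1) + half ∧ χ' (i + 1) = χ i + half
    | .cross i false =>
      χ' i = χ (i + 1) + half ∧ χ' (i + 1) = χ (i + 1) + χ (i + 1) - χ i + half
    | _ => True

/-- The values of the regions of a column, in terms of the strands. -/
def regionOf (χ : ℕ → UnitAddCircle) : ℕ → UnitAddCircle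
  | 0 => 0
  | j + 1 => χ j - regionOf χ j

/-- Regions are alternating sums of the strands below them. Across an event the alternating sum over
its window is preserved, which is the colouring relation at a crossing and equality of the two
strands at a turning point. -/
theorem Event.StrandStep.regionStep {e : Event} {χ χ' : ℕ → UnitAddCircle}
    (h : e.StrandStep χ χ') : e.RegionStep (regionOf χ) (regionOf χ') := by
  have h1 : ∀ j ≤ e.idx, regionOf χ' j = regionOf χ j := by
    intro j hj
    induction j with
    | zero => rfl
    | succ j ih => rw [regionOf, regionOf, ih (by omega), h.1.1.1 j (by omega)]
  have h2 : regionOf χ' (e.idx + e.outWidth) = regionOf χ (e.idx + e.inWidth) := by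
    have h0 := h1 _ le_rfl
    cases e with
    | birth i b =>
      have := h.1.2
      simp only at this
      change regionOf χ' (i + 1 + 1) = regionOf χ i
      rw [regionOf, regionOf, this, ← show regionOf χ' i = regionOf χ i from h0]
      abel
    | death i =>
      have := h.1.2
      simp only at this
      change regionOf χ' i = regionOf χ (i + 1 + 1)
      rw [regionOf, regionOf, this, show regionOf χ' i = regionOf χ i from h0]
      abel
    | cross i o =>
      have h0 : regionOf χ' i = regionOf χ i := h0
      have h3 := h.2
      have h4 := half_add_half
      change regionOf χ' (i + 1 + 1) = regionOf χ (i + 1 + 1)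
      rw [regionOf, regionOf, regionOf, regionOf, h0]
      cases o <;> simp only at h3 <;> rw [h3.1, h3.2] <;> abel
  refine ⟨h1, fun j hj => ?_, ?_⟩
  · induction j, hj using Nat.le_induction with
    | base => exact h2
    | succ j hj ih =>
      rw [show j + 1 + e.outWidth = (j + e.outWidth) + 1 by omega,
        show j + 1 + e.inWidth = (j + e.inWidth) + 1 by omega, regionOf, regionOf, ih,
        h.1.1.2 j hj]
  · cases e with
    | cross i o =>
      have h0 : regionOf χ' i = regionOf χ i := h1 i le_rfl
      have h3 := h.2
      simp only [Event.RegionRel, Event.idx]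
      change regionOf χ' (i + 1) = _
      rw [show i + 2 = i + 1 + 1 from rfl]
      simp only [regionOf, h0]
      cases o <;> simp only at h3 <;> rw [h3.1] <;> simp <;> abel
    | _ => trivial

/-- Converse direction, used to turn region columns built inside a move into a colouring. -/
theorem Event.RegionStep.strandStep {e : Event} {W W' : ℕ → UnitAddCircle}
    (h : e.RegionStep W W') :
    e.StrandStep (fun j => W j + W (j + 1)) (fun j => W' j + W' (j + 1)) := by
  refine ⟨⟨⟨fun j hj => ?_, fun j hj => ?_⟩, ?_⟩, ?_⟩
  · simp only
    rw [h.1 j (by omega), h.1 (j + 1) (by omega)]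
  · simp only
    rw [h.2.1 j hj, show j + e.outWidth + 1 = (j + 1) + e.outWidth by omega,
      show j + e.inWidth + 1 = (j + 1) + e.inWidth by omega, h.2.1 (j + 1) (by omega)]
  · cases e with
    | birth i b =>
      have e1 : W' (i + 2) = W' i := (h.2.1 i le_rfl).trans (h.1 i le_rfl).symm
      simp only [show i + 1 + 1 = i + 2 from rfl, e1, add_comm]
    | death i =>
      have e1 : W (i + 2) = W i := (h.2.1 i le_rfl).symm.trans (h.1 i le_rfl)
      simp only [show i + 1 + 1 = i + 2 from rfl, e1, add_comm]
    | cross i o => trivial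
  · cases e with
    | cross i o =>
      have e0 : W' i = W i := h.1 i le_rfl
      have e2 : W' (i + 2) = W (i + 2) := h.2.1 i le_rfl
      have e1 : W' (i + 1) = if o then W (i + 1) + W i - W (i + 2) + half
        else W (i + 1) + W (i + 2) - W i + half := h.2.2
      cases o <;> simp only [show i + 1 + 1 = i + 2 from rfl, e0, e1, e2] <;>
        constructor <;> simp <;> abel
    | _ => trivial

namespace LongDiagram

variable {D : LongDiagram}

/-- The over-passing strand keeps its bridge and its index changes parity, hence the summand `half`;
the under-passing strand is governed by the colouring relation, with the same shift. -/
theorem IsColouring.strandStep {ξ : D.Bridge → UnitAddCircle} (h : IsColouring ξ) {t : ℕ}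
    {e : Event} (he : D.word[t]? = some e) : e.StrandStep (strand ξ t) (strand ξ (t + 1)) := by
  refine ⟨plainStep_extend _ (fun p q => strandAt_eq_of_link ξ) he, ?_⟩
  cases e with
  | cross i o =>
    let c : D.Crossing := ⟨t, i, o, he⟩
    have hsw : strand ξ t i = _ := extend_apply 0 (strandAt ξ) (c.point .sw)
    have hnw : strand ξ t (i + 1) = _ := extend_apply 0 (strandAt ξ) (c.point .nw)
    have hse : strand ξ (t + 1) i = _ := extend_apply 0 (strandAt ξ) (c.point .se)
    have hne : strand ξ (t + 1) (i + 1) = _ := extend_apply 0 (strandAt ξ) (c.point .ne)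
    have hc := isColouring_iff_corner.1 h c
    have h1 := c.link_sw_ne
    have h2 := c.link_nw_se
    obtain ⟨l1, l2⟩ := c.leftIndex_corner_smul
    have hh := half_add_half
    have l3 := zsmul_half_of_even (n := leftIndex (c.point .sw) + leftIndex (c.point .sw)) ⟨_, rfl⟩
    have l4 := zsmul_half_of_even (n := leftIndex (c.point .nw) + leftIndex (c.point .nw)) ⟨_, rfl⟩
    rw [add_zsmul] at l3 l4
    simp only [strandAt] at hsw hnw hse hne
    rw [l1] at hne
    rw [l2] at hse
    generalize leftIndex (c.point .sw) • half = a at *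
    generalize leftIndex (c.point .nw) • half = b at *
    cases o
    · simp only [show c.upOver = false from rfl, Bool.false_eq_true, if_false] at hc h1 h2
      dsimp only
      rw [hsw, hnw, hse, hne, ← bridge_eq_of_link_over h2]
      constructor
      · abel
      · linear_combination (norm := module) hc + l3 - l4
    · simp only [show c.upOver = true from rfl, if_true] at hc h1 h2
      dsimp only
      rw [hsw, hnw, hse, hne, ← bridge_eq_of_link_over h1]
      constructor
      · linear_combination (norm := module) hc + l4 - l3
      · abel
  | _ => trivial

/-- The values of the regions of a column. -/
noncomputable def region (ξ : D.Bridge → UnitAddCircle) (t : ℕ) : ℕ → UnitAddCircle :=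
  regionOf (strand ξ t)

theorem IsColouring.regionRun {ξ : D.Bridge → UnitAddCircle} (h : IsColouring ξ) :
    RegionRun D.word (region ξ) := fun _ _ he => (h.strandStep he).regionStep

theorem exists_colouring {χ : ℕ → ℕ → UnitAddCircle}
    (hχ : ∀ (t : ℕ) (e : Event), D.word[t]? = some e → e.StrandStep (χ t) (χ (t + 1))) :
    ∃ ξ : D.Bridge → UnitAddCircle, IsColouring ξ ∧
      ∀ p : D.Point, strandAt ξ p = χ p.col p.pos := by
  have hc : ∀ c : D.Crossing, if c.upOver then
      χ (c.time + 1) c.idx =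
        χ c.time c.idx + χ c.time c.idx - χ c.time (c.idx + 1) + half ∧
      χ (c.time + 1) (c.idx + 1) = χ c.time c.idx + half
      else χ (c.time + 1) c.idx = χ c.time (c.idx + 1) + half ∧
        χ (c.time + 1) (c.idx + 1) =
          χ c.time (c.idx + 1) + χ c.time (c.idx + 1) - χ c.time c.idx + half := by
    rintro ⟨t, i, o, he⟩
    have := (hχ t _ he).2
    cases o <;> simpa using this
  have hh := half_add_half
  -- Inverse of the formula for `strandAt`: the two corrections have order at most two, so adding
  -- them again removes them.
  let g : D.Point → UnitAddCircle := fun p => χ p.col p.pos + leftIndex p • half + half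
  have hl : ∀ p : D.Point, leftIndex p • half + leftIndex p • half = 0 := fun p => by
    rw [← add_zsmul]; exact zsmul_half_of_even ⟨_, rfl⟩
  have hg : ∀ p q : D.Point, Link .plain p q ∨ Link .over p q → g p = g q := by
    rintro p q (h | h)
    · simp only [g]
      rw [eq_of_link_plain (fun t e he => (hχ t e he).1) h, leftIndex_eq_of_link h]
    · obtain ⟨c, ⟨rfl, rfl, hk⟩ | ⟨rfl, rfl, hk⟩⟩ := exists_crossing_of_link (by simp) h
      · have hc := hc c
        cases ho : c.upOver <;> simp only [ho, Bool.false_eq_true, if_true, if_false,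
          reduceCtorEq] at hk hc
        have h2 : χ (c.point .ne).col (c.point .ne).pos = _ := hc.2
        simp only [g, h2, c.leftIndex_corner_smul.1]
        linear_combination (norm := (simp only [Crossing.point]; module)) -hh
      · have hc := hc c
        cases ho : c.upOver <;> simp only [ho, Bool.false_eq_true, if_true, if_false,
          reduceCtorEq] at hk hc
        have h2 : χ (c.point .se).col (c.point .se).pos = _ := hc.1
        simp only [g, h2, c.leftIndex_corner_smul.2]
        linear_combination (norm := (simp only [Crossing.point]; module)) -hh
  refine ⟨Quot.lift g hg, isColouring_iff_corner.2 fun c => ?_, fun p => ?_⟩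
  · have hc := hc c
    have l1 := hl (c.point .sw)
    have l2 := hl (c.point .nw)
    cases ho : c.upOver <;> simp only [ho, Bool.false_eq_true, if_true, if_false] at hc ⊢
    · have h2 : χ (c.point .ne).col (c.point .ne).pos = _ := hc.2
      change g _ + g _ = g _ + g _
      simp only [g, h2, c.leftIndex_corner_smul.1]
      linear_combination (norm := (simp only [Crossing.point]; module)) hh + l1 - l2
    · have h2 : χ (c.point .se).col (c.point .se).pos = _ := hc.1
      change g _ + g _ = g _ + g _
      simp only [g, h2, c.leftIndex_corner_smul.2]
      linear_combination (norm := (simp only [Crossing.point]; module)) hh + l2 - l1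
  · change g p + _ + _ = _
    simp only [g]
    linear_combination (norm := module) hh + hl p

end LongDiagram

/-! ### Sums over the columns of a diagram -/

/-- A sign as an integer. -/
def sgn (b : Bool) : ℤ := if b then 1 else -1

theorem sgn_not (b : Bool) : sgn (!b) = -sgn b := by cases b <;> rfl

theorem OffWindow.sum_sub_sum {M : Type*} [AddCommGroup M] {e : Event} {f g : ℕ → M}
    (h : OffWindow e f g) {n n' : ℕ} (hn : e.idx + e.inWidth ≤ n)
    (hn' : n' + e.inWidth = n + e.outWidth) :
    ∑ j ∈ Finset.range n, f j - ∑ j ∈ Finset.range n', g j =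
      ∑ j ∈ Finset.range e.inWidth, f (e.idx + j) -
        ∑ j ∈ Finset.range e.outWidth, g (e.idx + j) := by
  obtain ⟨k, rfl⟩ := Nat.exists_eq_add_of_le hn
  obtain rfl : n' = e.idx + e.outWidth + k := by omega
  have h1 : ∑ j ∈ Finset.range e.idx, g j = ∑ j ∈ Finset.range e.idx, f j :=
    Finset.sum_congr rfl fun j hj => h.1 j (Finset.mem_range.1 hj)
  have h2 : ∑ j ∈ Finset.range k, g (e.idx + e.outWidth + j) =
      ∑ j ∈ Finset.range k, f (e.idx + e.inWidth + j) := by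
    refine Finset.sum_congr rfl fun j _ => ?_
    have := h.2 (e.idx + j) (by omega)
    rwa [show e.idx + e.outWidth + j = e.idx + j + e.outWidth by omega,
      show e.idx + e.inWidth + j = e.idx + j + e.inWidth by omega]
  rw [Finset.sum_range_add _ (e.idx + e.inWidth) k, Finset.sum_range_add _ e.idx,
    Finset.sum_range_add _ (e.idx + e.outWidth) k, Finset.sum_range_add _ e.idx, h1, h2]
  abel

namespace LongDiagram

variable {D : LongDiagram}

theorem sum_crossing {M : Type*} [AddCommMonoid M] (F : D.Crossing → M)
    (G : Fin D.word.length → M) (h : ∀ c : D.Crossing, F c = G ⟨c.time, c.time_lt⟩)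
    (h0 : ∀ k : Fin D.word.length, (∀ i o, D.word[k] ≠ .cross i o) → G k = 0) :
    ∑ c, F c = ∑ k, G k := by
  refine Fintype.sum_of_injective _ Crossing.time_injective F G (fun k hk => h0 k ?_) h
  intro i o hio
  refine hk ⟨⟨k, i, o, ?_⟩, rfl⟩
  rw [← hio]
  exact List.getElem?_eq_getElem k.2

/-- What flows into a crossing, for a function on the sample points. -/
def Crossing.flux {M : Type*} [AddCommGroup M] (Φ : D.Point → M) (c : D.Crossing) : M :=
  sgn (dir D.word c.time c.idx) • (Φ (c.point .sw) - Φ (c.point .ne)) +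
    sgn (dir D.word c.time (c.idx + 1)) • (Φ (c.point .nw) - Φ (c.point .se))

/-- Every interior segment leaves one crossing and enters another, so its contributions cancel. In
the sweep this becomes the telescoping of the signed column sums `G`, in which the two strands of a
turning point have opposite signs. -/
theorem sum_flux {M : Type*} [AddCommGroup M] {Φ : D.Point → M}
    (hΦ : ∀ p q, Link .plain p q → Φ p = Φ q) :
    ∑ c : D.Crossing, c.flux Φ = Φ D.rightEnd - Φ D.leftEnd := by
  let h : ℕ → ℕ → M := fun t j => sgn (dir D.word t j) • extend 0 Φ t j
  let G : ℕ → M := fun t => ∑ j ∈ Finset.range (width D.word t), h t j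
  have hstep : ∀ t e, D.word[t]? = some e → G t - G (t + 1) =
      ∑ j ∈ Finset.range e.inWidth, h t (e.idx + j) -
        ∑ j ∈ Finset.range e.outWidth, h (t + 1) (e.idx + j) := by
    intro t e he
    refine OffWindow.sum_sub_sum ⟨fun j hj => ?_, fun j hj => ?_⟩ (D.idx_add_inWidth_le he)
      (D.width_succ he)
    · simp only [h]
      rw [(plainStep_extend 0 hΦ he).1.1 j hj, (D.dirStep he).1.1 j hj]
    · simp only [h]
      rw [(plainStep_extend 0 hΦ he).1.2 j hj, (D.dirStep he).1.2 j hj]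
  have hsum : ∑ c : D.Crossing, c.flux Φ = ∑ k : Fin D.word.length, (G k - G (k + 1)) := by
    refine sum_crossing _ _ (fun c => ?_) (fun k hk => ?_)
    · rw [hstep c.time _ c.isCross]
      have hsw : extend 0 Φ c.time c.idx = _ := extend_apply 0 Φ (c.point .sw)
      have hnw : extend 0 Φ c.time (c.idx + 1) = _ := extend_apply 0 Φ (c.point .nw)
      have hse : extend 0 Φ (c.time + 1) c.idx = _ := extend_apply 0 Φ (c.point .se)
      have hne : extend 0 Φ (c.time + 1) (c.idx + 1) = _ := extend_apply 0 Φ (c.point .ne)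
      simp only [Event.inWidth, Event.outWidth, Event.idx, Finset.sum_range_succ,
        Finset.sum_range_zero, zero_add, add_zero, h, hsw, hnw, hse, hne, c.dir_right,
        Crossing.flux, smul_sub]
      abel
    · have he : D.word[(k : ℕ)]? = some D.word[k] := List.getElem?_eq_getElem k.2
      rw [hstep k _ he]
      have h1 := plainStep_extend 0 hΦ he
      have h2 := D.dirStep he
      generalize D.word[k] = e at *
      cases e with
      | birth i b =>
        have h3 := h1.2
        have h4 := h2.2
        simp only at h3 h4
        simp [Event.inWidth, Event.outWidth, Event.idx, Finset.sum_range_succ, h, h3, h4, sgn_not]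
      | death i =>
        have h3 := h1.2
        have h4 := h2.2
        simp only at h3 h4
        simp [Event.inWidth, Event.outWidth, Event.idx, Finset.sum_range_succ, h, h3, h4, sgn_not]
      | cross i o => exact absurd rfl (hk i o)
  -- Both infinite strands are directed to the left and so carry the sign minus one.
  have h0 : G 0 = -Φ D.leftEnd := by
    have : extend 0 Φ 0 0 = _ := extend_apply 0 Φ D.leftEnd
    simp [G, width_zero, h, dir_zero, sgn, this]
  have h1 : G D.word.length = -Φ D.rightEnd := by
    have : extend 0 Φ D.word.length 0 = _ := extend_apply 0 Φ D.rightEnd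
    simp [G, width_length, h, dir_length, sgn, this]
  rw [hsum, Fin.sum_univ_eq_sum_range (fun k => G k - G (k + 1)), Finset.sum_range_sub', h0, h1]
  abel

/-! ### The action functional modulo one -/

/-- The exponent of the invariant of a colouring. -/
noncomputable def exponent (ξ : D.Bridge → UnitAddCircle) : UnitAddCircle :=
  runWeight D.word (dir D.word) (region ξ)

/-- Solution of the recursion for the regions; it has the shape of the sum over the intersections of
a half-line in the action functional. -/
theorem regionOf_eq_sum (χ : ℕ → UnitAddCircle) (m : ℕ) :
    regionOf χ m = ((-1) ^ m : ℤ) • ∑ k ∈ Finset.range m, ((-1) ^ (k + 1) : ℤ) • χ k := by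
  induction m with
  | zero => simp [regionOf]
  | succ m ih =>
    rw [regionOf, ih, Finset.sum_range_succ, smul_add, smul_smul, ← mul_pow, pow_succ]
    simp
    abel

/-- The contribution of a crossing and of its auxiliary half-line. -/
noncomputable def Admissible.total (A : D.Admissible) (x : D.Bridge → ℝ) (c : D.Crossing) : ℝ :=
  evalAt x (A.crossingTerm c) + A.defect x c *
    ((-1) ^ c.count * ∑ k : Fin c.count, (-1) ^ ((k : ℕ) + 1) * (A.value x (c.hit k) - 1 / 2))

theorem Admissible.evalAt_action (A : D.Admissible) (x : D.Bridge → ℝ) :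
    evalAt x A.action = ∑ c, A.total x c := by
  simp only [Admissible.action, map_add, map_sum, Fintype.sum_sigma, Admissible.total,
    Finset.sum_add_distrib, Finset.mul_sum]
  congr 1
  refine Finset.sum_congr rfl fun c _ => Finset.sum_congr rfl fun k _ => ?_
  simp only [Admissible.intersectionTerm, map_mul, A.evalAt_aux, map_pow, map_neg, map_one,
    map_sub, evalAt_eps, Admissible.value]
  ring

/-- The value of the strand at a sample point, minus one half. -/
theorem Admissible.coe_value_sub (A : D.Admissible) (x : D.Bridge → ℝ) (p : D.Point) :
    ((A.value x p - 1 / 2 : ℝ) : UnitAddCircle) = strandAt (proj x) p := by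
  rw [AddCircle.coe_sub, A.coe_value, strandAt, sub_eq_add_neg]
  congr 1
  exact neg_half

/-- By `regionOf_eq_sum`, the alternating sum of the strands met by the half-line is the value of a
region; the sign of the auxiliary element makes it come with the right sign. -/
theorem Admissible.coe_halfline (A : D.Admissible) (x : D.Bridge → ℝ) (c : D.Crossing) :
    (((-1) ^ c.count * ∑ k : Fin c.count, (-1) ^ ((k : ℕ) + 1) * (A.value x (c.hit k) - 1 / 2) :
      ℝ) : UnitAddCircle) = sideValue true (region (proj x)) (c.point c.underIn) := by
  -- The rule for counting the bridge vertex makes `count` the number of the region on its left: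
  -- that region lies above the vertex exactly when the diagram is directed to the right there.
  have hside : sideValue true (region (proj x)) (c.point c.underIn) =
      regionOf (strand (proj x) c.vertex.col) c.count := by
    rw [Crossing.count, toRight_eq]; rfl
  rw [hside, regionOf_eq_sum, ← Fin.sum_univ_eq_sum_range
    (fun k => ((-1) ^ (k + 1) : ℤ) • strand (proj x) c.vertex.col k)]
  have h1 : ∀ (n : ℤ) (y : ℝ), ((n * y : ℝ) : UnitAddCircle) = n • (y : UnitAddCircle) := by
    intro n y; rw [← AddCircle.coe_zsmul, zsmul_eq_mul]
  have h2 := h1 ((-1) ^ c.count)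
    (∑ k : Fin c.count, (-1) ^ ((k : ℕ) + 1) * (A.value x (c.hit k) - 1 / 2))
  push_cast at h2
  rw [h2]
  congr 1
  have h3 := map_sum (QuotientAddGroup.mk' (AddSubgroup.zmultiples (1 : ℝ)))
    (fun k : Fin c.count => (-1) ^ ((k : ℕ) + 1) * (A.value x (c.hit k) - 1 / 2)) Finset.univ
  refine h3.trans (Finset.sum_congr rfl fun k _ => ?_)
  have h4 := h1 ((-1) ^ ((k : ℕ) + 1)) (A.value x (c.hit k) - 1 / 2)
  push_cast at h4
  refine h4.trans ?_
  rw [A.coe_value_sub, ← extend_apply 0 (strandAt (proj x)) (c.hit k)]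
  rfl

/-- Local evaluation, for an over-passing strand which crosses from left to right. -/
theorem cornerWeight_true {α β γ δ SW SE NW NE : ℝ} {k₁ k₂ k₃ k₄ : ℤ}
    (hα : α - 1 / 2 - SW - SE = k₁) (hγ : γ - 1 / 2 - NW - NE = k₂)
    (hβ : β - 1 / 2 - SW - NW = k₃) (hδ : δ - 1 / 2 - SE - NE = k₄) (h : β = δ + 1 / 2) :
    (β - γ) * δ + (α + γ - β - δ) * SW - cornerWeight true SW SE NW NE -
      (k₁ * SW + k₃ * NW - k₂ * NW - k₄ * NE) ∈ Set.range ((↑) : ℤ → ℝ) := by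
  -- The product of the integral parts of the two factors, where `δ` is rewritten as `β - 1 / 2`, so
  -- that its integral part is `k₃`.
  refine ⟨(k₃ - k₂) * k₃, ?_⟩
  obtain rfl : α = 1 / 2 + SW + SE + k₁ := by linarith
  obtain rfl : γ = 1 / 2 + NW + NE + k₂ := by linarith
  obtain rfl : β = 1 / 2 + SW + NW + k₃ := by linarith
  obtain rfl : δ = 1 / 2 + SE + NE + k₄ := by linarith
  -- The relation between the two over-passing segments eliminates one region.
  obtain rfl : SE = SW + NW + k₃ - NE - k₄ - 1 / 2 := by linarith
  simp only [cornerWeight, if_true]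
  push_cast
  ring

/-- Local evaluation, for an over-passing strand which crosses from right to left. -/
theorem cornerWeight_false {α β γ δ SW SE NW NE : ℝ} {k₁ k₂ k₃ k₄ : ℤ}
    (hα : α - 1 / 2 - SW - SE = k₁) (hγ : γ - 1 / 2 - NW - NE = k₂)
    (hβ : β - 1 / 2 - SW - NW = k₃) (hδ : δ - 1 / 2 - SE - NE = k₄) (h : β = δ + 1 / 2) :
    (δ - γ) * δ + (α + γ - β - δ) * SW - cornerWeight false SW SE NW NE -
      (k₁ * SW + k₄ * SE - k₂ * NW - k₃ * SW) ∈ Set.range ((↑) : ℤ → ℝ) := by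
  refine ⟨(k₄ - k₂) * k₃, ?_⟩
  obtain rfl : α = 1 / 2 + SW + SE + k₁ := by linarith
  obtain rfl : γ = 1 / 2 + NW + NE + k₂ := by linarith
  obtain rfl : β = 1 / 2 + SW + NW + k₃ := by linarith
  obtain rfl : δ = 1 / 2 + SE + NE + k₄ := by linarith
  obtain rfl : SE = SW + NW + k₃ - NE - k₄ - 1 / 2 := by linarith
  simp only [cornerWeight, Bool.false_eq_true, if_false]
  push_cast
  ring

/-- The difference between the value of a strand and the sum of the chosen values of the regions
next to it. -/
noncomputable def Admissible.excess (A : D.Admissible) (x : D.Bridge → ℝ) (p : D.Point) : ℝ :=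
  A.value x p - 1 / 2 - lift (sideValue true (region (proj x)) p)
    - lift (sideValue false (region (proj x)) p)

theorem region_add_region (ξ : D.Bridge → UnitAddCircle) (t j : ℕ) :
    region ξ t j + region ξ t (j + 1) = strand ξ t j := by
  simp [region, regionOf]

/-- Modulo one, the value of a strand is the sum of the two adjacent regions, and the left and right
regions are these two in some order. -/
theorem Admissible.exists_excess (A : D.Admissible) (x : D.Bridge → ℝ) (p : D.Point) :
    ∃ n : ℤ, A.excess x p = n := by
  have h : ((A.excess x p : ℝ) : UnitAddCircle) = ((0 : ℝ) : UnitAddCircle) := by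
    unfold Admissible.excess
    rw [AddCircle.coe_sub, AddCircle.coe_sub, A.coe_value_sub, coe_lift, coe_lift]
    have h1 := region_add_region (proj x) p.col p.pos
    rw [strand, extend_apply] at h1
    rw [← h1]
    unfold sideValue side
    cases dir D.word p.col p.pos <;> simp
  obtain ⟨n, hn⟩ := exists_int_of_coe_eq_coe h
  exact ⟨n, by rw [hn, zero_add]⟩

/-- If every segment were exactly one half plus the sum of its two representatives, the defect would
vanish and the crossing term would be `cornerWeight`. The integral excesses produce the flux term,
up to an integer. -/
theorem Admissible.coe_total (A : D.Admissible) {x : D.Bridge → ℝ} (hx : x ∈ A.realSolutions)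
    (c : D.Crossing) : (A.total x c : UnitAddCircle) =
      (D.word[c.time]'c.time_lt).weight (dir D.word c.time) (region (proj x) c.time)
        (region (proj x) (c.time + 1)) +
      ((c.flux (fun p => A.excess x p * lift (sideValue true (region (proj x)) p)) : ℝ) :
        UnitAddCircle) := by
  have hcol := A.mem_realSolutions_iff.1 hx
  set ξ := proj x with hξ
  obtain ⟨n, hn⟩ : ∃ n : ℤ, A.defect x c = n := by
    have := A.coe_defect x c
    rw [hcol c, sub_self] at this
    obtain ⟨n, hn⟩ := exists_int_of_coe_eq_coe (y := 0) this
    exact ⟨n, by rw [hn, zero_add]⟩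
  have h1 : (A.total x c : UnitAddCircle) = ((evalAt x (A.crossingTerm c) +
      A.defect x c * lift (sideValue true (region ξ) (c.point c.underIn)) : ℝ) :
        UnitAddCircle) := by
    unfold Admissible.total
    rw [AddCircle.coe_add, AddCircle.coe_add]
    congr 1
    -- Because the defect is an integer, its cofactor may be replaced by any real number of the same
    -- class.
    rw [hn, ← zsmul_eq_mul, ← zsmul_eq_mul, AddCircle.coe_zsmul, AddCircle.coe_zsmul,
      A.coe_halfline, coe_lift]
  have h2 : (D.word[c.time]'c.time_lt).weight (dir D.word c.time) (region ξ c.time)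
      (region ξ (c.time + 1)) = (crossWeight c.upOver (dir D.word c.time c.idx)
        (dir D.word c.time (c.idx + 1)) (lift (region ξ c.time (c.idx + 1)))
        (lift (region ξ c.time (c.idx + 2))) (lift (region ξ c.time c.idx))
        (lift (region ξ (c.time + 1) (c.idx + 1))) : ℝ) := by
    rw [c.word_time]; rfl
  have hoff := (hcol.regionRun _ _ c.isCross).regionOff
  have hb : region ξ (c.time + 1) c.idx = region ξ c.time c.idx := hoff.1 _ le_rfl
  have ht : region ξ (c.time + 1) (c.idx + 2) = region ξ c.time (c.idx + 2) :=
    hoff.2 c.idx le_rfl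
  rw [h1, h2, ← AddCircle.coe_add]
  apply coe_eq_coe_of_sub_mem
  have hov := A.value_leftSide x c
  obtain ⟨k₁, e₁⟩ := A.exists_excess x (c.point .sw)
  obtain ⟨k₂, e₂⟩ := A.exists_excess x (c.point .nw)
  obtain ⟨k₃, e₃⟩ := A.exists_excess x (c.point .se)
  obtain ⟨k₄, e₄⟩ := A.exists_excess x (c.point .ne)
  simp only [Crossing.flux, e₁, e₂, e₃, e₄, Admissible.defect]
  simp only [Admissible.excess, ← hξ, Crossing.sideValue_sw, Crossing.sideValue_nw,
    Crossing.sideValue_se, Crossing.sideValue_ne] at e₁ e₂ e₃ e₄ ⊢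
  have hterm : evalAt x (A.crossingTerm c) = if c.overIn = c.leftSide then
      (A.value x (c.point c.leftSide) - A.value x (c.point c.underOut)) *
        A.value x (c.point c.rightSide) else
      (A.value x (c.point c.rightSide) - A.value x (c.point c.underOut)) *
        A.value x (c.point c.rightSide) := by
    unfold Admissible.crossingTerm Admissible.value
    split_ifs <;> simp
  rw [hterm]
  rw [c.leftSide_eq, c.rightSide_eq] at hov
  rw [c.leftSide_eq, c.rightSide_eq, c.underIn_eq, c.overIn_eq, c.underOut_eq]
  generalize hd₁ : dir D.word c.time c.idx = d₁ at *
  generalize hd₂ : dir D.word c.time (c.idx + 1) = d₂ at *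
  have r2 : c.idx + 1 + 1 = c.idx + 2 := rfl
  cases ho : c.upOver <;> cases d₁ <;> cases d₂ <;>
    simp only [ho, Bool.false_eq_true, if_true, if_false, reduceCtorEq, add_zero, r2, hb, ht,
      Crossing.sideValue_sw, Crossing.sideValue_nw, Crossing.sideValue_se, Crossing.sideValue_ne,
      hd₁, hd₂, sgn, crossWeight, Bool.not_true, Bool.not_false] at e₁ e₂ e₃ e₄ hov ⊢
  all_goals
    generalize lift (region ξ c.time c.idx) = b at *
    generalize lift (region ξ c.time (c.idx + 1)) = l at *
    generalize lift (region ξ c.time (c.idx + 2)) = t at *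
    generalize lift (region ξ (c.time + 1) (c.idx + 1)) = r at *
    generalize A.value x (c.point .sw) = X₁ at *
    generalize A.value x (c.point .nw) = X₂ at *
    generalize A.value x (c.point .se) = X₃ at *
    generalize A.value x (c.point .ne) = X₄ at *
    clear hcol h1 h2 hoff hb ht hterm hn
  -- In each of the eight cases the crossing is turned so that its under-passing strand points
  -- upwards; the arguments are then the incoming, outgoing, left and right segments.
  · obtain ⟨n, hn⟩ := cornerWeight_true (show X₄ - 1 / 2 - r - t = (k₄ : ℤ) by linarith)
      (show X₁ - 1 / 2 - b - l = (k₁ : ℤ) by linarith) (show X₃ - 1 / 2 - r - b = (k₃ : ℤ) by linarith)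
      (show X₂ - 1 / 2 - t - l = (k₂ : ℤ) by linarith) hov
    exact ⟨n, by rw [hn]; simp only [neg_smul, one_smul]; ring⟩
  · obtain ⟨n, hn⟩ := cornerWeight_false (show X₄ - 1 / 2 - r - t = (k₄ : ℤ) by linarith)
      (show X₁ - 1 / 2 - b - l = (k₁ : ℤ) by linarith) (show X₃ - 1 / 2 - r - b = (k₃ : ℤ) by linarith)
      (show X₂ - 1 / 2 - t - l = (k₂ : ℤ) by linarith) hov
    exact ⟨n, by rw [hn]; simp only [neg_smul, one_smul]; ring⟩
  · obtain ⟨n, hn⟩ := cornerWeight_false (show X₁ - 1 / 2 - l - b = (k₁ : ℤ) by linarith)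
      (show X₄ - 1 / 2 - t - r = (k₄ : ℤ) by linarith) (show X₂ - 1 / 2 - l - t = (k₂ : ℤ) by linarith)
      (show X₃ - 1 / 2 - b - r = (k₃ : ℤ) by linarith) hov
    exact ⟨n, by rw [hn]; simp only [neg_smul, one_smul]; ring⟩
  · obtain ⟨n, hn⟩ := cornerWeight_true (show X₁ - 1 / 2 - l - b = (k₁ : ℤ) by linarith)
      (show X₄ - 1 / 2 - t - r = (k₄ : ℤ) by linarith) (show X₂ - 1 / 2 - l - t = (k₂ : ℤ) by linarith)
      (show X₃ - 1 / 2 - b - r = (k₃ : ℤ) by linarith) hov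
    exact ⟨n, by rw [hn]; simp only [one_smul]; ring⟩
  · obtain ⟨n, hn⟩ := cornerWeight_false (show X₃ - 1 / 2 - b - r = (k₃ : ℤ) by linarith)
      (show X₂ - 1 / 2 - l - t = (k₂ : ℤ) by linarith) (show X₁ - 1 / 2 - b - l = (k₁ : ℤ) by linarith)
      (show X₄ - 1 / 2 - r - t = (k₄ : ℤ) by linarith) hov
    exact ⟨n, by rw [hn]; simp only [neg_smul, one_smul]; ring⟩
  · obtain ⟨n, hn⟩ := cornerWeight_true (show X₂ - 1 / 2 - t - l = (k₂ : ℤ) by linarith)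
      (show X₃ - 1 / 2 - r - b = (k₃ : ℤ) by linarith) (show X₄ - 1 / 2 - t - r = (k₄ : ℤ) by linarith)
      (show X₁ - 1 / 2 - l - b = (k₁ : ℤ) by linarith) hov
    exact ⟨n, by rw [hn]; simp only [neg_smul, one_smul]; ring⟩
  · obtain ⟨n, hn⟩ := cornerWeight_true (show X₃ - 1 / 2 - b - r = (k₃ : ℤ) by linarith)
      (show X₂ - 1 / 2 - l - t = (k₂ : ℤ) by linarith) (show X₁ - 1 / 2 - b - l = (k₁ : ℤ) by linarith)
      (show X₄ - 1 / 2 - r - t = (k₄ : ℤ) by linarith) hov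
    exact ⟨n, by rw [hn]; simp only [neg_smul, one_smul]; ring⟩
  · obtain ⟨n, hn⟩ := cornerWeight_false (show X₂ - 1 / 2 - t - l = (k₂ : ℤ) by linarith)
      (show X₃ - 1 / 2 - r - b = (k₃ : ℤ) by linarith) (show X₄ - 1 / 2 - t - r = (k₄ : ℤ) by linarith)
      (show X₁ - 1 / 2 - l - b = (k₁ : ℤ) by linarith) hov
    exact ⟨n, by rw [hn]; simp only [one_smul]; ring⟩

/-- The action functional modulo one. -/
theorem Admissible.coe_action (A : D.Admissible) {x : D.Bridge → ℝ} (hx : x ∈ A.realSolutions) :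
    (evalAt x A.action : UnitAddCircle) = exponent (proj x) := by
  have hcol := A.mem_realSolutions_iff.1 hx
  let Ψ : D.Point → ℝ := fun p => A.excess x p * lift (sideValue true (region (proj x)) p)
  have hΨ : ∀ p q, Link .plain p q → Ψ p = Ψ q := by
    intro p q h
    have h1 := sideValue_eq_of_link true (fun _ _ he => (hcol.regionRun _ _ he).regionOff) h
    have h2 := sideValue_eq_of_link false (fun _ _ he => (hcol.regionRun _ _ he).regionOff) h
    simp only [Ψ, Admissible.excess]
    rw [h1, h2, A.value_eq_of_link x h]
  -- The excess is an integer, so modulo one `Ψ` is an integral multiple of the left region, and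
  -- this is the bottom region at the two ends.
  have hend : ∀ p : D.Point, sideValue true (region (proj x)) p = 0 →
      ((Ψ p : ℝ) : UnitAddCircle) = 0 := by
    intro p hp
    obtain ⟨n, hn⟩ := A.exists_excess x p
    simp only [Ψ]
    rw [hn, ← zsmul_eq_mul, AddCircle.coe_zsmul, coe_lift, hp, smul_zero]
  let π := QuotientAddGroup.mk' (AddSubgroup.zmultiples (1 : ℝ))
  rw [A.evalAt_action]
  refine (map_sum π (A.total x) Finset.univ).trans ?_
  have h1 : ∀ c : D.Crossing, π (A.total x c) =
      (D.word[c.time]'c.time_lt).weight (dir D.word c.time) (region (proj x) c.time)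
        (region (proj x) (c.time + 1)) + π (c.flux Ψ) := A.coe_total hx
  rw [Finset.sum_congr rfl fun c _ => h1 c, Finset.sum_add_distrib, ← map_sum, sum_flux hΨ]
  have h2 : π (Ψ D.rightEnd - Ψ D.leftEnd) = 0 := by
    rw [map_sub]
    exact sub_eq_zero.2 ((hend _ (sideValue_rightEnd _)).trans (hend _ (sideValue_leftEnd _)).symm)
  rw [h2, add_zero]
  refine sum_crossing _ _ (fun c => rfl) (fun k hk => ?_)
  generalize D.word[k] = e at *
  cases e with
  | cross i o => exact absurd rfl (hk i o)
  | _ => rfl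

/-- The invariant of a colouring. -/
noncomputable def invariant (ξ : D.Bridge → UnitAddCircle) : Circle :=
  AddCircle.toCircle (exponent ξ)

theorem Admissible.exp_action (A : D.Admissible) {x : D.Bridge → ℝ} (hx : x ∈ A.realSolutions) :
    Circle.exp (2 * Real.pi * evalAt x A.action) = invariant (proj x) := by
  rw [invariant, ← A.coe_action hx, AddCircle.toCircle_apply_mk, div_one]

/-! ### Simultaneous shift of all values of a colouring -/

/-- The parity of the number of a region in its column. -/
def stripe (_ j : ℕ) : ℝ := if Even j then 0 else 1

theorem stripe_succ (t j : ℕ) : stripe t (j + 1) = 1 - stripe t j := by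
  simp only [stripe, Nat.even_add_one]
  split_ifs <;> simp_all

/-- Events insert or remove regions two at a time, so the parity is a checkerboard colouring of the
plane. -/
theorem regionOff_stripe (e : Event) (t t' : ℕ) : RegionOff e (stripe t) (stripe t') := by
  refine ⟨fun _ _ => rfl, fun j _ => ?_⟩
  unfold stripe
  cases e <;> simp [Event.inWidth, Event.outWidth, Nat.even_add]

/-- The change of a region value when all strands are raised by one: zero and one in alternation. -/
theorem sum_range_stripe (n : ℕ) :
    (-1) ^ n * ∑ k ∈ Finset.range n, ((-1) ^ (k + 1) : ℝ) = stripe 0 n := by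
  induction n with
  | zero => simp [stripe]
  | succ n ih =>
    rw [Finset.sum_range_succ, stripe_succ, ← ih, mul_add, ← mul_pow, pow_succ]
    simp
    ring

/-- The case distinction in the crossing term only selects the incoming over-passing segment. -/
theorem Admissible.evalAt_crossingTerm (A : D.Admissible) (x : D.Bridge → ℝ) (c : D.Crossing) :
    evalAt x (A.crossingTerm c) =
      (A.value x (c.point c.overIn) - A.value x (c.point c.underOut)) *
        A.value x (c.point c.rightSide) := by
  unfold Admissible.crossingTerm Admissible.value
  split_ifs with h
  · rw [h]; simp
  · have : c.overIn = c.rightSide := by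
      rw [c.overIn_eq, c.leftSide_eq] at h
      rw [c.overIn_eq, c.rightSide_eq]
      split_ifs at h ⊢ <;> simp_all
    rw [this]; simp

theorem Admissible.value_add (A : D.Admissible) (x : D.Bridge → ℝ) (θ : ℝ) (p : D.Point) :
    A.value (fun b => x b + θ) p = A.value x p + θ := by
  obtain ⟨m, hm⟩ := A.on_bridge p
  unfold Admissible.value Admissible.at'
  rw [hm, map_add, map_add, evalAt_var, evalAt_var, map_zsmul, map_zsmul, evalAt_eps, evalAt_eps]
  ring

/-- A common shift leaves the defect and the first factor of the crossing term unchanged, so the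
dependence on `θ` is linear, and this is an identity of real numbers. -/
theorem Admissible.total_add (A : D.Admissible) (x : D.Bridge → ℝ) (θ : ℝ) (c : D.Crossing) :
    A.total (fun b => x b + θ) c =
      A.total x c + θ * c.flux (fun p => A.value x p * sideValue true stripe p) := by
  have h1 : A.defect (fun b => x b + θ) c = A.defect x c := by
    simp only [Admissible.defect, A.value_add]; ring
  have h2 : (-1) ^ c.count * ∑ k : Fin c.count, ((-1) ^ ((k : ℕ) + 1) : ℝ) =
      sideValue true stripe (c.point c.underIn) := by
    rw [Fin.sum_univ_eq_sum_range (fun k => ((-1) ^ (k + 1) : ℝ)), sum_range_stripe,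
      Crossing.count, toRight_eq]
    rfl
  have h3 : (-1) ^ c.count * ∑ k : Fin c.count, (-1) ^ ((k : ℕ) + 1) *
      (A.value x (c.hit k) + θ - 1 / 2) = (-1) ^ c.count * ∑ k : Fin c.count, (-1) ^ ((k : ℕ) + 1) *
      (A.value x (c.hit k) - 1 / 2) + θ * sideValue true stripe (c.point c.underIn) := by
    rw [← h2]
    simp only [Finset.mul_sum, ← Finset.sum_add_distrib]
    exact Finset.sum_congr rfl fun k _ => by ring
  -- The coefficient of `θ`. Around a crossing the checkerboard values alternate between `s` and `1
  -- - s`, with `s` on the left of the incoming under-passing segment; collecting the terms with and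
  -- without `s` gives the flux.
  have h4 : A.value x (c.point c.overIn) - A.value x (c.point c.underOut) +
      A.defect x c * sideValue true stripe (c.point c.underIn) =
        c.flux (fun p => A.value x p * sideValue true stripe p) := by
    rw [Admissible.defect, Crossing.flux, c.leftSide_eq, c.rightSide_eq, c.underIn_eq, c.overIn_eq,
      c.underOut_eq]
    have hs := stripe_succ c.time
    have ht : ∀ j, stripe (c.time + 1) j = stripe c.time j := fun _ => rfl
    cases c.upOver <;> cases hd₁ : dir D.word c.time c.idx <;>
      cases hd₂ : dir D.word c.time (c.idx + 1) <;>
      simp only [Bool.false_eq_true, if_true, if_false, add_zero,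
        Crossing.sideValue_sw, Crossing.sideValue_nw, Crossing.sideValue_se,
        Crossing.sideValue_ne, hd₁, hd₂, sgn, hs, ht, neg_smul, one_smul] <;> ring
  rw [← h4]
  simp only [Admissible.total, h1, A.value_add, h3, A.evalAt_crossingTerm]
  ring

/-- The flux in `total_add` telescopes to the two ends, whose left region is the bottom one, where
`stripe` is zero. So even the real value of the action is unchanged. -/
theorem exponent_add_const {ξ : D.Bridge → UnitAddCircle} (h : IsColouring ξ) (θ : UnitAddCircle) :
    exponent (fun b => ξ b + θ) = exponent ξ := by
  obtain ⟨x, rfl⟩ := proj_surjective ξ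
  obtain ⟨r, rfl⟩ := QuotientAddGroup.mk_surjective θ
  have h1 : (fun b => proj x b + (r : UnitAddCircle)) = proj fun b => x b + r := rfl
  let A := D.indexAdmissible
  have h2 : IsColouring (proj fun b => x b + r) := by
    intro c
    have := h c
    rw [← h1]
    simp only
    linear_combination (norm := module) this
  rw [show (fun b => proj x b + (QuotientAddGroup.mk r : UnitAddCircle)) = _ from h1,
    ← A.coe_action (A.mem_realSolutions_iff.2 h), ← A.coe_action (A.mem_realSolutions_iff.2 h2),
    A.evalAt_action, A.evalAt_action, Finset.sum_congr rfl fun c _ => A.total_add x r c,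
    Finset.sum_add_distrib, ← Finset.mul_sum, sum_flux]
  · rw [sideValue_rightEnd, sideValue_leftEnd]
    simp [stripe]
  · intro p q hpq
    rw [A.value_eq_of_link x hpq,
      sideValue_eq_of_link true (fun t e _ => regionOff_stripe e t (t + 1)) hpq]

end LongDiagram

/-! ### Moves inside a diagram -/

theorem regionRun_append {u v : List Event} {V : ℕ → ℕ → UnitAddCircle} :
    RegionRun (u ++ v) V ↔ RegionRun u V ∧ RegionRun v (fun k => V (u.length + k)) := by
  induction u generalizing V with
  | nil => simp [regionRun_nil]
  | cons e u ih =>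
    rw [List.cons_append, regionRun_cons, ih, regionRun_cons, and_assoc]
    simp only [List.length_cons, show ∀ k, u.length + k + 1 = u.length + 1 + k by intro k; omega]

theorem dirRun_append {u v : List Event} {d : ℕ → ℕ → Bool} :
    DirRun (u ++ v) d ↔ DirRun u d ∧ DirRun v (fun k => d (u.length + k)) := by
  induction u generalizing d with
  | nil => simp [dirRun_nil]
  | cons e u ih =>
    rw [List.cons_append, dirRun_cons, ih, dirRun_cons, and_assoc]
    simp only [List.length_cons, show ∀ k, u.length + k + 1 = u.length + 1 + k by intro k; omega]

theorem runWeight_append (u v : List Event) (d : ℕ → ℕ → Bool) (V : ℕ → ℕ → UnitAddCircle) :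
    runWeight (u ++ v) d V = runWeight u d V +
      runWeight v (fun k => d (u.length + k)) (fun k => V (u.length + k)) := by
  induction u generalizing d V with
  | nil => simp [runWeight_nil]
  | cons e u ih =>
    rw [List.cons_append, runWeight_cons, ih, runWeight_cons, add_assoc]
    simp only [List.length_cons, show ∀ k, u.length + k + 1 = u.length + 1 + k by intro k; omega]

theorem runWeight_congr {w : List Event} {d d' : ℕ → ℕ → Bool} {V V' : ℕ → ℕ → UnitAddCircle}
    (hd : ∀ k ≤ w.length, d k = d' k) (hV : ∀ k ≤ w.length, V k = V' k) :
    runWeight w d V = runWeight w d' V' :=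
  Finset.sum_congr rfl fun k _ => by
    rw [hd k k.2.le, hV k k.2.le, hV (k + 1) k.2]

theorem RegionRun.congr {w : List Event} {V V' : ℕ → ℕ → UnitAddCircle} (h : RegionRun w V)
    (hV : ∀ k ≤ w.length, V k = V' k) : RegionRun w V' := by
  intro k e he
  have hk := (List.getElem?_eq_some_iff.1 he).1
  rw [← hV k hk.le, ← hV (k + 1) hk]
  exact h k e he

/-- Unlike region values, directions involve no choice: a birth prescribes those of its two strands.
-/
theorem DirRun.eq_of_eq {w : List Event} {d d' : ℕ → ℕ → Bool} (h : DirRun w d) (h' : DirRun w d')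
    (h0 : d 0 = d' 0) : ∀ k ≤ w.length, d k = d' k := by
  intro k hk
  induction k with
  | zero => exact h0
  | succ k ih =>
    have he := List.getElem?_eq_getElem hk
    have h1 := h k _ he
    have h2 := h' k _ he
    rw [← ih (by omega)] at h2
    generalize w[k] = e at *
    funext j
    by_cases hj : j < e.idx
    · rw [h1.1.1 j hj, h2.1.1 j hj]
    by_cases hj' : e.idx + e.outWidth ≤ j
    · obtain ⟨m, rfl⟩ : ∃ m, j = m + e.outWidth := ⟨j - e.outWidth, by omega⟩
      rw [h1.1.2 m (by omega), h2.1.2 m (by omega)]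
    have h3 := h1.2
    have h4 := h2.2
    cases e with
    | birth i b =>
      simp only [Event.idx, Event.outWidth] at hj hj' h3 h4
      obtain rfl | rfl : j = i ∨ j = i + 1 := by omega
      · rw [h3.1, h4.1]
      · rw [h3.2, h4.2]
    | death i =>
      simp only [Event.idx, Event.outWidth] at hj hj'
      omega
    | cross i o =>
      simp only [Event.idx, Event.outWidth] at hj hj' h3 h4
      obtain rfl | rfl : j = i ∨ j = i + 1 := by omega
      · rw [h3.1, h4.1]
      · rw [h3.2, h4.2]

theorem Equivalent.symm {v w : List Event} (h : Equivalent v w) : Equivalent w v where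
  exists_run := h.exists_run'
  exists_run' := h.exists_run
  unique := h.unique'
  unique' := h.unique
  dir_eq d d' hd hd' h0 := (h.dir_eq d' d hd' hd h0.symm).symm
  weight_eq d d' V V' hd hd' hV hV' h0 h1 h2 :=
    (h.weight_eq d' d V' V hd' hd hV' hV h0.symm h1.symm h2.symm).symm

namespace LongDiagram

variable {D E : LongDiagram}

theorem dirRun (D : LongDiagram) : DirRun D.word (dir D.word) := fun _ _ he => D.dirStep he

/-- Region values which change as prescribed by the events come from a colouring. -/
theorem exists_colouring_of_regionRun {W : ℕ → ℕ → UnitAddCircle} (h : RegionRun D.word W) :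
    ∃ ξ : D.Bridge → UnitAddCircle, IsColouring ξ ∧
      ∀ p : D.Point, strandAt ξ p = W p.col p.pos + W p.col (p.pos + 1) :=
  exists_colouring (χ := fun t j => W t j + W t (j + 1)) fun t e he => (h t e he).strandStep

theorem strandAt_injective {ξ η : D.Bridge → UnitAddCircle} (h : ∀ p, strandAt ξ p = strandAt η p) :
    ξ = η := by
  funext b
  obtain ⟨p, rfl⟩ := Quot.exists_rep b
  have := h p
  unfold strandAt at this
  exact add_right_cancel (add_right_cancel this)

theorem eq_of_region_eq {ξ η : D.Bridge → UnitAddCircle}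
    (h : ∀ t ≤ D.word.length, region ξ t = region η t) : ξ = η := by
  refine strandAt_injective fun p => ?_
  rw [← extend_apply 0 (strandAt ξ) p, ← extend_apply 0 (strandAt η) p]
  change strand ξ _ _ = strand η _ _
  rw [← region_add_region, ← region_add_region, h _ p.col_le]

/-! ### Replacement of a subword by an equivalent one -/

/-- Two diagrams which differ by a replacement of equivalent words. -/
structure Splice (D E : LongDiagram) (u v w z : List Event) : Prop where
  source : D.word = u ++ (v ++ z)
  target : E.word = u ++ (w ++ z)
  equiv : Equivalent v w

variable {u v w z : List Event}

theorem Splice.symm (S : Splice D E u v w z) : Splice E D u w v z :=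
  ⟨S.target, S.source, S.equiv.symm⟩

/-- Columns of two diagrams which are the same outside of the region of a replacement. -/
def SameColumn (u v w z : List Event) (t t' : ℕ) : Prop :=
  (t = t' ∧ t ≤ u.length) ∨
    ∃ s ≤ z.length, t = u.length + v.length + s ∧ t' = u.length + w.length + s

namespace Splice

theorem dir_eq (S : Splice D E u v w z) {t t' : ℕ} (h : SameColumn u v w z t t') : dir D.word t = dir E.word t' := by
  have h1 := D.dirRun
  have h2 := E.dirRun
  rw [S.source, dirRun_append, dirRun_append] at h1
  rw [S.target, dirRun_append, dirRun_append] at h2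
  rw [← S.source] at h1
  rw [← S.target] at h2
  obtain ⟨h1u, h1v, h1z⟩ := h1
  obtain ⟨h2u, h2w, h2z⟩ := h2
  have hu := h1u.eq_of_eq h2u (by funext j; simp [dir, LongKnot.slice])
  rcases h with ⟨rfl, h⟩ | ⟨s, hs, rfl, rfl⟩
  · exact hu t h
  · have h3 := S.equiv.dir_eq _ _ h1v h2w (hu _ le_rfl)
    have h4 := h1z.eq_of_eq h2z h3 s hs
    simpa [add_assoc] using h4

/-- `Equivalent` says nothing about widths. To the right of the replacement they are compared by
going back from the right end, where both are one, since each event changes the width by a fixed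
amount. -/
theorem width_eq (S : Splice D E u v w z) {t t' : ℕ} (h : SameColumn u v w z t t') : width D.word t = width E.word t' := by
  rcases h with ⟨rfl, h⟩ | ⟨s, hs, rfl, rfl⟩
  · unfold width LongKnot.slice
    rw [S.source, S.target, List.take_append_of_le_length h, List.take_append_of_le_length h]
  · have hD : D.word.length = u.length + v.length + z.length := by rw [S.source]; simp; omega
    have hE : E.word.length = u.length + w.length + z.length := by rw [S.target]; simp; omega
    obtain ⟨k, hk⟩ : ∃ k, s + k = z.length := ⟨z.length - s, by omega⟩
    induction k generalizing s with
    | zero =>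
      obtain rfl : s = z.length := by omega
      rw [← hD, ← hE, D.width_length, E.width_length]
    | succ k ih =>
      have h1 := ih (s + 1) (by omega) (by omega)
      have hs' : s < z.length := by omega
      have h2 : D.word[u.length + v.length + s]? = some z[s] := by
        rw [S.source, List.getElem?_append_right (by omega),
          List.getElem?_append_right (by omega), ← List.getElem?_eq_getElem hs']
        congr 1; omega
      have h3 : E.word[u.length + w.length + s]? = some z[s] := by
        rw [S.target, List.getElem?_append_right (by omega),
          List.getElem?_append_right (by omega), ← List.getElem?_eq_getElem hs']
        congr 1; omega
      have h4 := D.width_succ h2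
      have h5 := E.width_succ h3
      rw [← add_assoc] at h1
      rw [← add_assoc] at h1
      omega

theorem le_length (S : Splice D E u v w z) {t t' : ℕ} (h : SameColumn u v w z t t') :
    t ≤ D.word.length ∧ t' ≤ E.word.length := by
  rw [S.source, S.target]
  simp only [List.length_append]
  rcases h with ⟨rfl, h⟩ | ⟨s, hs, rfl, rfl⟩ <;> omega

end Splice

/-- Colourings of two diagrams which agree outside of the region of a replacement. -/
def Agree (u v w z : List Event) (ξ : D.Bridge → UnitAddCircle) (η : E.Bridge → UnitAddCircle) :
    Prop := ∀ t t', SameColumn u v w z t t' → strand ξ t = strand η t'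

theorem Agree.symm {ξ : D.Bridge → UnitAddCircle} {η : E.Bridge → UnitAddCircle}
    (h : Agree u v w z ξ η) : Agree u w v z η ξ := by
  rintro t t' (⟨rfl, h1⟩ | ⟨s, hs, rfl, rfl⟩)
  · exact (h _ _ (Or.inl ⟨rfl, h1⟩)).symm
  · exact (h _ _ (Or.inr ⟨s, hs, rfl, rfl⟩)).symm

theorem Agree.region_eq {ξ : D.Bridge → UnitAddCircle} {η : E.Bridge → UnitAddCircle}
    (h : Agree u v w z ξ η) {t t' : ℕ} (ht : SameColumn u v w z t t') :
    region ξ t = region η t' := by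
  unfold region; rw [h t t' ht]

theorem sameColumn_start : SameColumn u v w z u.length u.length := Or.inl ⟨rfl, le_rfl⟩

theorem sameColumn_end :
    SameColumn u v w z (u.length + v.length) (u.length + w.length) :=
  Or.inr ⟨0, Nat.zero_le _, rfl, rfl⟩

/-- Outside of the replacement the columns of regions are prescribed; inside, equivalence supplies a
run between the two outer columns and its uniqueness. -/
theorem Splice.existsUnique (S : Splice D E u v w z) {ξ : D.Bridge → UnitAddCircle}
    (hξ : IsColouring ξ) :
    ∃! η : E.Bridge → UnitAddCircle, IsColouring η ∧ Agree u v w z ξ η := by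
  have h1 := hξ.regionRun
  rw [S.source, regionRun_append, regionRun_append] at h1
  obtain ⟨h1u, h1v, h1z⟩ := h1
  have hlen : E.word.length = u.length + w.length + z.length := by rw [S.target]; simp; omega
  refine existsUnique_of_exists_of_unique ?_ ?_
  · obtain ⟨V, hV, hV0, hV1⟩ := S.equiv.exists_run _ h1v
    -- The old columns before the replacement, the run supplied by equivalence, then the old columns
    -- renumbered. `W2` and `W3` check that the pieces agree where they meet.
    let W : ℕ → ℕ → UnitAddCircle := fun t => if t ≤ u.length then region ξ t else
      if t ≤ u.length + w.length then V (t - u.length) else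
        region ξ (u.length + (v.length + (t - u.length - w.length)))
    have W1 : ∀ t ≤ u.length, W t = region ξ t := fun t ht => if_pos ht
    have W2 : ∀ k ≤ w.length, W (u.length + k) = V k := by
      intro k hk
      by_cases h : k = 0
      · subst h; rw [add_zero, W1 _ le_rfl, hV0]; rfl
      · simp only [W]
        rw [if_neg (by omega), if_pos (by omega), Nat.add_sub_cancel_left]
    have W3 : ∀ s, W (u.length + (w.length + s)) = region ξ (u.length + (v.length + s)) := by
      intro s
      by_cases h : s = 0
      · subst h; rw [add_zero, W2 _ le_rfl, hV1]; rfl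
      · simp only [W]
        rw [if_neg (by omega), if_neg (by omega)]
        congr 3; omega
    have hW : RegionRun E.word W := by
      rw [S.target, regionRun_append, regionRun_append]
      refine ⟨h1u.congr fun k hk => (W1 k hk).symm, hV.congr fun k hk => (W2 k hk).symm,
        h1z.congr fun k hk => (W3 k).symm⟩
    obtain ⟨η, hη, hηW⟩ := exists_colouring_of_regionRun hW
    refine ⟨η, hη, ?_⟩
    intro t t' ht
    have hWt : W t' = region ξ t := by
      rcases ht with ⟨rfl, h⟩ | ⟨s, hs, rfl, rfl⟩
      · exact W1 t h
      · rw [add_assoc, W3, add_assoc]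
    obtain ⟨l1, l2⟩ := S.le_length ht
    funext j
    by_cases hj : j < width D.word t
    · have hj' : j < width E.word t' := S.width_eq ht ▸ hj
      have := hηW ⟨t', j, l2, hj'⟩
      simp only at this
      rw [← region_add_region, ← hWt, ← this]
      exact (extend_mk _ _ l2 hj').symm
    · have hj' : ¬ j < width E.word t' := S.width_eq ht ▸ hj
      -- Above the top strand both columns have the default value zero; this needs equality of
      -- widths.
      rw [strand, strand, extend_of_not _ _ (by tauto), extend_of_not _ _ (by tauto)]
  · rintro η η' ⟨hη, h⟩ ⟨hη', h'⟩
    have hrun := hη.regionRun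
    have hrun' := hη'.regionRun
    rw [S.target, regionRun_append, regionRun_append] at hrun hrun'
    have key := S.equiv.unique' _ _ hrun.2.1 hrun'.2.1
      ((h.region_eq sameColumn_start).symm.trans (h'.region_eq sameColumn_start))
      ((h.region_eq sameColumn_end).symm.trans (h'.region_eq sameColumn_end))
    refine eq_of_region_eq fun t ht => ?_
    by_cases h1 : t ≤ u.length
    · have hs : SameColumn u v w z t t := Or.inl ⟨rfl, h1⟩
      exact (h.region_eq hs).symm.trans (h'.region_eq hs)
    by_cases h2 : t ≤ u.length + w.length
    · obtain ⟨k, rfl⟩ : ∃ k, t = u.length + k := ⟨t - u.length, by omega⟩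
      exact key k (by omega)
    · obtain ⟨s, rfl⟩ : ∃ s, t = u.length + w.length + s := ⟨t - u.length - w.length, by omega⟩
      have hs : SameColumn u v w z (u.length + v.length + s) (u.length + w.length + s) :=
        Or.inr ⟨s, by omega, rfl, rfl⟩
      exact (h.region_eq hs).symm.trans (h'.region_eq hs)

theorem Splice.exponent_eq (S : Splice D E u v w z) {ξ : D.Bridge → UnitAddCircle}
    {η : E.Bridge → UnitAddCircle} (hξ : IsColouring ξ) (hη : IsColouring η)
    (h : Agree u v w z ξ η) : exponent ξ = exponent η := by
  have h1 := hξ.regionRun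
  have h2 := hη.regionRun
  have h3 := D.dirRun
  have h4 := E.dirRun
  unfold exponent
  rw [show runWeight D.word = runWeight (u ++ (v ++ z)) by rw [S.source],
    show runWeight E.word = runWeight (u ++ (w ++ z)) by rw [S.target], runWeight_append,
    runWeight_append, runWeight_append, runWeight_append]
  rw [show DirRun D.word = DirRun (u ++ (v ++ z)) by rw [S.source], dirRun_append,
    dirRun_append] at h3
  rw [show DirRun E.word = DirRun (u ++ (w ++ z)) by rw [S.target], dirRun_append,
    dirRun_append] at h4
  rw [S.source, regionRun_append, regionRun_append] at h1
  rw [S.target, regionRun_append, regionRun_append] at h2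
  have s1 : ∀ t ≤ u.length, SameColumn u v w z t t := fun t ht => Or.inl ⟨rfl, ht⟩
  have s2 : ∀ s ≤ z.length, SameColumn u v w z (u.length + (v.length + s))
      (u.length + (w.length + s)) := fun s hs =>
    Or.inr ⟨s, hs, (add_assoc _ _ _).symm, (add_assoc _ _ _).symm⟩
  congr 1
  · exact runWeight_congr (fun k hk => S.dir_eq (s1 k hk)) fun k hk => h.region_eq (s1 k hk)
  congr 1
  · exact S.equiv.weight_eq _ _ _ _ h3.2.1 h4.2.1 h1.2.1 h2.2.1 (S.dir_eq sameColumn_start)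
      (h.region_eq sameColumn_start) (h.region_eq sameColumn_end)
  · exact runWeight_congr (fun k hk => S.dir_eq (s2 k hk)) fun k hk => h.region_eq (s2 k hk)

end LongDiagram

/-! ### Reidemeister moves as replacements -/

open LongDiagram

namespace Move

variable {D E : LongDiagram} (M : Move D E)

theorem splice : Splice D E M.before M.old M.new M.after :=
  ⟨by rw [M.source, List.append_assoc], by rw [M.target, List.append_assoc], M.isLocal.equivalent⟩

/-- Bridge values and strand values differ by winding indices, and these are computed from
directions in a single column, which are the same in both diagrams outside of the move. -/
theorem corresponds_iff (ξ : D.Bridge → UnitAddCircle) (η : E.Bridge → UnitAddCircle) :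
    M.Corresponds ξ η ↔ Agree M.before M.old M.new M.after ξ η := by
  have hlen : D.word.length = M.before.length + M.old.length + M.after.length := by
    rw [M.source]; simp [add_assoc]
  have hli : ∀ (p : D.Point) (q : E.Point), p.pos = q.pos →
      SameColumn M.before M.old M.new M.after p.col q.col → leftIndex p = leftIndex q := by
    intro p q hpos hcol
    unfold leftIndex sideValue
    simp only [hpos, M.splice.dir_eq hcol]
  constructor
  · intro h t t' ht
    obtain ⟨l1, l2⟩ := M.splice.le_length ht
    funext j
    by_cases hj : j < width D.word t
    · have hj' : j < width E.word t' := M.splice.width_eq ht ▸ hj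
      rw [strand, strand, extend_mk _ _ l1 hj, extend_mk _ _ l2 hj']
      unfold strandAt
      rw [hli ⟨t, j, l1, hj⟩ ⟨t', j, l2, hj'⟩ rfl ht, h ⟨t, j, l1, hj⟩ ⟨t', j, l2, hj'⟩]
      refine ⟨rfl, ?_⟩
      rcases ht with h1 | ⟨s, -, h1⟩
      · exact Or.inl h1
      · exact Or.inr ⟨s, h1⟩
    · have hj' : ¬ j < width E.word t' := M.splice.width_eq ht ▸ hj
      rw [strand, strand, extend_of_not _ _ (by tauto), extend_of_not _ _ (by tauto)]
  · rintro h p q ⟨hpos, hcol⟩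
    have hcol : SameColumn M.before M.old M.new M.after p.col q.col := by
      rcases hcol with h1 | ⟨s, h1, h2⟩
      · exact Or.inl h1
      · have := p.col_le
        exact Or.inr ⟨s, by omega, h1, h2⟩
    have h1 : strand ξ p.col p.pos = strand η q.col q.pos := by rw [h _ _ hcol, hpos]
    rw [strand, strand, extend_apply, extend_apply] at h1
    unfold strandAt at h1
    rw [hli p q hpos hcol] at h1
    exact add_right_cancel (add_right_cancel h1)

theorem existsUnique_target {ξ : D.Bridge → UnitAddCircle} (h : IsColouring ξ) :
    ∃! η : E.Bridge → UnitAddCircle, IsColouring η ∧ M.Corresponds ξ η := by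
  simp only [M.corresponds_iff]
  exact M.splice.existsUnique h

theorem existsUnique_source {η : E.Bridge → UnitAddCircle} (h : IsColouring η) :
    ∃! ξ : D.Bridge → UnitAddCircle, IsColouring ξ ∧ M.Corresponds ξ η := by
  simp only [M.corresponds_iff]
  obtain ⟨ξ, ⟨h1, h2⟩, h3⟩ := M.splice.symm.existsUnique h
  exact ⟨ξ, ⟨h1, h2.symm⟩, fun ξ' h' => h3 ξ' ⟨h'.1, h'.2.symm⟩⟩

theorem exponent_eq {ξ : D.Bridge → UnitAddCircle} {η : E.Bridge → UnitAddCircle}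
    (hξ : IsColouring ξ) (hη : IsColouring η) (h : M.Corresponds ξ η) :
    exponent ξ = exponent η :=
  M.splice.exponent_eq hξ hη ((M.corresponds_iff ξ η).1 h)

end Move

namespace LongDiagram

variable {D : LongDiagram}

/-! ### The first homology group of the double cover -/

/-- The meridian of a bridge. -/
def meridian (b : D.Bridge) : D.KnotGroup := PresentedGroup.of b

variable (D) in
/-- The right infinite bridge. -/
def base : D.Bridge := bridge D.rightEnd

theorem parity_meridian (b : D.Bridge) : D.parity (meridian b) = Multiplicative.ofAdd 1 := by
  unfold parity meridian
  exact PresentedGroup.toGroup.of _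

/-- The class of an element of the kernel of the parity. -/
def cls (g : D.KnotGroup) (hg : D.parity g = 1) : D.H1 :=
  Additive.ofMul (Abelianization.of ⟨g, hg⟩)

theorem cls_mul {g h : D.KnotGroup} (hg : D.parity g = 1) (hh : D.parity h = 1)
    (hgh : D.parity (g * h) = 1) : cls (g * h) hgh = cls g hg + cls h hh := by
  unfold cls
  rw [← ofMul_mul, ← map_mul]
  rfl

theorem cls_inv {g : D.KnotGroup} (hg : D.parity g = 1) (hg' : D.parity g⁻¹ = 1) :
    cls g⁻¹ hg' = -cls g hg := by
  unfold cls
  rw [← ofMul_inv, ← map_inv]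
  rfl

theorem cls_congr {g h : D.KnotGroup} (e : g = h) (hg : D.parity g = 1) (hh : D.parity h = 1) :
    cls g hg = cls h hh := by
  subst e; rfl

theorem parity_mul_meridian (a b : D.Bridge) : D.parity (meridian a * meridian b) = 1 := by
  rw [map_mul, parity_meridian, parity_meridian]; decide

theorem parity_inv_mul_meridian (a b : D.Bridge) : D.parity ((meridian a)⁻¹ * meridian b) = 1 := by
  rw [map_mul, map_inv, parity_meridian, parity_meridian]; decide

theorem parity_mul_inv_meridian (a b : D.Bridge) : D.parity (meridian a * (meridian b)⁻¹) = 1 := by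
  rw [map_mul, map_inv, parity_meridian, parity_meridian]; decide

theorem pairClass_eq (b : D.Bridge) :
    pairClass b = cls (meridian b * meridian D.base) (parity_mul_meridian _ _) := rfl

theorem Crossing.meridian_underOut (c : D.Crossing) :
    meridian (bridge (c.point c.underOut)) = if c.overIn = c.leftSide then
      (meridian (bridge (c.point c.overIn)))⁻¹ * meridian (bridge (c.point c.underIn)) *
        meridian (bridge (c.point c.overIn))
    else meridian (bridge (c.point c.overIn)) * meridian (bridge (c.point c.underIn)) *
        (meridian (bridge (c.point c.overIn)))⁻¹ := by
  have h : PresentedGroup.mk (Set.range (relator (D := D))) (relator c) = 1 :=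
    PresentedGroup.one_of_mem ⟨c, rfl⟩
  unfold relator at h
  dsimp only at h
  split_ifs at h ⊢
  all_goals
    rw [map_mul, map_inv, mul_inv_eq_one] at h
    exact h.symm

/-- Consecutive meridians are conjugate by an odd element. The conjugator may be multiplied by the
meridian `a`, which commutes with its own square; it is then even and disappears in the
abelianization. -/
theorem cls_sq (b : D.Bridge) : cls (meridian b * meridian b) (parity_mul_meridian _ _) =
    pairClass D.base := by
  obtain ⟨p, rfl⟩ := Quot.exists_rep b
  refine forall_of_link (P := fun p => cls (meridian (bridge p) * meridian (bridge p))
    (parity_mul_meridian _ _) = pairClass D.base) ?_ rfl p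
  have key : ∀ c : D.Crossing, cls (meridian (bridge (c.point c.underOut)) *
      meridian (bridge (c.point c.underOut))) (parity_mul_meridian _ _) =
      cls (meridian (bridge (c.point c.underIn)) *
      meridian (bridge (c.point c.underIn))) (parity_mul_meridian _ _) := by
    intro c
    have h := c.meridian_underOut
    generalize bridge (c.point c.underOut) = b at *
    generalize bridge (c.point c.underIn) = a at *
    generalize bridge (c.point c.overIn) = o at *
    split_ifs at h
    · have e : meridian b * meridian b = (meridian o)⁻¹ * meridian a * (meridian a * meridian a) *
          ((meridian o)⁻¹ * meridian a)⁻¹ := by rw [h]; group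
      have p1 : D.parity (((meridian o)⁻¹ * meridian a)⁻¹) = 1 := by
        rw [map_inv, parity_inv_mul_meridian, inv_one]
      have p2 : D.parity ((meridian o)⁻¹ * meridian a * (meridian a * meridian a)) = 1 := by
        rw [map_mul, parity_inv_mul_meridian, parity_mul_meridian, one_mul]
      rw [cls_congr e _ (e ▸ parity_mul_meridian _ _), cls_mul p2 p1,
        cls_mul (parity_inv_mul_meridian _ _) (parity_mul_meridian _ _),
        cls_inv (parity_inv_mul_meridian _ _)]
      abel
    · have e : meridian b * meridian b = (meridian o * meridian a) * (meridian a * meridian a) *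
          (meridian o * meridian a)⁻¹ := by rw [h]; group
      have p1 : D.parity ((meridian o * meridian a)⁻¹) = 1 := by
        rw [map_inv, parity_mul_meridian, inv_one]
      have p2 : D.parity (meridian o * meridian a * (meridian a * meridian a)) = 1 := by
        rw [map_mul, parity_mul_meridian, parity_mul_meridian, one_mul]
      rw [cls_congr e _ (e ▸ parity_mul_meridian _ _), cls_mul p2 p1,
        cls_mul (parity_mul_meridian _ _) (parity_mul_meridian _ _),
        cls_inv (parity_mul_meridian _ _)]
      abel
  intro k p q h
  by_cases hk : k = .plain
  · subst hk; rw [bridge_eq_of_link h]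
  · obtain ⟨c, ⟨-, ⟨rfl, rfl⟩ | ⟨rfl, rfl⟩⟩ | ⟨-, ⟨rfl, rfl⟩ | ⟨rfl, rfl⟩⟩⟩ :=
      exists_ends_of_link hk h
    · rw [c.bridge_leftSide]
    · rw [c.bridge_leftSide]
    · rw [key c]
    · rw [key c]

theorem cls_mul_inv (a b : D.Bridge) : cls (meridian a * (meridian b)⁻¹)
    (parity_mul_inv_meridian _ _) = pairClass a - pairClass b := by
  have e : meridian a * (meridian b)⁻¹ =
    (meridian a * meridian D.base) * (meridian b * meridian D.base)⁻¹ := by group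
  have p1 : D.parity (meridian b * meridian D.base)⁻¹ = 1 := by
    rw [map_inv, parity_mul_meridian, inv_one]
  rw [cls_congr e _ (e ▸ parity_mul_inv_meridian _ _), cls_mul (parity_mul_meridian _ _) p1,
    cls_inv (parity_mul_meridian _ _), sub_eq_add_neg]
  rfl

theorem cls_meridian_mul (a b : D.Bridge) : cls (meridian a * meridian b)
    (parity_mul_meridian _ _) = pairClass a - pairClass b + pairClass D.base := by
  have e : meridian a * meridian b =
    (meridian a * (meridian b)⁻¹) * (meridian b * meridian b) := by group
  rw [cls_congr e _ (e ▸ parity_mul_meridian _ _), cls_mul (parity_mul_inv_meridian _ _)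
    (parity_mul_meridian _ _), cls_sq, cls_mul_inv]

/-- An inverse meridian is the meridian divided by its square, and all these squares have the class
of the base. -/
theorem cls_inv_mul (a b : D.Bridge) : cls ((meridian a)⁻¹ * meridian b)
    (parity_inv_mul_meridian _ _) = pairClass a - pairClass b := by
  have e : (meridian a)⁻¹ * meridian b =
    (meridian a * meridian a)⁻¹ * (meridian a * meridian b) := by group
  have p1 : D.parity (meridian a * meridian a)⁻¹ = 1 := by
    rw [map_inv, parity_mul_meridian, inv_one]
  rw [cls_congr e _ (e ▸ parity_inv_mul_meridian _ _), cls_mul p1 (parity_mul_meridian _ _),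
    cls_inv (parity_mul_meridian _ _), cls_sq, cls_meridian_mul]
  abel

/-- The conjugation in the Wirtinger relation, multiplied by the base meridian, splits into two even
factors. Both signs of the crossing give the same additive relation. -/
theorem pairClass_add (c : D.Crossing) : pairClass (bridge (c.point c.underIn)) +
    pairClass (bridge (c.point c.underOut)) =
      pairClass (bridge (c.point c.overIn)) + pairClass (bridge (c.point c.overIn)) := by
  have h := c.meridian_underOut
  rw [pairClass_eq (bridge (c.point c.underOut))]
  generalize bridge (c.point c.underOut) = b at *
  generalize bridge (c.point c.underIn) = a at *
  generalize bridge (c.point c.overIn) = o at *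
  split_ifs at h
  · have e : meridian b * meridian D.base =
      ((meridian o)⁻¹ * meridian a) * (meridian o * meridian D.base) := by rw [h]; group
    rw [cls_congr e _ (e ▸ parity_mul_meridian _ _), cls_mul (parity_inv_mul_meridian _ _)
      (parity_mul_meridian _ _), cls_inv_mul, ← pairClass_eq]
    abel
  · have e : meridian b * meridian D.base =
      (meridian o * meridian a) * ((meridian o)⁻¹ * meridian D.base) := by rw [h]; group
    rw [cls_congr e _ (e ▸ parity_mul_meridian _ _), cls_mul (parity_mul_meridian _ _)
      (parity_inv_mul_meridian _ _), cls_inv_mul, cls_meridian_mul]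
    abel

theorem closure_meridian : Subgroup.closure (Set.range (meridian (D := D))) = ⊤ :=
  PresentedGroup.closure_range_of _

/-- The first homology group of the double cover is generated by the pairs of meridians. -/
theorem closure_pairClass : AddSubgroup.closure (Set.range (pairClass (D := D))) = ⊤ := by
  set A := AddSubgroup.closure (Set.range (pairClass (D := D)))
  have hA : ∀ b : D.Bridge, pairClass b ∈ A := fun b => AddSubgroup.subset_closure ⟨b, rfl⟩
  -- Prefixes of a word of meridians may be odd and then have no class in the kernel; such a prefix
  -- is followed by the base meridian.
  have key : ∀ g : D.KnotGroup, ∀ (k : D.KnotGroup) (hk : D.parity k = 1),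
      (k = g ∨ k = g * meridian D.base) → cls k hk ∈ A := by
    intro g
    have hg : g ∈ Subgroup.closure (Set.range (meridian (D := D))) := by
      rw [closure_meridian]; trivial
    induction hg using Subgroup.closure_induction_right with
    | one =>
      rintro k hk (rfl | rfl)
      · have e : (1 : D.KnotGroup) = meridian D.base * (meridian D.base)⁻¹ := by group
        rw [cls_congr e _ (parity_mul_inv_meridian _ _), cls_mul_inv]
        exact sub_mem (hA _) (hA _)
      · rw [one_mul, parity_meridian] at hk
        exact absurd hk (by decide)
    | mul_right g _ y hy ih =>
      obtain ⟨b, rfl⟩ := hy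
      rintro k hk (rfl | rfl)
      · have h1 : D.parity (g * meridian D.base) = 1 := by
          rw [map_mul, parity_meridian] at hk ⊢; exact hk
        have e : g * meridian b =
          (g * meridian D.base) * ((meridian D.base)⁻¹ * meridian b) := by group
        rw [cls_congr e _ (e ▸ hk), cls_mul h1 (parity_inv_mul_meridian _ _), cls_inv_mul]
        exact add_mem (ih _ h1 (Or.inr rfl)) (sub_mem (hA _) (hA _))
      · have h1 : D.parity g = 1 := by
          rwa [mul_assoc, map_mul, parity_mul_meridian, mul_one] at hk
        rw [cls_congr (mul_assoc _ _ _) _ (mul_assoc g _ _ ▸ hk),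
          cls_mul h1 (parity_mul_meridian _ _)]
        exact add_mem (ih _ h1 (Or.inl rfl)) (hA _)
    | mul_inv_cancel g _ y hy ih =>
      obtain ⟨b, rfl⟩ := hy
      rintro k hk (rfl | rfl)
      · have e : g * (meridian b)⁻¹ =
          (g * meridian D.base) * (meridian b * meridian D.base)⁻¹ := by group
        have p1 : D.parity (meridian b * meridian D.base)⁻¹ = 1 := by
          rw [map_inv, parity_mul_meridian, inv_one]
        have h1 : D.parity (g * meridian D.base) = 1 := by
          rwa [e, map_mul, p1, mul_one] at hk
        rw [cls_congr e _ (e ▸ hk), cls_mul h1 p1, cls_inv (parity_mul_meridian _ _)]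
        exact add_mem (ih _ h1 (Or.inr rfl)) (neg_mem (hA _))
      · have h1 : D.parity g = 1 := by
          rwa [mul_assoc, map_mul, parity_inv_mul_meridian, mul_one] at hk
        rw [cls_congr (mul_assoc _ _ _) _ (mul_assoc g _ _ ▸ hk),
          cls_mul h1 (parity_inv_mul_meridian _ _), cls_inv_mul]
        exact add_mem (ih _ h1 (Or.inl rfl)) (sub_mem (hA _) (hA _))
  rw [eq_top_iff]
  rintro h -
  obtain ⟨g, hg⟩ := QuotientGroup.mk_surjective (Additive.toMul h)
  have := key g.1 g.1 g.2 (Or.inl rfl)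
  rw [show h = cls g.1 g.2 from hg.symm]
  exact this

theorem isColouring_ofCohomology (φ : D.H1 →+ UnitAddCircle) :
    IsColouring (D.ofCohomology φ) := by
  intro c
  have := congrArg φ (pairClass_add c)
  rwa [map_add, map_add] at this

theorem ofCohomology_injective : Function.Injective D.ofCohomology := by
  intro φ ψ h
  refine AddMonoidHom.eq_of_eqOn_dense closure_pairClass ?_
  rintro _ ⟨b, rfl⟩
  exact congrFun h b

/-! ### Characters from colourings -/

/-- The action of the knot group on `ℝ / ℤ` by reflections which is given by a colouring. -/
def reflection {ξ : D.Bridge → UnitAddCircle} (h : IsColouring ξ) :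
    D.KnotGroup →* Equiv.Perm UnitAddCircle :=
  PresentedGroup.toGroup (f := fun b => Equiv.subLeft (ξ b)) (by
    rintro _ ⟨c, rfl⟩
    have := h c
    unfold relator
    dsimp only
    split_ifs <;>
    · simp only [map_mul, map_inv, FreeGroup.lift_apply_of]
      rw [mul_inv_eq_one]
      ext x
      simp only [Equiv.Perm.coe_mul, Function.comp_apply, Equiv.Perm.inv_def, Equiv.subLeft_apply,
        Equiv.subLeft_symm_apply]
      -- Conjugating the reflection at `a` by the one at `o` gives the reflection with parameter `2
      -- * o - a`, which is the colouring relation.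
      linear_combination (norm := module) -this)

theorem reflection_meridian {ξ : D.Bridge → UnitAddCircle} (h : IsColouring ξ) (b : D.Bridge) :
    reflection h (meridian b) = Equiv.subLeft (ξ b) := PresentedGroup.toGroup.of _

theorem reflection_apply {ξ : D.Bridge → UnitAddCircle} (h : IsColouring ξ) (g : D.KnotGroup) :
    (D.parity g = 1 ∧ ∀ x, reflection h g x = reflection h g 0 + x) ∨
      (D.parity g = Multiplicative.ofAdd 1 ∧ ∀ x, reflection h g x = reflection h g 0 - x) := by
  have hg : g ∈ Subgroup.closure (Set.range (meridian (D := D))) := by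
    rw [closure_meridian]; trivial
  induction hg using Subgroup.closure_induction_left with
  | one => left; simp
  | mul_left y hy g _ ih =>
    obtain ⟨b, rfl⟩ := hy
    simp only [map_mul, parity_meridian, reflection_meridian, Equiv.Perm.coe_mul,
      Function.comp_apply, Equiv.subLeft_apply]
    rcases ih with ⟨h1, h2⟩ | ⟨h1, h2⟩
    · exact Or.inr ⟨by rw [h1, mul_one], fun x => by rw [h2 x]; abel⟩
    · exact Or.inl ⟨by rw [h1]; decide, fun x => by rw [h2 x]; abel⟩
  | inv_mul_cancel y hy g _ ih =>
    obtain ⟨b, rfl⟩ := hy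
    simp only [map_mul, map_inv, parity_meridian, reflection_meridian, Equiv.Perm.coe_mul,
      Function.comp_apply, Equiv.Perm.inv_def, Equiv.subLeft_symm_apply]
    rcases ih with ⟨h1, h2⟩ | ⟨h1, h2⟩
    · exact Or.inr ⟨by rw [h1, mul_one]; decide, fun x => by rw [h2 x]; abel⟩
    · exact Or.inl ⟨by rw [h1]; decide, fun x => by rw [h2 x]; abel⟩

theorem reflection_apply_of_parity {ξ : D.Bridge → UnitAddCircle} (h : IsColouring ξ)
    {g : D.KnotGroup} (hg : D.parity g = 1) (x : UnitAddCircle) :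
    reflection h g x = reflection h g 0 + x := by
  rcases reflection_apply h g with ⟨-, h2⟩ | ⟨h1, -⟩
  · exact h2 x
  · rw [hg] at h1
    exact absurd h1 (by decide)

/-- The homomorphism from the knot group which sends all meridians to the same element. -/
def degree (D : LongDiagram) (c : UnitAddCircle) : D.KnotGroup →* Multiplicative UnitAddCircle :=
  PresentedGroup.toGroup (f := fun _ => Multiplicative.ofAdd c) (by
    rintro _ ⟨c, rfl⟩
    unfold relator
    dsimp only
    split_ifs <;> simp)

theorem degree_meridian (c : UnitAddCircle) (b : D.Bridge) :
    D.degree c (meridian b) = Multiplicative.ofAdd c := PresentedGroup.toGroup.of _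

/-- Even elements act by translations, which gives a character of the kernel with value `ξ b - ξ
D.base` on the pair of `b`. Adding the degree character with `c + c = ξ D.base` restores the missing
constant. -/
theorem exists_ofCohomology_eq {ξ : D.Bridge → UnitAddCircle} (h : IsColouring ξ) :
    ∃ φ, D.ofCohomology φ = ξ := by
  -- Divisibility of `ℝ / ℤ`; a product of two meridians has degree `c + c`.
  obtain ⟨c, hc⟩ : ∃ c : UnitAddCircle, c + c = ξ D.base :=
    ⟨((lift (ξ D.base) / 2 : ℝ) : UnitAddCircle), by
      rw [← AddCircle.coe_add, add_halves, coe_lift]⟩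
  let κ : D.parity.ker →* Multiplicative UnitAddCircle :=
    { toFun := fun g => Multiplicative.ofAdd (reflection h g.1 0) * D.degree c g.1
      map_one' := by simp
      map_mul' := fun g k => by
        simp only [Subgroup.coe_mul, map_mul, Equiv.Perm.coe_mul, Function.comp_apply]
        rw [reflection_apply_of_parity h g.2, ofAdd_add]
        exact mul_mul_mul_comm _ _ _ _ }
  refine ⟨MonoidHom.toAdditiveLeft (Abelianization.lift κ), ?_⟩
  funext b
  change Multiplicative.toAdd (κ ⟨meridian b * meridian D.base, _⟩) = ξ b
  simp only [κ, MonoidHom.coe_mk, OneHom.coe_mk, map_mul, reflection_meridian, degree_meridian,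
    Equiv.Perm.coe_mul, Function.comp_apply, Equiv.subLeft_apply, toAdd_mul, toAdd_ofAdd]
  rw [hc]
  abel

theorem bijOn_ofCohomology (D : LongDiagram) :
    Set.BijOn D.ofCohomology Set.univ D.solutions := by
  rw [D.solutions_eq]
  exact ⟨fun φ _ => isColouring_ofCohomology φ, ofCohomology_injective.injOn,
    fun ξ hξ => (exists_ofCohomology_eq hξ).imp fun φ hφ => ⟨trivial, hφ⟩⟩

/-! ### Torsion -/

instance (w : List Event) : Finite (Pt w) := by
  refine Finite.of_injective (β := Σ t : Fin (w.length + 1), Fin (slice w t).length)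
    (fun p => ⟨⟨p.col, Nat.lt_succ_of_le p.col_le⟩, ⟨p.pos, p.pos_lt⟩⟩) ?_
  rintro ⟨t, j, ht, hj⟩ ⟨t', j', ht', hj'⟩ h
  simp only [Sigma.mk.injEq, Fin.mk.injEq] at h
  obtain ⟨rfl, h⟩ := h
  simpa using h

instance : Finite D.Bridge := inferInstanceAs (Finite (Quot _))

/-- The differences of the pairs of meridians are torsion elements. -/
theorem isOfFinAddOrder_sub (b : D.Bridge) :
    IsOfFinAddOrder (pairClass b - pairClass D.base : D.H1) := by
  let h : D.Bridge → D.H1 := fun b => pairClass b - pairClass D.base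
  let N : Submodule ℤ D.H1 := Submodule.span ℤ (Set.range h)
  let I : Ideal ℤ := Ideal.span {2}
  have hN : ∀ b, h b ∈ N := fun b => Submodule.subset_span ⟨b, rfl⟩
  have h2 : ∀ b, h b + h b ∈ I • N := fun b => by
    rw [← two_zsmul]
    exact Submodule.smul_mem_smul (Ideal.mem_span_singleton_self 2) (hN b)
  -- By the colouring relation, the two under-passing differences at a crossing have sum in `2 N`.
  -- So membership in `2 N` propagates along the knot, starting from the zero difference at the
  -- right end.
  have key : ∀ p : D.Point, h (bridge p) ∈ I • N := by
    refine forall_of_link ?_ ?_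
    · intro k p q hpq
      by_cases hk : k = .plain
      · subst hk; rw [bridge_eq_of_link hpq]
      · have hc : ∀ c : D.Crossing, h (bridge (c.point c.underIn)) + h (bridge (c.point c.underOut))
            ∈ I • N := by
          intro c
          have := pairClass_add c
          have e : h (bridge (c.point c.underIn)) + h (bridge (c.point c.underOut)) =
              h (bridge (c.point c.overIn)) + h (bridge (c.point c.overIn)) := by
            simp only [h]
            linear_combination (norm := module) this
          rw [e]
          exact h2 _
        obtain ⟨c, ⟨-, ⟨rfl, rfl⟩ | ⟨rfl, rfl⟩⟩ | ⟨-, ⟨rfl, rfl⟩ | ⟨rfl, rfl⟩⟩⟩ :=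
          exists_ends_of_link hk hpq
        · rw [c.bridge_leftSide]
        · rw [c.bridge_leftSide]
        · exact ⟨fun h3 => ((I • N).add_mem_iff_right h3).1 (hc c),
            fun h3 => ((I • N).add_mem_iff_left h3).1 (hc c)⟩
        · exact ⟨fun h3 => ((I • N).add_mem_iff_left h3).1 (hc c),
            fun h3 => ((I • N).add_mem_iff_right h3).1 (hc c)⟩
    · have : h (bridge D.rightEnd) = 0 := sub_self _
      rw [this]
      exact zero_mem _
  have hle : N ≤ I • N := by
    refine Submodule.span_le.2 ?_
    rintro _ ⟨b, rfl⟩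
    obtain ⟨p, rfl⟩ := Quot.exists_rep b
    exact key p
  -- Nakayama's lemma for `N = 2 N`; finite generation comes from the finiteness of the set of
  -- bridges. The resulting `r` is odd, hence not zero.
  obtain ⟨r, hr, hr0⟩ := Submodule.exists_sub_one_mem_and_smul_eq_zero_of_fg_of_le_smul I N
    (Submodule.fg_span (Set.finite_range h)) hle
  refine isOfFinAddOrder_iff_zsmul_eq_zero.2 ⟨r, ?_, hr0 _ (hN b)⟩
  rintro rfl
  rw [Ideal.mem_span_singleton] at hr
  omega

/-- Agreement on the torsion elements `pairClass b - pairClass D.base` means that the two colourings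
differ by one constant, which the exponent does not see. -/
theorem exponent_eq_of_torsion {φ ψ : D.H1 →+ UnitAddCircle}
    (h : ∀ x : D.H1, IsOfFinAddOrder x → φ x = ψ x) :
    exponent (D.ofCohomology φ) = exponent (D.ofCohomology ψ) := by
  rw [← exponent_add_const (isColouring_ofCohomology ψ) (φ (pairClass D.base) -
    ψ (pairClass D.base))]
  congr 1
  funext b
  have := h _ (isOfFinAddOrder_sub b)
  rw [map_sub, map_sub] at this
  change φ (pairClass b) = ψ (pairClass b) + _
  linear_combination (norm := module) this

end LongDiagram

end LongKnot

open LongKnot LongDiagram in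
theorem theorem1 :
    -- admissible assignments exist, and the set of solutions does not depend on their choice
    (∀ D : LongDiagram, Nonempty D.Admissible) ∧
    (∀ (D : LongDiagram) (A : D.Admissible), proj '' A.realSolutions = D.solutions) ∧
    -- identification with the first cohomology group of the double cyclic cover
    (∀ D : LongDiagram, Set.BijOn D.ofCohomology Set.univ D.solutions) ∧
    ∃ f : ∀ D : LongDiagram, D.solutions → Circle,
      -- the exponential of the action functional factors through `f`
      (∀ (D : LongDiagram) (A : D.Admissible) (x : D.Bridge → ℝ) (hx : x ∈ A.realSolutions),
        Circle.exp (2 * Real.pi * evalAt x A.action) = f D ⟨proj x, proj_mem A hx⟩) ∧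
      -- invariance under all Reidemeister moves, through the natural bijection
      (∀ (D E : LongDiagram) (M : Move D E),
        (∀ ξ : D.solutions, ∃! η : E.solutions, M.Corresponds ξ.1 η.1) ∧
        (∀ η : E.solutions, ∃! ξ : D.solutions, M.Corresponds ξ.1 η.1) ∧
        ∀ (ξ : D.solutions) (η : E.solutions), M.Corresponds ξ.1 η.1 → f D ξ = f E η) ∧
      -- independence of the image of the free generator
      (∀ (D : LongDiagram) (ξ η : D.solutions) (φ ψ : D.H1 →+ UnitAddCircle),
        D.ofCohomology φ = ξ.1 → D.ofCohomology ψ = η.1 →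
        (∀ h : D.H1, IsOfFinAddOrder h → φ h = ψ h) → f D ξ = f D η) := by
  refine ⟨fun D => ⟨D.indexAdmissible⟩, fun D A => ?_, bijOn_ofCohomology,
    fun D ξ => invariant ξ.1, fun D A x hx => A.exp_action hx, fun D E M => ⟨?_, ?_, ?_⟩, ?_⟩
  · rw [A.image_realSolutions, D.solutions_eq]
  · rintro ⟨ξ, hξ⟩
    obtain ⟨η, ⟨h1, h2⟩, h3⟩ := M.existsUnique_target (mem_solutions_iff.1 hξ)
    exact ⟨⟨η, mem_solutions_iff.2 h1⟩, h2, fun η' h' =>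
      Subtype.ext (h3 _ ⟨mem_solutions_iff.1 η'.2, h'⟩)⟩
  · rintro ⟨η, hη⟩
    obtain ⟨ξ, ⟨h1, h2⟩, h3⟩ := M.existsUnique_source (mem_solutions_iff.1 hη)
    exact ⟨⟨ξ, mem_solutions_iff.2 h1⟩, h2, fun ξ' h' =>
      Subtype.ext (h3 _ ⟨mem_solutions_iff.1 ξ'.2, h'⟩)⟩
  · rintro ⟨ξ, hξ⟩ ⟨η, hη⟩ h
    exact congrArg AddCircle.toCircle
      (M.exponent_eq (mem_solutions_iff.1 hξ) (mem_solutions_iff.1 hη) h)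
  · intro D ξ η φ ψ hφ hψ h
    simp only [← hφ, ← hψ]
    exact congrArg AddCircle.toCircle (exponent_eq_of_torsion h)
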